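/- **Setting.** All manifolds are finite-dimensional, without boundary, and all objects are $C^\infty$. Let $(M,\varphi,\xi,\eta,g)$ be an almost contact metric manifold, that is, a Riemannian manifold $(M,g)$ with a field $\varphi$ of endomorphisms of $TM$, a vector field $\xi$ and a 1-form $\eta$ such that $\varphi^2=-I+\eta\otimes\xi$, $\eta(\xi)=1$ and $g(\varphi X,\varphi Y)=g(X,Y)-\eta(X)\eta(Y)$; its fundamental form is $\Phi(X,Y)=g(X,\varphi Y)$. Let $(N,J,g')$ be an almost Hermitian manifold, with fundamental form $\Omega(X',Y')=g'(X',JY')$; it is Kähler if the Nijenhuis tensor of $J$ vanishes and $d\Omega=0$. A *contact-complex Riemannian submersion* $\pi:M\to N$ is a surjective submersion such that $d\pi_x$ is isometric on the horizontal space $\mathcal H_x=(\ker d\pi_x)^\perp$ for every $x\in M$, and $J\circ d\pi=d\pi\circ\varphi$. Let $v$ and $h$ be the orthogonal projections of $TM$ onto $\mathcal V=\ker d\pi$ and $\mathcal H$, let $\nabla$ be the Levi-Civita connection of $g$, and put $$A_{X}Y=v\nabla_{hX}hY+h\nabla_{hX}vY,$$ $$B(X,Y)=v\nabla_{hX}\varphi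 hY-v\nabla_{\varphi hX}hY+h\nabla_{hX}\varphi vY-h\nabla_{\varphi hX}vY .$$ Let $\operatorname{Tr}B^h=\sum_i B(e_i,e_i)$, with $(e_i)$ an orthonormal basis of $\mathcal H_x$, be the trace of the restriction $B^h$ of $B$ to $\mathcal H$. The manifold $M$ is *almost cosymplectic with Kähler leaves* if $d\eta=0$, $d\Phi=0$, and the integral manifolds of the distribution $\ker\eta$, with the metric induced by $g$ and the almost complex structure induced by $\varphi$, are Kähler. **Theorem.** Let $\pi:M\to N$ be a contact-complex Riemannian submersion, and suppose that $M$ is almost cosymplectic with Kähler leaves. Then: (i) $N$ is Kähler if and only if $A_X\xi=0$ for every horizontal $X$. (ii) The fundamental form $\Omega$ of $N$ is harmonic, that is, $\Delta\Omega=(d\delta+\delta d)\Omega=0$, if and only if $\operatorname{Tr}B^h=0$ on $M$. -/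

import Mathlib

open Bundle
open scoped Manifold ContDiff

noncomputable section

namespace ContactComplex

/-! ### Tensor calculus on a smooth manifold

`M` is a smooth manifold modelled on a real normed space `E` (without boundary). -/

section Calculus

variable {E : Type*} [NormedAddCommGroup E] [NormedSpace ℝ E]
  {M : Type*} [TopologicalSpace M] [ChartedSpace E M] [IsManifold 𝓘(ℝ, E) ∞ M]

/-- A vector field near `x` with value `v` at `x`, smooth near `x`. The expressions below in which
it is used are tensorial, hence do not depend on which extension is taken. -/
def ext {x : M} (v : TangentSpace 𝓘(ℝ, E) x) : Π y : M, TangentSpace 𝓘(ℝ, E) y :=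
  FiberBundle.extend E v

/-- The exterior derivative of a 1-form:
`dθ(U, V) = U θ(V) - V θ(U) - θ([U, V])`. -/
def dOne (θ : Π x : M, TangentSpace 𝓘(ℝ, E) x → ℝ) (x : M) (u v : TangentSpace 𝓘(ℝ, E) x) : ℝ :=
  mvfderiv 𝓘(ℝ, E) (fun y ↦ θ y (ext v y)) x u
    - mvfderiv 𝓘(ℝ, E) (fun y ↦ θ y (ext u y)) x v
    - θ x (VectorField.mlieBracket 𝓘(ℝ, E) (ext u) (ext v) x)

/-- The exterior derivative of a 2-form:
`dα(U, V, W) = U α(V, W) - V α(U, W) + W α(U, V) - α([U, V], W) + α([U, W], V) - α([V, W], U)`. -/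
def dTwo (α : Π x : M, TangentSpace 𝓘(ℝ, E) x → TangentSpace 𝓘(ℝ, E) x → ℝ)
    (x : M) (u v w : TangentSpace 𝓘(ℝ, E) x) : ℝ :=
  mvfderiv 𝓘(ℝ, E) (fun y ↦ α y (ext v y) (ext w y)) x u
    - mvfderiv 𝓘(ℝ, E) (fun y ↦ α y (ext u y) (ext w y)) x v
    + mvfderiv 𝓘(ℝ, E) (fun y ↦ α y (ext u y) (ext v y)) x w
    - α x (VectorField.mlieBracket 𝓘(ℝ, E) (ext u) (ext v) x) w
    + α x (VectorField.mlieBracket 𝓘(ℝ, E) (ext u) (ext w) x) v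
    - α x (VectorField.mlieBracket 𝓘(ℝ, E) (ext v) (ext w) x) u

/-- The Nijenhuis tensor of a field of endomorphisms `J` of the tangent spaces:
`N_J(U, V) = J²[U, V] + [JU, JV] - J[JU, V] - J[U, JV]`. -/
def nijenhuis (J : Π x : M, TangentSpace 𝓘(ℝ, E) x →L[ℝ] TangentSpace 𝓘(ℝ, E) x)
    (x : M) (u v : TangentSpace 𝓘(ℝ, E) x) : TangentSpace 𝓘(ℝ, E) x :=
  J x (J x (VectorField.mlieBracket 𝓘(ℝ, E) (ext u) (ext v) x))
    + VectorField.mlieBracket 𝓘(ℝ, E) (fun y ↦ J y (ext u y)) (fun y ↦ J y (ext v y)) x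
    - J x (VectorField.mlieBracket 𝓘(ℝ, E) (fun y ↦ J y (ext u y)) (ext v) x)
    - J x (VectorField.mlieBracket 𝓘(ℝ, E) (ext u) (fun y ↦ J y (ext v y)) x)

/-- The almost Hermitian structure `(g, J)` is Kähler: the almost complex structure `J` is
integrable (its Nijenhuis tensor vanishes) and the fundamental 2-form `(u, v) ↦ g(u, J v)` is
closed. -/
def IsKahler (g : Π x : M, TangentSpace 𝓘(ℝ, E) x → TangentSpace 𝓘(ℝ, E) x → ℝ)
    (J : Π x : M, TangentSpace 𝓘(ℝ, E) x →L[ℝ] TangentSpace 𝓘(ℝ, E) x) : Prop :=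
  (∀ (x : M) (u v : TangentSpace 𝓘(ℝ, E) x), nijenhuis J x u v = 0) ∧
    ∀ (x : M) (u v w : TangentSpace 𝓘(ℝ, E) x),
      dTwo (fun y a b ↦ g y a (J y b)) x u v w = 0

end Calculus

/-! ### Riemannian manifolds: Levi-Civita connection, codifferential, Laplacian -/

section Riemannian

variable {E : Type*} [NormedAddCommGroup E] [NormedSpace ℝ E] [FiniteDimensional ℝ E]
  {M : Type*} [TopologicalSpace M] [ChartedSpace E M] [IsManifold 𝓘(ℝ, E) ∞ M]
  [RiemannianBundle (fun x : M ↦ TangentSpace 𝓘(ℝ, E) x)]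

instance (x : M) : FiniteDimensional ℝ (TangentSpace 𝓘(ℝ, E) x) :=
  inferInstanceAs (FiniteDimensional ℝ E)

/-- The right-hand side of the Koszul formula for `g(∇_X Y, Z)`. -/
def koszul (X Y Z : Π x : M, TangentSpace 𝓘(ℝ, E) x) (x : M) : ℝ :=
  (1 / 2 : ℝ) *
    (mvfderiv 𝓘(ℝ, E) (fun y ↦ inner ℝ (Y y) (Z y)) x (X x)
      + mvfderiv 𝓘(ℝ, E) (fun y ↦ inner ℝ (Z y) (X y)) x (Y x)
      - mvfderiv 𝓘(ℝ, E) (fun y ↦ inner ℝ (X y) (Y y)) x (Z x)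
      + inner ℝ (VectorField.mlieBracket 𝓘(ℝ, E) X Y x) (Z x)
      - inner ℝ (VectorField.mlieBracket 𝓘(ℝ, E) Y Z x) (X x)
      + inner ℝ (VectorField.mlieBracket 𝓘(ℝ, E) Z X x) (Y x))

/-- The Levi-Civita connection: `leviCivita u Y` is `∇_u Y`, the tangent vector at `x` whose inner
product with every `z` is given by the Koszul formula (expanded in an orthonormal basis). -/
def leviCivita {x : M} (u : TangentSpace 𝓘(ℝ, E) x) (Y : Π y : M, TangentSpace 𝓘(ℝ, E) y) :
    TangentSpace 𝓘(ℝ, E) x :=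
  ∑ i, koszul (ext u) Y (ext (stdOrthonormalBasis ℝ (TangentSpace 𝓘(ℝ, E) x) i)) x •
    stdOrthonormalBasis ℝ (TangentSpace 𝓘(ℝ, E) x) i

/-- The covariant derivative of a 2-form: `(∇_u α)(v, w)`. -/
def covTwo (α : Π x : M, TangentSpace 𝓘(ℝ, E) x → TangentSpace 𝓘(ℝ, E) x → ℝ)
    (x : M) (u v w : TangentSpace 𝓘(ℝ, E) x) : ℝ :=
  mvfderiv 𝓘(ℝ, E) (fun y ↦ α y (ext v y) (ext w y)) x u
    - α x (leviCivita u (ext v)) w - α x v (leviCivita u (ext w))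

/-- The covariant derivative of a 3-form: `(∇_u β)(v, w, z)`. -/
def covThree
    (β : Π x : M, TangentSpace 𝓘(ℝ, E) x → TangentSpace 𝓘(ℝ, E) x → TangentSpace 𝓘(ℝ, E) x → ℝ)
    (x : M) (u v w z : TangentSpace 𝓘(ℝ, E) x) : ℝ :=
  mvfderiv 𝓘(ℝ, E) (fun y ↦ β y (ext v y) (ext w y) (ext z y)) x u
    - β x (leviCivita u (ext v)) w z - β x v (leviCivita u (ext w)) z
    - β x v w (leviCivita u (ext z))

/-- The codifferential of a 2-form: `(δα)(v) = - ∑ i, (∇_{e_i} α)(e_i, v)`. -/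
def codiffTwo (α : Π x : M, TangentSpace 𝓘(ℝ, E) x → TangentSpace 𝓘(ℝ, E) x → ℝ)
    (x : M) (v : TangentSpace 𝓘(ℝ, E) x) : ℝ :=
  - ∑ i, covTwo α x (stdOrthonormalBasis ℝ (TangentSpace 𝓘(ℝ, E) x) i)
      (stdOrthonormalBasis ℝ (TangentSpace 𝓘(ℝ, E) x) i) v

/-- The codifferential of a 3-form: `(δβ)(v, w) = - ∑ i, (∇_{e_i} β)(e_i, v, w)`. -/
def codiffThree
    (β : Π x : M, TangentSpace 𝓘(ℝ, E) x → TangentSpace 𝓘(ℝ, E) x → TangentSpace 𝓘(ℝ, E) x → ℝ)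
    (x : M) (v w : TangentSpace 𝓘(ℝ, E) x) : ℝ :=
  - ∑ i, covThree β x (stdOrthonormalBasis ℝ (TangentSpace 𝓘(ℝ, E) x) i)
      (stdOrthonormalBasis ℝ (TangentSpace 𝓘(ℝ, E) x) i) v w

/-- A 2-form is harmonic: `Δα = (dδ + δd)α = 0`. -/
def IsHarmonic (α : Π x : M, TangentSpace 𝓘(ℝ, E) x → TangentSpace 𝓘(ℝ, E) x → ℝ) : Prop :=
  ∀ (x : M) (u v : TangentSpace 𝓘(ℝ, E) x),
    dOne (codiffTwo α) x u v + codiffThree (dTwo α) x u v = 0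

variable (E M)

/-- A smooth almost contact metric structure `(φ, ξ, η)` on the Riemannian manifold `M`. -/
structure AlmostContactMetric where
  φ : Π x : M, TangentSpace 𝓘(ℝ, E) x →L[ℝ] TangentSpace 𝓘(ℝ, E) x
  ξ : Π x : M, TangentSpace 𝓘(ℝ, E) x
  η : Π x : M, TangentSpace 𝓘(ℝ, E) x →L[ℝ] ℝ
  contMDiff_φ : ContMDiff 𝓘(ℝ, E) (𝓘(ℝ, E).prod 𝓘(ℝ, E →L[ℝ] E)) ∞
    (fun x ↦ Bundle.TotalSpace.mk' (E →L[ℝ] E)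
      (E := fun y : M ↦ TangentSpace 𝓘(ℝ, E) y →L[ℝ] TangentSpace 𝓘(ℝ, E) y) x (φ x))
  contMDiff_ξ : ContMDiff 𝓘(ℝ, E) 𝓘(ℝ, E).tangent ∞ (fun x ↦ (⟨x, ξ x⟩ : TangentBundle 𝓘(ℝ, E) M))
  contMDiff_η : ContMDiff 𝓘(ℝ, E) (𝓘(ℝ, E).prod 𝓘(ℝ, E →L[ℝ] ℝ)) ∞
    (fun x ↦ Bundle.TotalSpace.mk' (E →L[ℝ] ℝ)
      (E := fun y : M ↦ TangentSpace 𝓘(ℝ, E) y →L[ℝ] Bundle.Trivial M ℝ y) x (η x))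
  φ_φ : ∀ (x : M) (v : TangentSpace 𝓘(ℝ, E) x), φ x (φ x v) = -v + η x v • ξ x
  η_ξ : ∀ x : M, η x (ξ x) = 1
  inner_φ_φ : ∀ (x : M) (u v : TangentSpace 𝓘(ℝ, E) x),
    inner ℝ (φ x u) (φ x v) = inner ℝ u v - η x u * η x v

/-- A smooth almost complex structure `J` compatible with the metric of the Riemannian
manifold `M`. -/
structure AlmostHermitian where
  J : Π x : M, TangentSpace 𝓘(ℝ, E) x →L[ℝ] TangentSpace 𝓘(ℝ, E) x
  contMDiff_J : ContMDiff 𝓘(ℝ, E) (𝓘(ℝ, E).prod 𝓘(ℝ, E →L[ℝ] E)) ∞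
    (fun x ↦ Bundle.TotalSpace.mk' (E →L[ℝ] E)
      (E := fun y : M ↦ TangentSpace 𝓘(ℝ, E) y →L[ℝ] TangentSpace 𝓘(ℝ, E) y) x (J x))
  J_J : ∀ (x : M) (v : TangentSpace 𝓘(ℝ, E) x), J x (J x v) = -v
  inner_J_J : ∀ (x : M) (u v : TangentSpace 𝓘(ℝ, E) x),
    inner ℝ (J x u) (J x v) = inner ℝ u v

variable {E M}

/-- The fundamental form `Ω(u, v) = g(u, J v)`. -/
def AlmostHermitian.fundamentalForm (T : AlmostHermitian E M) (x : M)
    (u v : TangentSpace 𝓘(ℝ, E) x) : ℝ :=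
  inner ℝ u (T.J x v)

/-- The almost Hermitian manifold is Kähler. -/
def AlmostHermitian.Kahler (T : AlmostHermitian E M) : Prop :=
  IsKahler (fun _ u v ↦ inner ℝ u v) T.J

namespace AlmostContactMetric

variable (S : AlmostContactMetric E M)

/-- The fundamental form `Φ(u, v) = g(u, φ v)`. -/
def fundamentalForm (x : M) (u v : TangentSpace 𝓘(ℝ, E) x) : ℝ :=
  inner ℝ u (S.φ x v)

/-- `M` is almost cosymplectic: `dη = 0` and `dΦ = 0`. -/
def AlmostCosymplectic : Prop :=
  (∀ (x : M) (u v : TangentSpace 𝓘(ℝ, E) x), dOne (fun y w ↦ S.η y w) x u v = 0) ∧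
    ∀ (x : M) (u v w : TangentSpace 𝓘(ℝ, E) x), dTwo S.fundamentalForm x u v w = 0

/-- `ι : L → M` is an immersed integral manifold of the distribution `D = ker η`. -/
def IsIntegralManifold (k : ℕ) {L : Type} [TopologicalSpace L]
    [ChartedSpace (EuclideanSpace ℝ (Fin k)) L] (ι : L → M) : Prop :=
  ContMDiff (𝓡 k) 𝓘(ℝ, E) ∞ ι ∧
    ∀ x : L, Function.Injective (mfderiv (𝓡 k) 𝓘(ℝ, E) ι x) ∧
      Set.range (mfderiv (𝓡 k) 𝓘(ℝ, E) ι x) = {v | S.η (ι x) v = 0}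

/-- The leaves of the distribution `D = ker η` are Kähler: on every integral manifold `ι : L → M` of
`D`, the induced almost Hermitian structure, that is, the metric `ι^* g` and the almost complex
structure `J` that `dι` intertwines with the restriction of `φ` to `D`, is Kähler.
(An integral manifold is locally an open piece of a leaf, and being Kähler is a local property;
so it is the same to ask this of all integral manifolds or of the maximal ones, the leaves.) -/
def HasKahlerLeaves : Prop :=
  ∀ (k : ℕ) (L : Type) [TopologicalSpace L] [ChartedSpace (EuclideanSpace ℝ (Fin k)) L]
    [IsManifold (𝓡 k) ∞ L] [T2Space L] [SecondCountableTopology L] (ι : L → M),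
    S.IsIntegralManifold k ι →
    ∀ J : Π x : L, TangentSpace (𝓡 k) x →L[ℝ] TangentSpace (𝓡 k) x,
      (∀ (x : L) (v : TangentSpace (𝓡 k) x),
        mfderiv (𝓡 k) 𝓘(ℝ, E) ι x (J x v) = S.φ (ι x) (mfderiv (𝓡 k) 𝓘(ℝ, E) ι x v)) →
      IsKahler
        (fun x u v ↦ inner ℝ (mfderiv (𝓡 k) 𝓘(ℝ, E) ι x u) (mfderiv (𝓡 k) 𝓘(ℝ, E) ι x v)) J

end AlmostContactMetric

end Riemannian

/-! ### Contact-complex Riemannian submersions -/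

section Submersion

variable {E : Type*} [NormedAddCommGroup E] [NormedSpace ℝ E] [FiniteDimensional ℝ E]
  {M : Type*} [TopologicalSpace M] [ChartedSpace E M] [IsManifold 𝓘(ℝ, E) ∞ M]
  [RiemannianBundle (fun x : M ↦ TangentSpace 𝓘(ℝ, E) x)]
  {F : Type*} [NormedAddCommGroup F] [NormedSpace ℝ F]
  {N : Type*} [TopologicalSpace N] [ChartedSpace F N]

variable (E F) in
/-- The vertical space `ker df` at `x`. -/
def vertical (f : M → N) (x : M) : Submodule ℝ (TangentSpace 𝓘(ℝ, E) x) :=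
  LinearMap.ker (mfderiv 𝓘(ℝ, E) 𝓘(ℝ, F) f x).toLinearMap

variable (E F) in
/-- The horizontal space at `x`, the orthogonal complement of the vertical space. -/
def horizontal (f : M → N) (x : M) : Submodule ℝ (TangentSpace 𝓘(ℝ, E) x) :=
  (vertical E F f x)ᗮ

variable (F) in
/-- The vertical projection `v`. -/
def vproj (f : M → N) (x : M) (u : TangentSpace 𝓘(ℝ, E) x) : TangentSpace 𝓘(ℝ, E) x :=
  (vertical E F f x).starProjection u

variable (F) in
/-- The horizontal projection `h`. -/
def hproj (f : M → N) (x : M) (u : TangentSpace 𝓘(ℝ, E) x) : TangentSpace 𝓘(ℝ, E) x :=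
  (horizontal E F f x).starProjection u

variable (F) in
/-- O'Neill's tensor `A_X Y = v ∇_{hX} hY + h ∇_{hX} vY`, at the point `x`, with `u = X(x)`. -/
def oneillA (f : M → N) {x : M} (u : TangentSpace 𝓘(ℝ, E) x)
    (Y : Π y : M, TangentSpace 𝓘(ℝ, E) y) : TangentSpace 𝓘(ℝ, E) x :=
  vproj F f x (leviCivita (hproj F f x u) (fun y ↦ hproj F f y (Y y)))
    + hproj F f x (leviCivita (hproj F f x u) (fun y ↦ vproj F f y (Y y)))

variable (F) in
/-- The tensor
`B(X, Y) = v ∇_{hX} φhY - v ∇_{φhX} hY + h ∇_{hX} φvY - h ∇_{φhX} vY`,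
at the point `x`, with `u = X(x)`. -/
def tensorB (S : AlmostContactMetric E M) (f : M → N) {x : M} (u : TangentSpace 𝓘(ℝ, E) x)
    (Y : Π y : M, TangentSpace 𝓘(ℝ, E) y) : TangentSpace 𝓘(ℝ, E) x :=
  vproj F f x (leviCivita (hproj F f x u) (fun y ↦ S.φ y (hproj F f y (Y y))))
    - vproj F f x (leviCivita (S.φ x (hproj F f x u)) (fun y ↦ hproj F f y (Y y)))
    + hproj F f x (leviCivita (hproj F f x u) (fun y ↦ S.φ y (vproj F f y (Y y))))
    - hproj F f x (leviCivita (S.φ x (hproj F f x u)) (fun y ↦ vproj F f y (Y y)))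

variable (F) in
/-- `Tr B^h`, the trace of the restriction `B^h` of `B` to the horizontal distribution:
`∑ i, B(e_i, e_i)` over an orthonormal basis of the horizontal space. -/
def traceBh (S : AlmostContactMetric E M) (f : M → N) (x : M) : TangentSpace 𝓘(ℝ, E) x :=
  ∑ i, tensorB F S f (stdOrthonormalBasis ℝ (horizontal E F f x) i : TangentSpace 𝓘(ℝ, E) x)
    (ext (stdOrthonormalBasis ℝ (horizontal E F f x) i : TangentSpace 𝓘(ℝ, E) x))

variable [FiniteDimensional ℝ F] [IsManifold 𝓘(ℝ, F) ∞ N]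
  [RiemannianBundle (fun x : N ↦ TangentSpace 𝓘(ℝ, F) x)]

/-- `f` is a contact-complex Riemannian submersion: a smooth surjective submersion whose
differential is isometric on horizontal spaces and satisfies `J ∘ df = df ∘ φ`. -/
structure IsContactComplexSubmersion (S : AlmostContactMetric E M) (T : AlmostHermitian F N)
    (f : M → N) : Prop where
  contMDiff : ContMDiff 𝓘(ℝ, E) 𝓘(ℝ, F) ∞ f
  surjective : Function.Surjective f
  submersion : ∀ x : M, Function.Surjective (mfderiv 𝓘(ℝ, E) 𝓘(ℝ, F) f x)
  isometry : ∀ (x : M), ∀ u ∈ horizontal E F f x, ∀ v ∈ horizontal E F f x,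
    inner ℝ (mfderiv 𝓘(ℝ, E) 𝓘(ℝ, F) f x u) (mfderiv 𝓘(ℝ, E) 𝓘(ℝ, F) f x v) = inner ℝ u v
  holomorphic : ∀ (x : M) (u : TangentSpace 𝓘(ℝ, E) x),
    T.J (f x) (mfderiv 𝓘(ℝ, E) 𝓘(ℝ, F) f x u) = mfderiv 𝓘(ℝ, E) 𝓘(ℝ, F) f x (S.φ x u)

end Submersion

end ContactComplex

end

/-! Both equivalences hold because all four of their sides hold. The source is that the horizontal
distribution H is integrable and totally geodesic.

Since J² = -1 and φξ = 0, the relation J ∘ dπ = dπ ∘ φ makes ξ vertical, and φ preserves both V and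
H. Take X, Y horizontal and W vertical. On H the form Φ is the pull-back of Ω, and Φ(H, V) = 0, so
dΦ(X, Y, W) = 0 reduces to Φ([X, Y], W) = 0, the form π^*Ω being invariant along W. Putting φW for W
gives g([X, Y], W) = η(W) η([X, Y]), and the right side is zero because dη = 0 and η kills H. This
is `Flat.LocalSubmersion.integrable`. The metric on H is a pull-back as well (`lie_metric`), so the
Koszul formula reduces g(∇_X Y, W) and g(∇_X W, Y) to half of g(±[X, Y], W), hence to zero
(`conn_hor_ver`, `conn_ver_hor`). Every term of A and of B is the vertical part of such a ∇_X Y or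
the horizontal part of such a ∇_X W, so both tensors vanish.

On the base, dΩ = 0 is dΦ = 0 evaluated on horizontal vectors (`closed_Ω`). On any almost Hermitian
manifold a closed fundamental form is also coclosed (`trace_cov_eq_zero`), hence harmonic. For the
integrability of J, take an integral manifold of ker η through a point of M
(`Flat.exists_integral_manifold`). Its tangent spaces contain H, so it is mapped submersively and
holomorphically to N; by naturality (`Flat.nijenhuis_map`) the Nijenhuis tensor of J is the image of
that of the leaf, which is zero.

The arguments are local and are carried out in charts: `Flat.LocalSubmersion` lists what is needed
of the coordinate expressions around one point, and `IsContactComplexSubmersion.localSubmersion`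
supplies it. -/

noncomputable section

open Filter Topology

namespace ContactComplex

set_option synthInstance.maxHeartbeats 200000
set_option linter.unusedSectionVars false

/-! ### Calculus in a chart and pointwise almost contact algebra -/

namespace Flat

variable {E : Type*} [NormedAddCommGroup E] [NormedSpace ℝ E]
  {F : Type*} [NormedAddCommGroup F] [NormedSpace ℝ F]

/-- The Leibniz rule for a field of bilinear forms applied to two vector fields along a map. -/
lemma fderiv_bilin {D : Type*} [NormedAddCommGroup D] [NormedSpace ℝ D]
    {G : D → E →L[ℝ] E →L[ℝ] ℝ} {Y Z : D → E} {p : D}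
    (hG : DifferentiableAt ℝ G p) (hY : DifferentiableAt ℝ Y p) (hZ : DifferentiableAt ℝ Z p)
    (w : D) :
    fderiv ℝ (fun q ↦ G q (Y q) (Z q)) p w
      = fderiv ℝ G p w (Y p) (Z p) + G p (fderiv ℝ Y p w) (Z p) + G p (Y p) (fderiv ℝ Z p w) := by
  have h1 := ((hG.hasFDerivAt.clm_apply hY.hasFDerivAt).clm_apply hZ.hasFDerivAt).fderiv
  rw [h1]
  simp
  ring

lemma fderiv_clm_field {D : Type*} [NormedAddCommGroup D] [NormedSpace ℝ D]
    {G : D → E →L[ℝ] F} {Y : D → E} {p : D}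
    (hG : DifferentiableAt ℝ G p) (hY : DifferentiableAt ℝ Y p) (w : D) :
    fderiv ℝ (fun q ↦ G q (Y q)) p w = fderiv ℝ G p w (Y p) + G p (fderiv ℝ Y p w) := by
  rw [(hG.hasFDerivAt.clm_apply hY.hasFDerivAt).fderiv]
  simp [add_comm]

lemma fderiv_apply_congr {D : Type*} [NormedAddCommGroup D] [NormedSpace ℝ D] {a b : D → F} {p : D}
    (h : a =ᶠ[𝓝 p] b) (w : D) : fderiv ℝ a p w = fderiv ℝ b p w := by
  rw [h.fderiv_eq]

/-- The exterior derivative of a 2-form on a vector space. -/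
def dTwo (α : E → E → E → ℝ) (p u v w : E) : ℝ :=
  fderiv ℝ (fun q ↦ α q v w) p u - fderiv ℝ (fun q ↦ α q u w) p v
    + fderiv ℝ (fun q ↦ α q u v) p w

lemma fderiv_bilin_const {D : Type*} [NormedAddCommGroup D] [NormedSpace ℝ D]
    {G : D → E →L[ℝ] E →L[ℝ] ℝ} {p : D} (hG : DifferentiableAt ℝ G p) (u v : E) (w : D) :
    fderiv ℝ (fun q ↦ G q u v) p w = fderiv ℝ G p w u v := by
  rw [fderiv_bilin hG (differentiableAt_const u) (differentiableAt_const v)]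
  simp

/-- The value on `z` of the Koszul formula for the derivative along the constant field `u` of
the field `Y`. -/
def conn (g : E → E →L[ℝ] E →L[ℝ] ℝ) (Y : E → E) (p u z : E) : ℝ :=
  (1 / 2 : ℝ) * (fderiv ℝ (fun q ↦ g q (Y q) z) p u + fderiv ℝ (fun q ↦ g q z u) p (Y p)
    - fderiv ℝ (fun q ↦ g q u (Y q)) p z + g p (fderiv ℝ Y p u) z + g p (fderiv ℝ Y p z) u)

/-- The two terms that differentiate `Y` in the direction `z` cancel by symmetry of `g`. What
remains is the derivative of `Y` plus the Christoffel term, visibly linear in `z`. -/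
lemma conn_eq {g : E → E →L[ℝ] E →L[ℝ] ℝ} {Y : E → E} {p : E} (hg : DifferentiableAt ℝ g p)
    (hY : DifferentiableAt ℝ Y p) (hs : ∀ u v, g p u v = g p v u) (u z : E) :
    conn g Y p u z = g p (fderiv ℝ Y p u) z
      + (1 / 2 : ℝ) * (fderiv ℝ g p u (Y p) z + fderiv ℝ g p (Y p) z u
        - fderiv ℝ g p z u (Y p)) := by
  rw [conn, fderiv_bilin hg hY (differentiableAt_const z), fderiv_bilin_const hg,
    fderiv_bilin hg (differentiableAt_const u) hY]
  simp only [fderiv_fun_const, Pi.zero_apply, zero_apply, map_zero, hs u]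
  ring

/-- `u` is orthogonal to the kernel of `df` at `q`. -/
def Hor (g : E → E →L[ℝ] E →L[ℝ] ℝ) (f : E → F) (q u : E) : Prop :=
  ∀ k, fderiv ℝ f q k = 0 → g q u k = 0

/-- The 2-form `(u, v) ↦ g(u, φ v)`. -/
def form (g : E → E →L[ℝ] E →L[ℝ] ℝ) (φ : E → E →L[ℝ] E) (q : E) : E →L[ℝ] E →L[ℝ] ℝ :=
  ((ContinuousLinearMap.compL ℝ E E ℝ).flip (φ q)).comp (g q)

@[simp] lemma form_apply (g : E → E →L[ℝ] E →L[ℝ] ℝ) (φ : E → E →L[ℝ] E) (q u v : E) :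
    form g φ q u v = g q u (φ q v) := rfl

lemma differentiableAt_form {g : E → E →L[ℝ] E →L[ℝ] ℝ} {φ : E → E →L[ℝ] E} {p : E}
    (hg : DifferentiableAt ℝ g p) (hφ : DifferentiableAt ℝ φ p) :
    DifferentiableAt ℝ (form g φ) p :=
  DifferentiableAt.clm_comp
    (((ContinuousLinearMap.compL ℝ E E ℝ).flip.differentiableAt).comp p hφ) hg

/-- A Riemannian submersion with a compatible pair of structures, read in charts around `p`. -/
structure LocalSubmersion (g : E → E →L[ℝ] E →L[ℝ] ℝ) (φ : E → E →L[ℝ] E) (ξ : E → E)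
    (η : E → E →L[ℝ] ℝ) (f : E → F) (g' : F → F →L[ℝ] F →L[ℝ] ℝ) (J : F → F →L[ℝ] F)
    (p : E) : Prop where
  diff_g : DifferentiableAt ℝ g p
  diff_φ : DifferentiableAt ℝ φ p
  diff_η : DifferentiableAt ℝ η p
  diff_f : ContDiffAt ℝ 2 f p
  diff_g' : DifferentiableAt ℝ g' (f p)
  diff_J : DifferentiableAt ℝ J (f p)
  symm : ∀ᶠ q in 𝓝 p, ∀ u v, g q u v = g q v u
  pos : ∀ᶠ q in 𝓝 p, ∀ u, u ≠ 0 → 0 < g q u u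
  φ_φ : ∀ᶠ q in 𝓝 p, ∀ u, φ q (φ q u) = -u + η q u • ξ q
  η_ξ : ∀ᶠ q in 𝓝 p, η q (ξ q) = 1
  g_φ_φ : ∀ᶠ q in 𝓝 p, ∀ u v, g q (φ q u) (φ q v) = g q u v - η q u * η q v
  surj : ∀ᶠ q in 𝓝 p, Function.Surjective (fderiv ℝ f q)
  iso : ∀ᶠ q in 𝓝 p, ∀ u v, Hor g f q u → Hor g f q v →
    g' (f q) (fderiv ℝ f q u) (fderiv ℝ f q v) = g q u v
  hol : ∀ᶠ q in 𝓝 p, ∀ u, J (f q) (fderiv ℝ f q u) = fderiv ℝ f q (φ q u)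
  J_J : ∀ᶠ q in 𝓝 p, ∀ u, J (f q) (J (f q) u) = - u
  symm' : ∀ u v, g' (f p) u v = g' (f p) v u
  g_J_J : ∀ u v, g' (f p) (J (f p) u) (J (f p) v) = g' (f p) u v
  closed_η : ∀ u v, fderiv ℝ η p u v = fderiv ℝ η p v u
  closed_Φ : ∀ u v w, dTwo (fun q a b ↦ g q a (φ q b)) p u v w = 0

/-- A pointwise almost contact metric structure. -/
structure PointContact (g : E →L[ℝ] E →L[ℝ] ℝ) (φ : E →L[ℝ] E) (ξ : E) (η : E →L[ℝ] ℝ) :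
    Prop where
  symm : ∀ u v, g u v = g v u
  pos : ∀ u, u ≠ 0 → 0 < g u u
  φ_φ : ∀ u, φ (φ u) = -u + η u • ξ
  η_ξ : η ξ = 1
  g_φ_φ : ∀ u v, g (φ u) (φ v) = g u v - η u * η v

namespace PointContact

variable {g : E →L[ℝ] E →L[ℝ] ℝ} {φ : E →L[ℝ] E} {ξ : E} {η : E →L[ℝ] ℝ}

/-- From φ²ξ = 0 one gets φ²(φξ) = 0, so the formula for φ² shows φξ = λξ with λ = η(φξ). Then 0 =
φ²ξ = λ φξ, and either factor being zero gives φξ = 0. -/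
lemma φ_ξ (h : PointContact g φ ξ η) : φ ξ = 0 := by
  by_contra hne
  have h0 : φ (φ ξ) = 0 := by rw [h.φ_φ, h.η_ξ]; simp
  have h1 := h.g_φ_φ (φ ξ) (φ ξ)
  have h2 : φ (φ (φ ξ)) = 0 := by rw [h0]; simp
  have h3 := h.φ_φ (φ ξ)
  rw [h2] at h3
  have h4 : φ ξ = η (φ ξ) • ξ := by
    have : φ ξ = η (φ ξ) • ξ - 0 := by rw [h3]; abel
    simpa using this
  have h5 : φ (φ ξ) = η (φ ξ) • φ ξ := by
    conv_lhs => rw [h4]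
    simp
  rw [h0] at h5
  rcases smul_eq_zero.1 h5.symm with h6 | h6
  · rw [h6, zero_smul] at h4; exact hne h4
  · exact hne h6

/-- Compare the two ways of computing φ³u, as φ(φ²u) and as φ²(φu). -/
lemma η_φ (h : PointContact g φ ξ η) (u : E) : η (φ u) = 0 := by
  have hξ : ξ ≠ 0 := fun h0 ↦ by simpa [h0] using h.η_ξ
  have h1 : φ (φ (φ u)) = -φ u := by
    rw [h.φ_φ u, map_add, map_smul, h.φ_ξ]; simp
  rw [h.φ_φ (φ u)] at h1
  have h2 : η (φ u) • ξ = 0 := by simpa using h1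
  exact (smul_eq_zero.1 h2).resolve_right hξ

lemma g_ξ (h : PointContact g φ ξ η) (u : E) : g u ξ = η u := by
  have h1 := h.g_φ_φ u ξ
  rw [h.φ_ξ, h.η_ξ, map_zero] at h1
  linarith

lemma skew (h : PointContact g φ ξ η) (u v : E) : g (φ u) v = - g u (φ v) := by
  have h1 := h.g_φ_φ u (φ v)
  rw [h.φ_φ v, h.η_φ v] at h1
  simp only [map_add, map_neg, map_smul, h.g_ξ, h.η_φ, smul_eq_mul] at h1
  linarith

variable {A : E →L[ℝ] F} {J : F →L[ℝ] F}

lemma ver_φ (hol : ∀ u, J (A u) = A (φ u)) {k : E} (hk : A k = 0) : A (φ k) = 0 := by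
  rw [← hol, hk, map_zero]

/-- J kills the image of ξ, because φξ = 0, while J² = -1. -/
lemma ver_ξ (h : PointContact g φ ξ η) (hJ : ∀ u, J (J u) = -u)
    (hol : ∀ u, J (A u) = A (φ u)) : A ξ = 0 := by
  have h1 := hJ (A ξ)
  rw [hol ξ, h.φ_ξ] at h1
  simpa using h1.symm

/-- φ is skew for the metric and preserves the kernel of `A`, hence also the orthogonal complement
of that kernel. -/
lemma hor_φ (h : PointContact g φ ξ η) (hol : ∀ u, J (A u) = A (φ u)) {u : E}
    (hu : ∀ k, A k = 0 → g u k = 0) : ∀ k, A k = 0 → g (φ u) k = 0 := fun k hk ↦ by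
  rw [h.skew, hu _ (ver_φ hol hk), neg_zero]

end PointContact

end Flat

/-! ### Riemannian submersions in a chart: projections, closedness of Ω, integrability of H -/

namespace Flat

variable {E : Type*} [NormedAddCommGroup E] [NormedSpace ℝ E]
  {F : Type*} [NormedAddCommGroup F] [NormedSpace ℝ F]

lemma isInvertible_of_injective {V W : Type*} [NormedAddCommGroup V] [NormedSpace ℝ V]
    [FiniteDimensional ℝ V] [NormedAddCommGroup W] [NormedSpace ℝ W] [FiniteDimensional ℝ W]
    (hd : Module.finrank ℝ V = Module.finrank ℝ W) (T : V →L[ℝ] W)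
    (hT : ∀ v, T v = 0 → v = 0) : T.IsInvertible := by
  have hi : Function.Injective (T : V →ₗ[ℝ] W) :=
    (injective_iff_map_eq_zero (T : V →ₗ[ℝ] W)).2 hT
  refine ⟨(LinearMap.linearEquivOfInjective (T : V →ₗ[ℝ] W) hi hd).toContinuousLinearEquiv, ?_⟩
  ext v
  rfl

lemma finrank_clm_dual (V : Type*) [NormedAddCommGroup V] [NormedSpace ℝ V]
    [FiniteDimensional ℝ V] : Module.finrank ℝ (V →L[ℝ] ℝ) = Module.finrank ℝ V :=
  ((LinearMap.toContinuousLinearMap (𝕜 := ℝ) (E := V) (F' := ℝ)).finrank_eq).symm.trans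
    Subspace.dual_finrank_eq

lemma _root_.DifferentiableAt.clm_inverse {D V W : Type*} [NormedAddCommGroup D] [NormedSpace ℝ D]
    [NormedAddCommGroup V] [NormedSpace ℝ V] [CompleteSpace V]
    [NormedAddCommGroup W] [NormedSpace ℝ W] {T : D → V →L[ℝ] W} {p : D}
    (hT : DifferentiableAt ℝ T p) (hi : (T p).IsInvertible) :
    DifferentiableAt ℝ (fun q ↦ (T q).inverse) p := by
  obtain ⟨e, he⟩ := hi
  have h1 : DifferentiableAt ℝ ContinuousLinearMap.inverse (T p) := by
    rw [← he]
    exact (contDiffAt_map_inverse (n := 1) e).differentiableAt one_ne_zero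
  exact h1.comp p hT

/-- The orthogonal projection onto the horizontal spaces is differentiable. -/
lemma exists_horizontal_projection [FiniteDimensional ℝ E] [FiniteDimensional ℝ F]
    {g : E → E →L[ℝ] E →L[ℝ] ℝ} {f : E → F} {p : E} (hg : DifferentiableAt ℝ g p)
    (hf : ContDiffAt ℝ 2 f p) (hpos : ∀ᶠ q in 𝓝 p, ∀ u, u ≠ 0 → 0 < g q u u)
    (hsurj : ∀ᶠ q in 𝓝 p, Function.Surjective (fderiv ℝ f q)) :
    ∃ P : E → E →L[ℝ] E, DifferentiableAt ℝ P p ∧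
      ∀ᶠ q in 𝓝 p, ∀ u, Hor g f q (P q u) ∧ fderiv ℝ f q (P q u) = fderiv ℝ f q u := by
  have : CompleteSpace E := FiniteDimensional.complete ℝ E
  have : CompleteSpace F := FiniteDimensional.complete ℝ F
  let tr := (ContinuousLinearMap.compL ℝ E F ℝ).flip
  let A : E → E →L[ℝ] F := fderiv ℝ f
  have hA : DifferentiableAt ℝ A p :=
    (hf.fderiv_right (m := 1) (by norm_num)).differentiableAt one_ne_zero
  have htr : DifferentiableAt ℝ (fun q ↦ tr (A q)) p := DifferentiableAt.comp (g := tr) p tr.differentiableAt hA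
  -- The projection is the weighted pseudo-inverse formula P = g⁻¹Aᵗ(A g⁻¹Aᵗ)⁻¹A, with A = df. `M`
  -- is the factor to be inverted; since P is built from inverses and compositions, its
  -- differentiability is inherited from g and A.
  let M : E → (F →L[ℝ] ℝ) →L[ℝ] F := fun q ↦ A q ∘L (g q).inverse ∘L tr (A q)
  have invg : ∀ q, (∀ u, u ≠ 0 → 0 < g q u u) → (g q).IsInvertible := fun q hq ↦
    isInvertible_of_injective (finrank_clm_dual E).symm _ fun v hv ↦ by
      by_contra hne
      have := hq v hne
      rw [hv] at this
      simp at this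
  have ginv : ∀ q, (∀ u, u ≠ 0 → 0 < g q u u) → ∀ l, g q ((g q).inverse l) = l := fun q hq l ↦ by
    obtain ⟨e, he⟩ := invg q hq
    rw [← he]; simp
  have invM : ∀ q, (∀ u, u ≠ 0 → 0 < g q u u) → Function.Surjective (A q) →
      (M q).IsInvertible := fun q hq hs ↦
    isInvertible_of_injective (finrank_clm_dual F) _ fun l hl ↦ by
      -- If l is in the kernel of `M q`, then v = g⁻¹(l ∘ A) has g(v, v) = l(Av) = 0, so l ∘ A = 0
      -- and surjectivity of A gives l = 0.
      set v := (g q).inverse (tr (A q) l) with hv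
      have h1 : g q v = tr (A q) l := ginv q hq _
      have h2 : A q v = 0 := hl
      have h3 : g q v v = 0 := by
        rw [h1]
        change l (A q v) = 0
        rw [h2, map_zero]
      have h4 : v = 0 := by
        by_contra hne
        exact (hq v hne).ne' h3
      ext y
      obtain ⟨x, rfl⟩ := hs y
      have : tr (A q) l x = 0 := by rw [← h1, h4]; simp
      exact this
  have dgi : DifferentiableAt ℝ (fun q ↦ (g q).inverse) p :=
    hg.clm_inverse (invg p hpos.self_of_nhds)
  have dM : DifferentiableAt ℝ M p := hA.clm_comp (dgi.clm_comp htr)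
  have dMi : DifferentiableAt ℝ (fun q ↦ (M q).inverse) p :=
    dM.clm_inverse (invM p hpos.self_of_nhds hsurj.self_of_nhds)
  refine ⟨fun q ↦ (g q).inverse ∘L tr (A q) ∘L (M q).inverse ∘L A q,
    dgi.clm_comp (htr.clm_comp (dMi.clm_comp hA)), ?_⟩
  filter_upwards [hpos, hsurj] with q hq hs u
  constructor
  · intro k hk
    have h1 := ginv q hq (tr (A q) ((M q).inverse (A q u)))
    change g q ((g q).inverse (tr (A q) ((M q).inverse (A q u)))) k = 0
    rw [h1]
    change (M q).inverse (A q u) (A q k) = 0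
    rw [show A q k = 0 from hk, map_zero]
  · change M q ((M q).inverse (A q u)) = A q u
    obtain ⟨e, he⟩ := invM q hq hs
    rw [← he]; simp

/-- Differentiating `β(X, Z) = (f^* α)(X, Z)` in any direction when `β` and `f^* α` agree at the
base point as soon as one of the arguments is a value of `X` or `Z`. -/
lemma fderiv_eq_of_pullback {β : E → E →L[ℝ] E →L[ℝ] ℝ} {α : F → F →L[ℝ] F →L[ℝ] ℝ} {f : E → F}
    {p : E} {X Z : E → E} (hβ : DifferentiableAt ℝ β p) (hα : DifferentiableAt ℝ α (f p))
    (hf : ContDiffAt ℝ 2 f p) (hX : DifferentiableAt ℝ X p) (hZ : DifferentiableAt ℝ Z p)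
    (h : ∀ᶠ q in 𝓝 p, β q (X q) (Z q) = α (f q) (fderiv ℝ f q (X q)) (fderiv ℝ f q (Z q)))
    (hl : ∀ v, β p (X p) v = α (f p) (fderiv ℝ f p (X p)) (fderiv ℝ f p v))
    (hr : ∀ v, β p v (Z p) = α (f p) (fderiv ℝ f p v) (fderiv ℝ f p (Z p))) (w : E) :
    fderiv ℝ β p w (X p) (Z p)
      = fderiv ℝ α (f p) (fderiv ℝ f p w) (fderiv ℝ f p (X p)) (fderiv ℝ f p (Z p))
        + α (f p) (fderiv ℝ (fderiv ℝ f) p w (X p)) (fderiv ℝ f p (Z p))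
        + α (f p) (fderiv ℝ f p (X p)) (fderiv ℝ (fderiv ℝ f) p w (Z p)) := by
  have hA : DifferentiableAt ℝ (fderiv ℝ f) p :=
    (hf.fderiv_right (m := 1) (by norm_num)).differentiableAt one_ne_zero
  have hfd : DifferentiableAt ℝ f p := hf.differentiableAt two_ne_zero
  have h1 := fderiv_apply_congr h w
  have hαf : DifferentiableAt ℝ (fun q ↦ α (f q)) p := DifferentiableAt.comp (g := α) p hα hfd
  -- By `hl` and `hr` the terms in which `X` or `Z` is differentiated are the same on both sides and
  -- cancel; only derivatives of β, α and df survive.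
  rw [fderiv_bilin hβ hX hZ, fderiv_bilin hαf (hA.clm_apply hX) (hA.clm_apply hZ),
    fderiv_clm_field hA hX, fderiv_clm_field hA hZ, hl, hr] at h1
  have h2 : fderiv ℝ (fun q ↦ α (f q)) p w = fderiv ℝ α (f p) (fderiv ℝ f p w) := by
    have := fderiv_comp (g := α) p hα hfd
    rw [show (fun q ↦ α (f q)) = α ∘ f from rfl, this]
    rfl
  rw [h2] at h1
  simp only [map_add, add_apply] at h1
  linarith

namespace LocalSubmersion

variable {g : E → E →L[ℝ] E →L[ℝ] ℝ} {φ : E → E →L[ℝ] E} {ξ : E → E}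
  {η : E → E →L[ℝ] ℝ} {f : E → F} {g' : F → F →L[ℝ] F →L[ℝ] ℝ} {J : F → F →L[ℝ] F} {p : E}
  (h : LocalSubmersion g φ ξ η f g' J p)
include h

lemma contact : ∀ᶠ q in 𝓝 p, PointContact (g q) (φ q) (ξ q) (η q) := by
  filter_upwards [h.symm, h.pos, h.φ_φ, h.η_ξ, h.g_φ_φ] with q h1 h2 h3 h4 h5
  exact ⟨h1, h2, h3, h4, h5⟩

lemma diff_A : DifferentiableAt ℝ (fderiv ℝ f) p :=
  (h.diff_f.fderiv_right (m := 1) (by norm_num)).differentiableAt one_ne_zero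

lemma second_symm (u v : E) :
    fderiv ℝ (fderiv ℝ f) p u v = fderiv ℝ (fderiv ℝ f) p v u :=
  (h.diff_f.isSymmSndFDerivAt (by simp)) u v

/-- Differentiate df(W) = 0. This trades the unknown derivative of a vertical field for the second
derivative of f, whose symmetry makes such terms cancel later. -/
lemma fderiv_vertical {W : E → E} (hW : DifferentiableAt ℝ W p)
    (hv : ∀ᶠ q in 𝓝 p, fderiv ℝ f q (W q) = 0) (w : E) :
    fderiv ℝ f p (fderiv ℝ W p w) = - fderiv ℝ (fderiv ℝ f) p w (W p) := by
  have h1 := fderiv_apply_congr hv w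
  rw [fderiv_clm_field h.diff_A hW] at h1
  simp only [fderiv_fun_const, Pi.zero_apply, zero_apply] at h1
  exact eq_neg_of_add_eq_zero_right h1

lemma ver_ξ : ∀ᶠ q in 𝓝 p, fderiv ℝ f q (ξ q) = 0 := by
  filter_upwards [h.contact, h.J_J, h.hol] with q h1 h2 h3 using h1.ver_ξ h2 h3

variable [FiniteDimensional ℝ E] [FiniteDimensional ℝ F]

lemma exists_projection : ∃ P : E → E →L[ℝ] E, DifferentiableAt ℝ P p ∧
    ∀ᶠ q in 𝓝 p, ∀ u, Hor g f q (P q u) ∧ fderiv ℝ f q (P q u) = fderiv ℝ f q u :=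
  exists_horizontal_projection h.diff_g h.diff_f h.pos h.surj

/-- One horizontal argument suffices: the vertical part of the other contributes zero to both sides.
-/
lemma iso_left : ∀ᶠ q in 𝓝 p, ∀ u v, Hor g f q u →
    g q u v = g' (f q) (fderiv ℝ f q u) (fderiv ℝ f q v) := by
  obtain ⟨P, -, hP⟩ := h.exists_projection
  filter_upwards [hP, h.iso] with q hq hi u v hu
  rw [← (hq v).2, hi u _ hu (hq v).1]
  have h1 := hu (v - P q v) (by rw [map_sub, (hq v).2, sub_self])
  rw [map_sub] at h1
  linarith

lemma hor_eq_of_map_eq {u v : E} (hu : Hor g f p u) (hv : Hor g f p v)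
    (huv : fderiv ℝ f p u = fderiv ℝ f p v) : u = v := by
  by_contra hne
  have h1 := h.pos.self_of_nhds (u - v) (sub_ne_zero.2 hne)
  have hk : fderiv ℝ f p (u - v) = 0 := by rw [map_sub, huv, sub_self]
  have h2 := hu _ hk
  have h3 := hv _ hk
  have : g p (u - v) (u - v) = g p u (u - v) - g p v (u - v) := by
    rw [map_sub (g p) u v]; rfl
  rw [this, h2, h3] at h1
  simp at h1

/-- Horizontal vectors extend to differentiable horizontal fields. -/
lemma exists_hor_extension {u : E} (hu : Hor g f p u) :
    ∃ U : E → E, DifferentiableAt ℝ U p ∧ U p = u ∧ ∀ᶠ q in 𝓝 p, Hor g f q (U q) := by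
  obtain ⟨P, hP, hP'⟩ := h.exists_projection
  refine ⟨fun q ↦ P q u, hP.clm_apply (differentiableAt_const u), ?_, ?_⟩
  · exact h.hor_eq_of_map_eq (hP'.self_of_nhds u).1 hu (hP'.self_of_nhds u).2
  · filter_upwards [hP'] with q hq using (hq u).1

/-- Vertical vectors extend to differentiable vertical fields. -/
lemma exists_ver_extension {u : E} (hu : fderiv ℝ f p u = 0) :
    ∃ U : E → E, DifferentiableAt ℝ U p ∧ U p = u ∧ ∀ᶠ q in 𝓝 p, fderiv ℝ f q (U q) = 0 := by
  obtain ⟨P, hP, hP'⟩ := h.exists_projection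
  refine ⟨fun q ↦ u - P q u,
    (differentiableAt_const u).sub (hP.clm_apply (differentiableAt_const u)), ?_, ?_⟩
  · have : P p u = 0 := h.hor_eq_of_map_eq (hP'.self_of_nhds u).1
      (fun k _ ↦ by simp) (by rw [(hP'.self_of_nhds u).2, hu, map_zero])
    simp [this]
  · filter_upwards [hP'] with q hq
    rw [map_sub, (hq u).2, sub_self]

/-- The Lie derivative of the metric along a vertical field vanishes on horizontal vectors. -/
lemma lie_metric {Y : E → E} (hY : DifferentiableAt ℝ Y p)
    (hv : ∀ᶠ q in 𝓝 p, fderiv ℝ f q (Y q) = 0) {x z : E} (hx : Hor g f p x) (hz : Hor g f p z) :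
    fderiv ℝ g p (Y p) x z + g p (fderiv ℝ Y p x) z + g p x (fderiv ℝ Y p z) = 0 := by
  obtain ⟨X, hX, rfl, hX'⟩ := h.exists_hor_extension hx
  obtain ⟨Z, hZ, rfl, hZ'⟩ := h.exists_hor_extension hz
  have hl := h.iso_left
  have hl0 := hl.self_of_nhds
  have hs := h.symm.self_of_nhds
  have h1 := fderiv_eq_of_pullback h.diff_g h.diff_g' h.diff_f hX hZ
    (by filter_upwards [hl, hX'] with q h1 h2 using h1 _ _ h2)
    (fun v ↦ hl0 _ v hx) (fun v ↦ by rw [hs, h.symm', hl0 _ v hz]) (Y p)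
  -- Each derivative of the vertical field becomes minus a second derivative of f, which cancels the
  -- corresponding term of the pull-back formula; the derivative of `g'` is taken along df(Y) = 0.
  rw [h1, hs (fderiv ℝ Y p (X p)), hl0 _ _ hz, hl0 _ _ hx, h.fderiv_vertical hY hv,
    h.fderiv_vertical hY hv, hv.self_of_nhds, h.second_symm (Y p), h.second_symm (Y p),
    h.symm' (fderiv ℝ f p (Z p))]
  simp

lemma form_left : ∀ᶠ q in 𝓝 p, ∀ u v, Hor g f q u →
    form g φ q u v = form g' J (f q) (fderiv ℝ f q u) (fderiv ℝ f q v) := by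
  filter_upwards [h.iso_left, h.hol] with q h1 h2 u v hu
  rw [form_apply, form_apply, h1 _ _ hu, h2]

/-- The argument v being horizontal, so is φv; hence the isometry property can be used in the second
slot. -/
lemma form_right (u v : E) (hv : Hor g f p v) :
    form g φ p u v = form g' J (f p) (fderiv ℝ f p u) (fderiv ℝ f p v) := by
  have hc := h.contact.self_of_nhds
  rw [form_apply, form_apply, hc.symm, h.symm',
    h.iso_left.self_of_nhds _ _ (hc.hor_φ h.hol.self_of_nhds hv), h.hol.self_of_nhds]

lemma diff_Φ : DifferentiableAt ℝ (form g φ) p := differentiableAt_form h.diff_g h.diff_φ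

lemma diff_Ω : DifferentiableAt ℝ (form g' J) (f p) := differentiableAt_form h.diff_g' h.diff_J

lemma dTwo_Φ (u v w : E) : fderiv ℝ (form g φ) p u v w - fderiv ℝ (form g φ) p v u w
    + fderiv ℝ (form g φ) p w u v = 0 := by
  simp only [← fderiv_bilin_const h.diff_Φ]
  exact h.closed_Φ u v w

/-- On horizontal vectors Φ is the pull-back of Ω, so its derivative is that of f^*Ω, second
derivatives of f included. The direction `w` is unrestricted, which allows vertical directions too.
-/
lemma fderiv_Φ {x z : E} (hx : Hor g f p x) (hz : Hor g f p z) (w : E) :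
    fderiv ℝ (form g φ) p w x z
      = fderiv ℝ (form g' J) (f p) (fderiv ℝ f p w) (fderiv ℝ f p x) (fderiv ℝ f p z)
        + form g' J (f p) (fderiv ℝ (fderiv ℝ f) p w x) (fderiv ℝ f p z)
        + form g' J (f p) (fderiv ℝ f p x) (fderiv ℝ (fderiv ℝ f) p w z) := by
  obtain ⟨X, hX, rfl, hX'⟩ := h.exists_hor_extension hx
  obtain ⟨Z, hZ, rfl, hZ'⟩ := h.exists_hor_extension hz
  exact fderiv_eq_of_pullback h.diff_Φ h.diff_Ω h.diff_f hX hZ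
    (by filter_upwards [h.form_left, hX'] with q h1 h2 using h1 _ _ h2)
    (fun v ↦ h.form_left.self_of_nhds _ v hx) (fun v ↦ h.form_right v _ hz) w

lemma skew_Ω (u v : F) : form g' J (f p) u v = - form g' J (f p) v u := by
  have h1 := h.g_J_J u (J (f p) v)
  rw [h.J_J.self_of_nhds, map_neg, h.symm'] at h1
  simp only [form_apply]
  linarith

/-- The fundamental form of the base is closed. -/
lemma closed_Ω (u v w : F) : dTwo (fun q a b ↦ g' q a (J q b)) (f p) u v w = 0 := by
  obtain ⟨P, hP, hP'⟩ := h.exists_projection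
  have key : ∀ u : F, ∃ x, Hor g f p x ∧ fderiv ℝ f p x = u := fun u ↦ by
    obtain ⟨y, rfl⟩ := h.surj.self_of_nhds u
    exact ⟨P p y, hP'.self_of_nhds y⟩
  obtain ⟨x, hx, rfl⟩ := key u
  obtain ⟨y, hy, rfl⟩ := key v
  obtain ⟨z, hz, rfl⟩ := key w
  have h1 := h.dTwo_Φ x y z
  -- In the alternating sum the second derivatives of f cancel, because they are symmetric while Ω
  -- is skew.
  rw [h.fderiv_Φ hy hz, h.fderiv_Φ hx hz, h.fderiv_Φ hx hy, h.second_symm y x, h.second_symm z x,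
    h.second_symm z y, h.skew_Ω (fderiv ℝ f p x) (fderiv ℝ (fderiv ℝ f) p y z),
    h.skew_Ω (fderiv ℝ (fderiv ℝ f) p x z)] at h1
  change fderiv ℝ (fun q ↦ form g' J q _ _) (f p) _ - fderiv ℝ (fun q ↦ form g' J q _ _) (f p) _
    + fderiv ℝ (fun q ↦ form g' J q _ _) (f p) _ = 0
  simp only [fderiv_bilin_const h.diff_Ω]
  linarith

lemma hor_ver {X W : E → E} (hX : DifferentiableAt ℝ X p) (hW : DifferentiableAt ℝ W p)
    (hX' : ∀ᶠ q in 𝓝 p, Hor g f q (X q)) (hW' : ∀ᶠ q in 𝓝 p, fderiv ℝ f q (W q) = 0) (w : E) :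
    fderiv ℝ g p w (X p) (W p) + g p (fderiv ℝ X p w) (W p) + g p (X p) (fderiv ℝ W p w) = 0 := by
  rw [← fderiv_bilin h.diff_g hX hW]
  have : (fun q ↦ g q (X q) (W q)) =ᶠ[𝓝 p] fun _ ↦ 0 := by
    filter_upwards [hX', hW'] with q h1 h2 using h1 _ h2
  rw [this.fderiv_eq]; simp

/-- The horizontal distribution is integrable. -/
lemma integrable {X Y : E → E} (hX : DifferentiableAt ℝ X p) (hY : DifferentiableAt ℝ Y p)
    (hX' : ∀ᶠ q in 𝓝 p, Hor g f q (X q)) (hY' : ∀ᶠ q in 𝓝 p, Hor g f q (Y q)) {w : E}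
    (hw : fderiv ℝ f p w = 0) :
    g p (fderiv ℝ Y p (X p) - fderiv ℝ X p (Y p)) w = 0 := by
  have hc := h.contact.self_of_nhds
  have hx := hX'.self_of_nhds
  have hy := hY'.self_of_nhds
  -- Horizontal fields satisfy η(Z) = g(Z, ξ) = 0 because ξ is vertical; differentiate this
  -- identity.
  have hη : ∀ {Z : E → E}, DifferentiableAt ℝ Z p → (∀ᶠ q in 𝓝 p, Hor g f q (Z q)) → ∀ v,
      η p (fderiv ℝ Z p v) = - fderiv ℝ η p v (Z p) := by
    intro Z hZ hZ' v
    have h0 : (fun q ↦ η q (Z q)) =ᶠ[𝓝 p] fun _ ↦ 0 := by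
      filter_upwards [h.contact, hZ', h.ver_ξ] with q h1 h2 h3
      rw [← h1.g_ξ, h2 _ h3]
    have h1 := fderiv_apply_congr h0 v
    rw [fderiv_clm_field h.diff_η hZ] at h1
    simp only [fderiv_fun_const, Pi.zero_apply, zero_apply] at h1
    linarith
  have step1 : η p (fderiv ℝ Y p (X p) - fderiv ℝ X p (Y p)) = 0 := by
    rw [map_sub, hη hX hX', hη hY hY', h.closed_η]; ring
  have step2 : ∀ w, fderiv ℝ f p w = 0 →
      form g φ p (fderiv ℝ Y p (X p) - fderiv ℝ X p (Y p)) w = 0 := by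
    intro w hw
    obtain ⟨W, hW, rfl, hW'⟩ := h.exists_ver_extension hw
    -- Differentiate Φ(Z, W) = 0, valid for Z horizontal and W vertical since φ preserves the
    -- splitting.
    have hmix : ∀ {Z : E → E}, DifferentiableAt ℝ Z p → (∀ᶠ q in 𝓝 p, Hor g f q (Z q)) → ∀ v,
        fderiv ℝ (form g φ) p v (Z p) (W p) = - form g φ p (fderiv ℝ Z p v) (W p)
          + form g' J (f p) (fderiv ℝ f p (Z p)) (fderiv ℝ (fderiv ℝ f) p v (W p)) := by
      intro Z hZ hZ' v
      have h0 : (fun q ↦ form g φ q (Z q) (W q)) =ᶠ[𝓝 p] fun _ ↦ 0 := by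
        filter_upwards [h.form_left, hZ', hW'] with q h1 h2 h3
        rw [h1 _ _ h2, h3, map_zero]
      have h1 := fderiv_apply_congr h0 v
      rw [fderiv_bilin h.diff_Φ hZ hW, h.form_left.self_of_nhds _ (fderiv ℝ W p v) hZ'.self_of_nhds,
        h.fderiv_vertical hW hW'] at h1
      simp only [fderiv_fun_const, Pi.zero_apply, zero_apply, map_neg] at h1
      linarith
    -- In dΦ(X, Y, W) = 0 the derivative of Ω along df(W) is zero and the second derivatives of f
    -- cancel, leaving Φ([X, Y], W).
    have h1 := h.dTwo_Φ (X p) (Y p) (W p)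
    rw [hmix hX hX', hmix hY hY', h.fderiv_Φ hx hy, hw, h.second_symm (W p), h.second_symm (W p),
      h.skew_Ω (fderiv ℝ f p (Y p))] at h1
    rw [map_sub, sub_apply]
    simp only [map_zero, zero_apply] at h1
    linarith
  -- Φ(·, φw) = g(·, φ²w), and φ² = -1 up to the ξ-component, which `step1` removes.
  have h2 := step2 (φ p w) (PointContact.ver_φ h.hol.self_of_nhds hw)
  rw [form_apply, hc.φ_φ, map_add, map_neg, map_smul, hc.g_ξ, step1] at h2
  simp only [smul_zero, add_zero] at h2
  linarith

/-- For Y vertical, the Koszul formula gives 2g(∇_U Y, Z) = (L_Y g)(U, Z) + g([Z, U], Y). The first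
term is zero by `lie_metric`, the second by `integrable`. -/
lemma conn_ver_hor {Y : E → E} (hY : DifferentiableAt ℝ Y p)
    (hv : ∀ᶠ q in 𝓝 p, fderiv ℝ f q (Y q) = 0) {u z : E} (hu : Hor g f p u) (hz : Hor g f p z) :
    conn g Y p u z = 0 := by
  have hs := h.symm.self_of_nhds
  have h1 := h.lie_metric hY hv hu hz
  have hgs : ∀ a b c, fderiv ℝ g p a b c = fderiv ℝ g p a c b := by
    intro a b c
    rw [← fderiv_bilin_const h.diff_g, ← fderiv_bilin_const h.diff_g]
    refine fderiv_apply_congr ?_ a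
    filter_upwards [h.symm] with q hq using hq b c
  obtain ⟨U, hU, rfl, hU'⟩ := h.exists_hor_extension hu
  obtain ⟨Z, hZ, rfl, hZ'⟩ := h.exists_hor_extension hz
  have h2 := h.hor_ver hZ hY hZ' hv (U p)
  have h3 := h.hor_ver hU hY hU' hv (Z p)
  have h4 := h.integrable hU hZ hU' hZ' hv.self_of_nhds
  rw [map_sub, sub_apply] at h4
  rw [conn_eq h.diff_g hY hs, hgs _ (Z p) (U p), hgs _ (Y p)]
  rw [hs (Z p)] at h2
  linarith

/-- For Z vertical, the Koszul formula gives 2g(∇_U Y, Z) = g([U, Y], Z) - (L_Z g)(U, Y), and both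
terms vanish as in `conn_ver_hor`. -/
lemma conn_hor_ver {Y : E → E} (hY : DifferentiableAt ℝ Y p)
    (hh : ∀ᶠ q in 𝓝 p, Hor g f q (Y q)) {u z : E} (hu : Hor g f p u) (hz : fderiv ℝ f p z = 0) :
    conn g Y p u z = 0 := by
  have hs := h.symm.self_of_nhds
  have hgs : ∀ a b c, fderiv ℝ g p a b c = fderiv ℝ g p a c b := by
    intro a b c
    rw [← fderiv_bilin_const h.diff_g, ← fderiv_bilin_const h.diff_g]
    refine fderiv_apply_congr ?_ a
    filter_upwards [h.symm] with q hq using hq b c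
  obtain ⟨U, hU, rfl, hU'⟩ := h.exists_hor_extension hu
  obtain ⟨Z, hZ, rfl, hZ'⟩ := h.exists_ver_extension hz
  have h1 := h.lie_metric hZ hZ' hu hh.self_of_nhds
  have h2 := h.hor_ver hY hZ hh hZ' (U p)
  have h3 := h.hor_ver hU hZ hU' hZ' (Y p)
  have h4 := h.integrable hU hY hU' hh hZ'.self_of_nhds
  rw [map_sub, sub_apply] at h4
  rw [hs _ (Y p)] at h1
  rw [conn_eq h.diff_g hY hs, hgs _ (Z p) (U p)]
  linarith

end LocalSubmersion

end Flat

/-! ### The Nijenhuis tensor and the covariant derivative of a fundamental form in a chart -/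

namespace Flat

variable {E : Type*} [NormedAddCommGroup E] [NormedSpace ℝ E]
  {F : Type*} [NormedAddCommGroup F] [NormedSpace ℝ F]

/-- The Nijenhuis tensor of a field of endomorphisms of a vector space, on constant fields. -/
def nijenhuis (J : E → E →L[ℝ] E) (p u v : E) : E :=
  fderiv ℝ J p (J p u) v - fderiv ℝ J p (J p v) u + J p (fderiv ℝ J p v u)
    - J p (fderiv ℝ J p u v)

/-- The Nijenhuis tensor is natural under maps intertwining the endomorphisms. -/
lemma nijenhuis_map {J : E → E →L[ℝ] E} {J' : F → F →L[ℝ] F} {f : E → F} {p : E}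
    (hJ : DifferentiableAt ℝ J p) (hJ' : DifferentiableAt ℝ J' (f p)) (hf : ContDiffAt ℝ 2 f p)
    (h : ∀ᶠ q in 𝓝 p, ∀ u, J' (f q) (fderiv ℝ f q u) = fderiv ℝ f q (J q u)) (u v : E) :
    nijenhuis J' (f p) (fderiv ℝ f p u) (fderiv ℝ f p v) = fderiv ℝ f p (nijenhuis J p u v) := by
  have hA : DifferentiableAt ℝ (fderiv ℝ f) p :=
    (hf.fderiv_right (m := 1) (by norm_num)).differentiableAt one_ne_zero
  have hfd : DifferentiableAt ℝ f p := hf.differentiableAt two_ne_zero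
  have hJf : DifferentiableAt ℝ (fun q ↦ J' (f q)) p := DifferentiableAt.comp (g := J') p hJ' hfd
  have hs : ∀ a b, fderiv ℝ (fderiv ℝ f) p a b = fderiv ℝ (fderiv ℝ f) p b a := fun a b ↦
    (hf.isSymmSndFDerivAt (by simp)) a b
  have h2 : ∀ w, fderiv ℝ (fun q ↦ J' (f q)) p w = fderiv ℝ J' (f p) (fderiv ℝ f p w) := by
    intro w
    have := fderiv_comp (g := J') p hJ' hfd
    rw [show (fun q ↦ J' (f q)) = J' ∘ f from rfl, this]
    rfl
  -- Differentiate J' ∘ df = df ∘ J. When this is substituted in the Nijenhuis tensor, the second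
  -- derivatives of f cancel in pairs by symmetry.
  have key : ∀ w a, fderiv ℝ J' (f p) (fderiv ℝ f p w) (fderiv ℝ f p a)
      = fderiv ℝ (fderiv ℝ f) p w (J p a) + fderiv ℝ f p (fderiv ℝ J p w a)
        - J' (f p) (fderiv ℝ (fderiv ℝ f) p w a) := by
    intro w a
    have h1 := fderiv_apply_congr (h.mono fun q hq ↦ hq a :
      (fun q ↦ J' (f q) (fderiv ℝ f q a)) =ᶠ[𝓝 p] fun q ↦ fderiv ℝ f q (J q a)) w
    rw [fderiv_clm_field hJf (hA.clm_apply (differentiableAt_const a)),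
      fderiv_clm_field hA (differentiableAt_const a),
      fderiv_clm_field hA (hJ.clm_apply (differentiableAt_const a)),
      fderiv_clm_field hJ (differentiableAt_const a), h2] at h1
    simp only [fderiv_fun_const, Pi.zero_apply, zero_apply, map_zero, add_zero] at h1
    rw [← h1]; abel
  have h0 := h.self_of_nhds
  simp only [nijenhuis, h0, key, map_sub, map_add, hs (J p v) (J p u), hs (J p v) u, hs (J p u) v,
    hs v u]
  simp only [← h0]
  abel

/-- The covariant derivative of the 2-form `g(·, J ·)` for the Levi-Civita connection of `g`. -/
def covForm (g : E → E →L[ℝ] E →L[ℝ] ℝ) (J : E → E →L[ℝ] E) (p u v w : E) : ℝ :=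
  fderiv ℝ (form g J) p u v w
    - (1 / 2 : ℝ) * (fderiv ℝ g p u v (J p w) + fderiv ℝ g p v (J p w) u
        - fderiv ℝ g p (J p w) u v)
    + (1 / 2 : ℝ) * (fderiv ℝ g p u w (J p v) + fderiv ℝ g p w (J p v) u
        - fderiv ℝ g p (J p v) u w)

section Hermitian

variable {g : E → E →L[ℝ] E →L[ℝ] ℝ} {J : E → E →L[ℝ] E} {p : E}
  (hg : DifferentiableAt ℝ g p) (hJ : DifferentiableAt ℝ J p)
  (hs : ∀ᶠ q in 𝓝 p, ∀ u v, g q u v = g q v u)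
  (hJJ : ∀ᶠ q in 𝓝 p, ∀ u, J q (J q u) = -u)
  (hgJ : ∀ᶠ q in 𝓝 p, ∀ u v, g q (J q u) (J q v) = g q u v)
include hg hs

lemma fderiv_metric_symm (a b c : E) : fderiv ℝ g p a b c = fderiv ℝ g p a c b := by
  rw [← fderiv_bilin_const hg, ← fderiv_bilin_const hg]
  refine fderiv_apply_congr ?_ a
  filter_upwards [hs] with q hq using hq b c

include hJ hJJ hgJ

lemma covForm_swap (u v w : E) : covForm g J p u v w = - covForm g J p u w v := by
  have hΩ := differentiableAt_form hg hJ
  have h1 : fderiv ℝ (form g J) p u v w = - fderiv ℝ (form g J) p u w v := by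
    rw [← fderiv_bilin_const hΩ, ← fderiv_bilin_const hΩ, ← neg_apply, ← fderiv_fun_neg]
    refine fderiv_apply_congr ?_ u
    filter_upwards [hs, hJJ, hgJ] with q h1 h2 h3
    have := h3 v (J q w)
    rw [h2, map_neg, h1] at this
    simp only [form_apply]
    linarith
  rw [covForm, covForm, h1]
  ring

/-- The connection is torsion-free: the Christoffel terms cancel in the cyclic sum, which is
therefore dΩ(u, v, w). -/
lemma covForm_cyclic (hc : ∀ u v w, dTwo (fun q a b ↦ g q a (J q b)) p u v w = 0) (u v w : E) :
    covForm g J p u v w + covForm g J p v w u + covForm g J p w u v = 0 := by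
  have hΩ := differentiableAt_form hg hJ
  have h1 := hc u v w
  change fderiv ℝ (fun q ↦ form g J q _ _) p _ - fderiv ℝ (fun q ↦ form g J q _ _) p _
    + fderiv ℝ (fun q ↦ form g J q _ _) p _ = 0 at h1
  simp only [fderiv_bilin_const hΩ] at h1
  have h2 : fderiv ℝ (form g J) p v w u = - fderiv ℝ (form g J) p v u w := by
    have := covForm_swap hg hJ hs hJJ hgJ v w u
    rw [covForm, covForm] at this
    linarith
  have hsy := fderiv_metric_symm hg hs
  rw [covForm, covForm, covForm, h2, hsy u w, hsy v u, hsy w v, hsy v (J p w), hsy w (J p u),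
    hsy u (J p v), hsy w (J p v), hsy (J p v) w u, hsy u (J p w), hsy (J p w) v u,
    hsy (J p u) w v, hsy v (J p u)]
  linarith

/-- Differentiating J² = -1 shows that ∇_u J anticommutes with J. As (∇_u Ω)(v, w) = g(v, (∇_u J)w)
and J is skew, J passes from one argument to the other. -/
lemma covForm_J (u v w : E) : covForm g J p u (J p v) w = covForm g J p u v (J p w) := by
  have hform : ∀ a b, fderiv ℝ (form g J) p u a b
      = fderiv ℝ g p u a (J p b) + g p a (fderiv ℝ J p u b) := by
    intro a b
    rw [← fderiv_bilin_const (differentiableAt_form hg hJ)]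
    change fderiv ℝ (fun q ↦ g q a (J q b)) p u = _
    rw [fderiv_bilin hg (differentiableAt_const a) (hJ.clm_apply (differentiableAt_const b)),
      fderiv_clm_field hJ (differentiableAt_const b)]
    simp
  have hD : ∀ b, fderiv ℝ J p u (J p b) = - J p (fderiv ℝ J p u b) := by
    intro b
    have h1 := fderiv_apply_congr (hJJ.mono fun q hq ↦ hq b :
      (fun q ↦ J q (J q b)) =ᶠ[𝓝 p] fun q ↦ -b) u
    rw [fderiv_clm_field hJ (hJ.clm_apply (differentiableAt_const b)),
      fderiv_clm_field hJ (differentiableAt_const b)] at h1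
    simp only [fderiv_fun_const, Pi.zero_apply, zero_apply, map_zero, add_zero] at h1
    exact eq_neg_of_add_eq_zero_left h1
  have hskew : ∀ a b, g p (J p a) b = - g p a (J p b) := by
    intro a b
    have := hgJ.self_of_nhds a (J p b)
    rw [hJJ.self_of_nhds, map_neg] at this
    linarith
  have hsy := fderiv_metric_symm hg hs
  rw [covForm, covForm, hform, hform, hJJ.self_of_nhds, hJJ.self_of_nhds, hD, hskew]
  simp only [map_neg, neg_apply]
  rw [hsy u w v, hsy u (J p w) (J p v), hsy (J p v) (J p w) u, hsy (J p w) (J p v) u, hsy w v u,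
    hsy v w u]
  ring

end Hermitian

lemma covForm_isLinear₁ (g : E → E →L[ℝ] E →L[ℝ] ℝ) (J : E → E →L[ℝ] E) (p v w : E) :
    IsLinearMap ℝ fun u ↦ covForm g J p u v w :=
  ⟨fun a b ↦ by simp only [covForm, map_add, add_apply]; ring,
   fun c a ↦ by simp only [covForm, map_smul, smul_apply, smul_eq_mul]; ring⟩

lemma covForm_isLinear₂ (g : E → E →L[ℝ] E →L[ℝ] ℝ) (J : E → E →L[ℝ] E) (p u w : E) :
    IsLinearMap ℝ fun v ↦ covForm g J p u v w :=
  ⟨fun a b ↦ by simp only [covForm, map_add, add_apply]; ring,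
   fun c a ↦ by simp only [covForm, map_smul, smul_apply, smul_eq_mul]; ring⟩

lemma covForm_isLinear₃ (g : E → E →L[ℝ] E →L[ℝ] ℝ) (J : E → E →L[ℝ] E) (p u v : E) :
    IsLinearMap ℝ fun w ↦ covForm g J p u v w :=
  ⟨fun a b ↦ by simp only [covForm, map_add, add_apply]; ring,
   fun c a ↦ by simp only [covForm, map_smul, smul_apply, smul_eq_mul]; ring⟩

end Flat

/-! ### Almost Kähler fundamental forms are coclosed: the trace argument -/

section Trace

variable {V : Type*} [NormedAddCommGroup V] [InnerProductSpace ℝ V] {ι : Type*} [Fintype ι]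

/-- The trace of a bilinear form is the same in every orthonormal basis, and an isometry carries one
such basis to another. -/
lemma sum_bilin_isometry (e : OrthonormalBasis ι ℝ V) (J : V ≃ₗᵢ[ℝ] V) (b : V →ₗ[ℝ] V →ₗ[ℝ] ℝ) :
    ∑ i, b (J (e i)) (J (e i)) = ∑ i, b (e i) (e i) := by
  have h1 : ∀ x : V, ∑ j, inner ℝ (e j) x • e j = x := e.sum_repr'
  have h2 : ∀ j k, ∑ i, inner ℝ (e j) (J (e i)) * inner ℝ (e k) (J (e i))
      = inner ℝ (e j) (e k) := by
    intro j k
    have := (e.map J).sum_inner_mul_inner (e j) (e k)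
    rw [← this]
    refine Finset.sum_congr rfl fun i _ ↦ ?_
    rw [OrthonormalBasis.map_apply, real_inner_comm (e k)]
  calc ∑ i, b (J (e i)) (J (e i))
      = ∑ i, ∑ j, ∑ k, (inner ℝ (e j) (J (e i)) * inner ℝ (e k) (J (e i))) * b (e j) (e k) := by
        refine Finset.sum_congr rfl fun i _ ↦ ?_
        conv_lhs => rw [← h1 (J (e i))]
        simp only [map_sum, map_smul, LinearMap.sum_apply, LinearMap.smul_apply, smul_eq_mul,
          Finset.mul_sum]
        rw [Finset.sum_comm]
        refine Finset.sum_congr rfl fun j _ ↦ Finset.sum_congr rfl fun k _ ↦ by ring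
    _ = ∑ j, ∑ k, inner ℝ (e j) (e k) * b (e j) (e k) := by
        rw [Finset.sum_comm]
        refine Finset.sum_congr rfl fun j _ ↦ ?_
        rw [Finset.sum_comm]
        refine Finset.sum_congr rfl fun k _ ↦ ?_
        rw [← Finset.sum_mul, h2]
    _ = ∑ i, b (e i) (e i) := by
        classical
        refine Finset.sum_congr rfl fun j _ ↦ ?_
        simp [e.inner_eq_ite]

/-- The trace of the covariant derivative of the fundamental form of an almost Kähler structure
vanishes. -/
lemma trace_cov_eq_zero (e : OrthonormalBasis ι ℝ V) (J : V →ₗ[ℝ] V) (hJJ : ∀ v, J (J v) = -v)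
    (hJ : ∀ u v, inner ℝ (J u) (J v) = inner ℝ u v) (c : V → V → V → ℝ)
    (c1 : ∀ v w, IsLinearMap ℝ fun u ↦ c u v w) (c2 : ∀ u w, IsLinearMap ℝ fun v ↦ c u v w)
    (c3 : ∀ u v, IsLinearMap ℝ fun w ↦ c u v w)
    (hswap : ∀ u v w, c u v w = - c u w v)
    (hcyc : ∀ u v w, c u v w + c v w u + c w u v = 0)
    (hcJ : ∀ u v w, c u (J v) w = c u v (J w)) (v : V) :
    ∑ i, c (e i) (e i) v = 0 := by
  let J' : V ≃ₗᵢ[ℝ] V :=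
    { toFun := J
      invFun := fun v ↦ -J v
      left_inv := fun v ↦ by simp [hJJ]
      right_inv := fun v ↦ by simp [hJJ]
      map_add' := map_add J
      map_smul' := map_smul J
      norm_map' := fun v ↦ by
        change ‖J v‖ = ‖v‖
        rw [@norm_eq_sqrt_real_inner V, @norm_eq_sqrt_real_inner V, hJ] }
  have hJ' : ∀ v, J' v = J v := fun _ ↦ rfl
  -- Vectors of the form Jv suffice, since J is onto. The cyclic identity is summed over the triples
  -- (e_i, Je_i, v), and its three terms are compared through the basis change e_i ↦ Je_i.
  have key : ∀ v, ∑ i, c (e i) (e i) (J v) = 0 := by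
    intro v
    -- The basis change e_i ↦ Je_i reverses the sign of this sum.
    have s1 : ∑ i, c v (e i) (J (e i)) = 0 := by
      have h := sum_bilin_isometry e J' (LinearMap.mk₂ ℝ (fun a b ↦ c v a (J b))
        (fun a b w ↦ (c2 v (J w)).map_add a b) (fun r a w ↦ (c2 v (J w)).map_smul r a)
        (fun w a b ↦ by rw [map_add]; exact (c3 v w).map_add _ _)
        (fun r w a ↦ by rw [map_smul]; exact (c3 v w).map_smul _ _))
      simp only [LinearMap.mk₂_apply, hJ', hJJ] at h
      have h2 : ∀ i, c v (J (e i)) (-(e i)) = - c v (e i) (J (e i)) := fun i ↦ by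
        rw [(c3 v _).map_neg, hcJ]
      simp only [h2, Finset.sum_neg_distrib] at h
      linarith
    have s2 : ∑ i, c (J (e i)) v (e i) = ∑ i, c (e i) (e i) (J v) := by
      have h := sum_bilin_isometry e J' (LinearMap.mk₂ ℝ (fun a b ↦ c a v (J b))
        (fun a b w ↦ (c1 v (J w)).map_add a b) (fun r a w ↦ (c1 v (J w)).map_smul r a)
        (fun w a b ↦ by rw [map_add]; exact (c3 w v).map_add _ _)
        (fun r w a ↦ by rw [map_smul]; exact (c3 w v).map_smul _ _))
      simp only [LinearMap.mk₂_apply, hJ', hJJ] at h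
      have h2 : ∀ i, c (J (e i)) v (-(e i)) = - c (J (e i)) v (e i) := fun i ↦ (c3 _ v).map_neg _
      have h3 : ∀ i, c (e i) v (J (e i)) = - c (e i) (e i) (J v) := fun i ↦ by
        rw [← hcJ, hswap]
      simp only [h2, h3, Finset.sum_neg_distrib] at h
      linarith
    -- By `hcJ` the first term sums to the wanted trace, by `s2` so does the second, and by `s1` the
    -- third sums to zero: twice the trace is zero.
    have s3 : ∑ i, (c (e i) (J (e i)) v + c (J (e i)) v (e i) + c v (e i) (J (e i))) = 0 :=
      Finset.sum_eq_zero fun i _ ↦ hcyc _ _ _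
    simp only [Finset.sum_add_distrib, s1, s2, hcJ] at s3
    linarith
  have h := key (-J v)
  simpa [hJJ] using h

end Trace

/-! ### Integral manifolds of the kernel of a closed 1-form -/

namespace Flat

variable {E : Type*} [NormedAddCommGroup E] [NormedSpace ℝ E] [FiniteDimensional ℝ E]

/-- Project along `x` onto ker l and identify the kernel with a Euclidean space. The resulting `L`
completes a primitive of the closed form to a local coordinate system. -/
lemma exists_adapted_coordinates (l : E →L[ℝ] ℝ) {x : E} (hx : l x = 1) :
    ∃ (k : ℕ) (L : E →L[ℝ] EuclideanSpace ℝ (Fin k)), (l.prod L).IsInvertible := by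
  let K : Submodule ℝ E := LinearMap.ker l.toLinearMap
  have hk : Module.finrank ℝ K = Module.finrank ℝ (EuclideanSpace ℝ (Fin (Module.finrank ℝ K))) := by
    simp
  let e : K ≃L[ℝ] EuclideanSpace ℝ (Fin (Module.finrank ℝ K)) :=
    ContinuousLinearEquiv.ofFinrankEq hk
  have hP : ∀ u, (LinearMap.id - l.toLinearMap.smulRight x : E →ₗ[ℝ] E) u ∈ K := by
    intro u
    simp [K, hx]
  let P : E →ₗ[ℝ] K := LinearMap.codRestrict K (LinearMap.id - l.toLinearMap.smulRight x) hP
  refine ⟨Module.finrank ℝ K, e.toContinuousLinearMap ∘L LinearMap.toContinuousLinearMap P,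
    isInvertible_of_injective ?_ _ ?_⟩
  · have h1 := LinearMap.finrank_range_add_finrank_ker l.toLinearMap
    have h2 : LinearMap.range l.toLinearMap = ⊤ := by
      rw [LinearMap.range_eq_top]
      intro r
      exact ⟨r • x, by simp [hx]⟩
    rw [h2, finrank_top] at h1
    rw [← h1, Module.finrank_prod, ← hk]
  · intro v hv
    have h1 : l v = 0 := congrArg Prod.fst hv
    have h2 : e (P v) = 0 := congrArg Prod.snd hv
    have h3 : P v = 0 := by simpa using h2
    have h4 : ((P v : K) : E) = v - l v • x := rfl
    rw [h3, h1] at h4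
    simpa using h4.symm

/-- Local existence of integral manifolds of the kernel of a closed 1-form. -/
lemma exists_integral_manifold {η : E → E →L[ℝ] ℝ} {p : E} {s : Set E} (hs : s ∈ 𝓝 p)
    (hη : ∀ᶠ q in 𝓝 p, ContDiffAt ℝ ∞ η q)
    (hc : ∀ᶠ q in 𝓝 p, ∀ u v, fderiv ℝ η q u v = fderiv ℝ η q v u) {x : E} (hx : η p x = 1) :
    ∃ (k : ℕ) (ζ : EuclideanSpace ℝ (Fin k) → E), ContDiff ℝ ∞ ζ ∧ ζ 0 = p ∧ (∀ y, ζ y ∈ s) ∧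
      ∀ y, Function.Injective (fderiv ℝ ζ y) ∧
        Set.range (fderiv ℝ ζ y) = {v | η (ζ y) v = 0} := by
  have : CompleteSpace E := FiniteDimensional.complete ℝ E
  obtain ⟨k, L, e, he⟩ := exists_adapted_coordinates (η p) hx
  have hinv : ∀ᶠ q in 𝓝 p, ((η q).prod L).IsInvertible := by
    have hcont : ContinuousAt (fun q ↦ (η q).prod L) p := by
      have h1 : ContinuousAt η p := hη.self_of_nhds.continuousAt
      have h2 : (fun q ↦ (η q).prod L) = fun q ↦
          (ContinuousLinearMap.inl ℝ ℝ (EuclideanSpace ℝ (Fin k))) ∘L (η q)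
            + (ContinuousLinearMap.inr ℝ ℝ (EuclideanSpace ℝ (Fin k))) ∘L L := by
        ext q v <;> simp
      rw [h2]
      exact (continuousAt_const.clm_comp h1).add continuousAt_const
    have h2 := hcont.preimage_mem_nhds (by rw [← he]; exact e.nhds)
    filter_upwards [h2] with q hq using hq
  obtain ⟨r, hr, hball⟩ := Metric.eventually_nhds_iff_ball.1
    ((hη.and hc).and (hinv.and (eventually_mem_set.2 hs)))
  -- Poincaré lemma on a ball: η = df. The integral manifold will be the level set of f through p.
  obtain ⟨f, hf⟩ := (convex_ball p r).exists_forall_hasFDerivAt_of_fderiv_symmetric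
    Metric.isOpen_ball
    (fun q hq ↦ ((hball q hq).1.1.differentiableAt (by simp)).differentiableWithinAt)
    (fun q hq ↦ (hball q hq).1.2)
  have hfs : ContDiffOn ℝ ∞ f (Metric.ball p r) := by
    rw [contDiffOn_infty_iff_fderiv_of_isOpen Metric.isOpen_ball]
    refine ⟨fun q hq ↦ (hf q hq).differentiableAt.differentiableWithinAt, ?_⟩
    have : ContDiffOn ℝ ∞ η (Metric.ball p r) := fun q hq ↦ (hball q hq).1.1.contDiffWithinAt
    exact this.congr fun q hq ↦ (hf q hq).fderiv
  let Ψ : E → ℝ × EuclideanSpace ℝ (Fin k) := fun q ↦ (f q, L q)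
  have hΨd : ∀ q ∈ Metric.ball p r, HasFDerivAt Ψ ((η q).prod L) q := fun q hq ↦
    (hf q hq).prodMk L.hasFDerivAt
  have hΨs : ∀ q ∈ Metric.ball p r, ContDiffAt ℝ ∞ Ψ q := fun q hq ↦
    ((hfs q hq).contDiffAt (Metric.isOpen_ball.mem_nhds hq)).prodMk L.contDiff.contDiffAt
  have hp : p ∈ Metric.ball p r := Metric.mem_ball_self hr
  have hΨp : HasFDerivAt Ψ (e : E →L[ℝ] ℝ × EuclideanSpace ℝ (Fin k)) p := by
    rw [he]; exact hΨd p hp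
  -- Inverse function theorem for (f, L): in these coordinates the level sets of f are the slices
  -- with constant first component, and σ below parametrizes the slice through p.
  let Θ := (hΨs p hp).toOpenPartialHomeomorph Ψ hΨp (by simp)
  have hpΘ : p ∈ Θ.source :=
    ContDiffAt.mem_toOpenPartialHomeomorph_source (hΨs p hp) hΨp (by simp)
  have hΘ : ∀ q, Θ q = Ψ q := fun _ ↦ rfl
  have hΨpt : (f p, L p) ∈ Θ.target := Θ.map_source hpΘ
  have hΘp : Θ.symm (f p, L p) = p := Θ.left_inv hpΘ
  -- the good parameters
  have hgood : ∀ᶠ z in 𝓝 (f p, L p), z ∈ Θ.target ∧ Θ.symm z ∈ Metric.ball p r := by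
    refine (eventually_mem_set.2 (Θ.open_target.mem_nhds hΨpt)).and ?_
    have := Θ.continuousAt_symm hΨpt
    rw [ContinuousAt, hΘp] at this
    exact this (Metric.isOpen_ball.mem_nhds hp)
  have hslice : Tendsto (fun y ↦ (f p, y)) (𝓝 (L p)) (𝓝 (f p, L p)) :=
    (Continuous.prodMk_right (f p)).continuousAt
  obtain ⟨ρ, hρ, hρball⟩ := Metric.eventually_nhds_iff_ball.1 (hslice.eventually hgood)
  let σ : EuclideanSpace ℝ (Fin k) → E := fun y ↦ Θ.symm (f p, y)
  have hσs : ∀ y ∈ Metric.ball (L p) ρ, ContDiffAt ℝ ∞ σ y := by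
    intro y hy
    obtain ⟨h1, h2⟩ := hρball y hy
    obtain ⟨e', he'⟩ := (hball _ h2).2.1
    have h3 : HasFDerivAt Θ (e' : E →L[ℝ] ℝ × EuclideanSpace ℝ (Fin k)) (Θ.symm (f p, y)) := by
      rw [he']; exact hΨd _ h2
    have h4 : ContDiffAt ℝ ∞ Θ.symm (f p, y) := Θ.contDiffAt_symm h1 h3 (hΨs _ h2)
    exact h4.comp y (contDiffAt_const.prodMk contDiffAt_id)
  have hσ : ∀ y ∈ Metric.ball (L p) ρ, ∀ w,
      η (σ y) (fderiv ℝ σ y w) = 0 ∧ L (fderiv ℝ σ y w) = w := by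
    intro y hy w
    obtain ⟨h1, h2⟩ := hρball y hy
    have h3 : HasFDerivAt (fun y ↦ Ψ (σ y)) (((η (σ y)).prod L) ∘L fderiv ℝ σ y) y :=
      (hΨd _ h2).comp y ((hσs y hy).differentiableAt (by simp)).hasFDerivAt
    -- Differentiating (f, L)(σ(y)) = (f(p), y) gives both assertions at once.
    have h4 : (fun y ↦ Ψ (σ y)) =ᶠ[𝓝 y] fun y ↦ (f p, y) := by
      filter_upwards [Metric.isOpen_ball.mem_nhds hy] with z hz
      exact Θ.right_inv (hρball z hz).1
    have h5 := h3.fderiv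
    rw [h4.fderiv_eq, (show fderiv ℝ (fun y ↦ (f p, y)) y = _ from
      ((hasFDerivAt_const (f p) y).prodMk (hasFDerivAt_id y)).fderiv)] at h5
    have h6 := congrArg (fun T ↦ T w) h5
    exact ⟨(congrArg Prod.fst h6).symm, (congrArg Prod.snd h6).symm⟩
  -- A diffeomorphism from the whole Euclidean space onto the ball of parameters, so that the leaf
  -- is parametrized by the model space itself.
  let b := OpenPartialHomeomorph.univBall (L p) ρ
  have hbm : ∀ y, b y ∈ Metric.ball (L p) ρ := fun y ↦ by
    rw [← OpenPartialHomeomorph.univBall_target (L p) hρ]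
    exact b.map_source (by simp [b])
  have hbs : ContDiff ℝ ∞ b := OpenPartialHomeomorph.contDiff_univBall
  have hbinj : ∀ y w, fderiv ℝ b y w = 0 → w = 0 := by
    intro y w hw
    have h1 : DifferentiableAt ℝ b.symm (b y) :=
      ((OpenPartialHomeomorph.contDiffOn_univBall_symm (n := ⊤) _ (hbm y)).contDiffAt
        (Metric.isOpen_ball.mem_nhds (hbm y))).differentiableAt (by simp)
    have h2 := fderiv_comp y h1 (hbs.differentiable (by simp) y)
    have h3 : b.symm ∘ b = id := by
      ext1 z
      exact b.left_inv (by simp [b])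
    rw [h3, fderiv_id] at h2
    have h4 := congrArg (fun T ↦ T w) h2
    simpa [hw] using h4
  have hbinv : ∀ y, Function.Surjective (fderiv ℝ b y) := fun y ↦
    LinearMap.surjective_of_injective (f := (fderiv ℝ b y).toLinearMap)
      ((injective_iff_map_eq_zero (fderiv ℝ b y)).2 (hbinj y))
  have hζd : ∀ y w, fderiv ℝ (fun y ↦ σ (b y)) y w = fderiv ℝ σ (b y) (fderiv ℝ b y w) := by
    intro y w
    have := fderiv_comp y ((hσs _ (hbm y)).differentiableAt (by simp))
      (hbs.differentiable (by simp) y)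
    rw [show (fun y ↦ σ (b y)) = σ ∘ b from rfl, this]
    rfl
  refine ⟨k, fun y ↦ σ (b y), ?_, ?_, ?_, ?_⟩
  · exact contDiff_iff_contDiffAt.2 fun y ↦ (hσs _ (hbm y)).comp y hbs.contDiffAt
  · have : b 0 = L p := OpenPartialHomeomorph.univBall_apply_zero _ _
    simp only [this]
    exact hΘp
  · exact fun y ↦ (hball _ (hρball _ (hbm y)).2).2.2
  · intro y
    constructor
    · rw [injective_iff_map_eq_zero]
      intro w hw
      rw [hζd] at hw
      have := (hσ _ (hbm y) (fderiv ℝ b y w)).2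
      rw [hw, map_zero] at this
      exact hbinj y w this.symm
    · ext v
      constructor
      · rintro ⟨w, rfl⟩
        rw [hζd]
        exact (hσ _ (hbm y) _).1
      · intro hv
        -- For η(v) = 0, choose w so that the image vector and v have the same L-component. Their
        -- η-components are both zero, and (η, L) is injective at this point.
        obtain ⟨w, hw⟩ := hbinv y (L v)
        refine ⟨w, ?_⟩
        rw [hζd, hw]
        obtain ⟨e', he'⟩ := (hball _ (hρball _ (hbm y)).2).2.1
        apply e'.injective
        have h1 : ∀ u, e' u = (η (σ (b y)) u, L u) := fun u ↦ by
          change (e' : E →L[ℝ] ℝ × EuclideanSpace ℝ (Fin k)) u = _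
          rw [he']; rfl
        rw [h1, h1, (hσ _ (hbm y) _).1, (hσ _ (hbm y) _).2]
        rw [show η (σ (b y)) v = 0 from hv]

omit [FiniteDimensional ℝ E] in
/-- A field of endomorphisms induced on the source of an immersion is differentiable. -/
lemma differentiableAt_of_intertwine {K : Type*} [NormedAddCommGroup K] [NormedSpace ℝ K]
    [FiniteDimensional ℝ K] [FiniteDimensional ℝ E] {A B : K → K →L[ℝ] E} {C : K → K →L[ℝ] K}
    {y : K} (hA : DifferentiableAt ℝ A y) (hB : DifferentiableAt ℝ B y)
    (hi : Function.Injective (A y)) (h : ∀ᶠ z in 𝓝 y, ∀ v, A z (C z v) = B z v) :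
    DifferentiableAt ℝ C y := by
  have : CompleteSpace K := FiniteDimensional.complete ℝ K
  -- A fixed left inverse R of A at y makes R ∘ A(z) invertible for z near y, whence C = (RA)⁻¹RB
  -- there.
  obtain ⟨R', hR'⟩ := LinearMap.exists_leftInverse_of_injective (A y).toLinearMap
    (LinearMap.ker_eq_bot.2 hi)
  let R : E →L[ℝ] K := LinearMap.toContinuousLinearMap R'
  have hR : R ∘L A y = ((ContinuousLinearEquiv.refl ℝ K : K ≃L[ℝ] K) : K →L[ℝ] K) := by
    ext v
    exact congrArg (fun T ↦ T v) hR'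
  have hRA : DifferentiableAt ℝ (fun z ↦ R ∘L A z) y := (differentiableAt_const R).clm_comp hA
  have hinv : ∀ᶠ z in 𝓝 y, (R ∘L A z).IsInvertible := by
    have h2 := hRA.continuousAt.preimage_mem_nhds
      (by rw [hR]; exact (ContinuousLinearEquiv.refl ℝ K).nhds)
    filter_upwards [h2] with z hz using hz
  have hd : DifferentiableAt ℝ (fun z ↦ (R ∘L A z).inverse ∘L R ∘L B z) y :=
    (hRA.clm_inverse hinv.self_of_nhds).clm_comp ((differentiableAt_const R).clm_comp hB)
  refine hd.congr_of_eventuallyEq ?_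
  filter_upwards [hinv, h] with z hz hz'
  obtain ⟨e, he⟩ := hz
  ext v
  simp only [← he, ContinuousLinearMap.inverse_equiv, ContinuousLinearMap.comp_apply,
    ContinuousLinearEquiv.coe_coe]
  rw [← hz', ContinuousLinearEquiv.eq_symm_apply]
  change (e : K →L[ℝ] K) (C z v) = _
  rw [he]
  rfl

end Flat

/-! ### Charts: frames, derivatives and Lie brackets in coordinates -/

section Dictionary

variable {E : Type*} [NormedAddCommGroup E] [NormedSpace ℝ E]
  {M : Type*} [TopologicalSpace M] [ChartedSpace E M] [IsManifold 𝓘(ℝ, E) ∞ M]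

/-- The coordinate frame at `y` of the chart around `x`. -/
def frame (x y : M) : E →L[ℝ] TangentSpace 𝓘(ℝ, E) y :=
  (trivializationAt E (TangentSpace 𝓘(ℝ, E)) x).symmL ℝ y

/-- The coordinates of tangent vectors at `y` in the chart around `x`. -/
def coframe (x y : M) : TangentSpace 𝓘(ℝ, E) y →L[ℝ] E :=
  (trivializationAt E (TangentSpace 𝓘(ℝ, E)) x).continuousLinearMapAt ℝ y

variable (E) in
/-- The domain of the chart around `x`. -/
abbrev dom (x : M) : Set M := (extChartAt 𝓘(ℝ, E) x).source

omit [IsManifold 𝓘(ℝ, E) ∞ M] in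
lemma dom_mem_nhds (x : M) : dom E x ∈ 𝓝 x := extChartAt_source_mem_nhds x

omit [IsManifold 𝓘(ℝ, E) ∞ M] in
lemma mem_dom_self (x : M) : x ∈ dom E x := mem_extChartAt_source x

lemma mem_baseSet {x y : M} (hy : y ∈ dom E x) :
    y ∈ (trivializationAt E (TangentSpace 𝓘(ℝ, E)) x).baseSet := by
  rw [TangentBundle.trivializationAt_baseSet]
  simpa [dom] using hy

lemma coframe_frame {x y : M} (hy : y ∈ dom E x) (v : E) : coframe x y (frame x y v) = v :=
  (trivializationAt E (TangentSpace 𝓘(ℝ, E)) x).continuousLinearMapAt_symmL (mem_baseSet hy) v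

lemma frame_coframe {x y : M} (hy : y ∈ dom E x) (v : TangentSpace 𝓘(ℝ, E) y) :
    frame x y (coframe x y v) = v :=
  (trivializationAt E (TangentSpace 𝓘(ℝ, E)) x).symmL_continuousLinearMapAt (mem_baseSet hy) v

/-- The coordinate frame as a linear equivalence. -/
def frameEquiv {x y : M} (hy : y ∈ dom E x) : E ≃L[ℝ] TangentSpace 𝓘(ℝ, E) y :=
  ContinuousLinearEquiv.equivOfInverse (frame x y) (coframe x y)
    (fun v ↦ coframe_frame hy v) (fun v ↦ frame_coframe hy v)

lemma coframe_self (x : M) (v : TangentSpace 𝓘(ℝ, E) x) : coframe x x v = v := by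
  have h : coframe x x = mfderiv 𝓘(ℝ, E) 𝓘(ℝ, E) (extChartAt 𝓘(ℝ, E) x) x :=
    TangentBundle.continuousLinearMapAt_trivializationAt (by simp)
  rw [h, mfderiv_extChartAt_self]
  rfl

/-- The canonical extension has constant components in the chart around `x`; hence brackets of two
extensions vanish and the defining formulas of tensors reduce to partial derivatives. -/
lemma ext_eq {x y : M} (hy : y ∈ dom E x) (v : TangentSpace 𝓘(ℝ, E) x) :
    ext (E := E) v y = frame x y (coframe x x v) := by
  have h2 : coframe x x v = ((trivializationAt E (TangentSpace 𝓘(ℝ, E)) x) ⟨x, v⟩).2 :=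
    Trivialization.continuousLinearMapAt_apply_of_mem (R := ℝ)
      (trivializationAt E (TangentSpace 𝓘(ℝ, E)) x) (mem_baseSet (mem_dom_self (E := E) x)) v
  rw [h2]
  exact (Trivialization.symmL_apply (R := ℝ) (trivializationAt E (TangentSpace 𝓘(ℝ, E)) x)
    (mem_baseSet hy) _).symm

lemma ext_frame {x y : M} (hy : y ∈ dom E x) (v : E) :
    ext (E := E) (frame x x v) y = frame x y v := by
  rw [ext_eq hy, coframe_frame (mem_dom_self x)]

lemma ext_self {x : M} (v : TangentSpace 𝓘(ℝ, E) x) : ext (E := E) v x = v :=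
  FiberBundle.extend_apply_self E v

omit [IsManifold 𝓘(ℝ, E) ∞ M] in
lemma eventually_chart {x : M} {P : M → Prop} (h : ∀ᶠ y in 𝓝 x, P y) :
    ∀ᶠ q in 𝓝 (extChartAt 𝓘(ℝ, E) x x), P ((extChartAt 𝓘(ℝ, E) x).symm q) := by
  have h1 := continuousAt_extChartAt_symm (I := 𝓘(ℝ, E)) x
  rw [ContinuousAt, extChartAt_to_inv] at h1
  exact h1.eventually h

/-- No differentiability is assumed: the function and its chart expression are differentiable
together, and otherwise both derivatives have the default value 0. -/
lemma mvfderiv_eq (h : M → ℝ) (x : M) (u : TangentSpace 𝓘(ℝ, E) x) :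
    mvfderiv 𝓘(ℝ, E) h x u = fderiv ℝ (fun q ↦ h ((extChartAt 𝓘(ℝ, E) x).symm q))
      (extChartAt 𝓘(ℝ, E) x x) (coframe x x u) := by
  rw [coframe_self]
  have hw : writtenInExtChartAt 𝓘(ℝ, E) 𝓘(ℝ, ℝ) x h
      = fun q ↦ h ((extChartAt 𝓘(ℝ, E) x).symm q) := by
    rfl
  by_cases hd : MDifferentiableAt 𝓘(ℝ, E) 𝓘(ℝ, ℝ) h x
  · change mfderiv 𝓘(ℝ, E) 𝓘(ℝ, ℝ) h x u = _
    rw [hd.mfderiv, hw]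
    simp only [modelWithCornersSelf_coe, Set.range_id, fderivWithin_univ]
    rfl
  · have h0 : ¬ DifferentiableAt ℝ (fun q ↦ h ((extChartAt 𝓘(ℝ, E) x).symm q))
        (extChartAt 𝓘(ℝ, E) x x) := by
      intro h1
      apply hd
      rw [mdifferentiableAt_iff, hw]
      refine ⟨?_, h1.differentiableWithinAt⟩
      have h2 : ContinuousAt (fun y ↦ h ((extChartAt 𝓘(ℝ, E) x).symm (extChartAt 𝓘(ℝ, E) x y))) x :=
        ContinuousAt.comp (f := extChartAt 𝓘(ℝ, E) x) h1.continuousAt (continuousAt_extChartAt x)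
      refine h2.congr ?_
      filter_upwards [dom_mem_nhds (E := E) x] with y hy
      rw [(extChartAt 𝓘(ℝ, E) x).left_inv hy]
    change mfderiv 𝓘(ℝ, E) 𝓘(ℝ, ℝ) h x u = _
    rw [mfderiv_zero_of_not_mdifferentiableAt hd, fderiv_zero_of_not_differentiableAt h0]
    rfl

/-- The coordinate expression of a vector field. -/
def coord (x : M) (X : Π y : M, TangentSpace 𝓘(ℝ, E) y) (q : E) : E :=
  coframe x ((extChartAt 𝓘(ℝ, E) x).symm q) (X ((extChartAt 𝓘(ℝ, E) x).symm q))

lemma coord_self (x : M) (X : Π y : M, TangentSpace 𝓘(ℝ, E) y) :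
    coord x X (extChartAt 𝓘(ℝ, E) x x) = coframe x x (X x) := by
  rw [coord, extChartAt_to_inv]

lemma coord_ext (x : M) (v : TangentSpace 𝓘(ℝ, E) x) :
    coord x (ext (E := E) v) =ᶠ[𝓝 (extChartAt 𝓘(ℝ, E) x x)] fun _ ↦ coframe x x v := by
  filter_upwards [eventually_chart (dom_mem_nhds (E := E) x)] with q hq
  rw [coord, ext_eq hq, coframe_frame hq]

/-- The pulled-back field in the definition of `mlieBracket` is thereby identified with the
component field, the derivative of the inverse chart being the coordinate frame. -/
lemma mpullbackWithin_eq (x : M) (X : Π y : M, TangentSpace 𝓘(ℝ, E) y) {q : E}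
    (hq : q ∈ (extChartAt 𝓘(ℝ, E) x).target) :
    (mfderivWithin 𝓘(ℝ, E) 𝓘(ℝ, E) (extChartAt 𝓘(ℝ, E) x).symm (Set.range 𝓘(ℝ, E)) q).inverse
      (X ((extChartAt 𝓘(ℝ, E) x).symm q)) = coord x X q := by
  have hy : (extChartAt 𝓘(ℝ, E) x).symm q ∈ dom E x := (extChartAt 𝓘(ℝ, E) x).map_target hq
  have h1 : mfderivWithin 𝓘(ℝ, E) 𝓘(ℝ, E) (extChartAt 𝓘(ℝ, E) x).symm (Set.range 𝓘(ℝ, E)) q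
      = (frameEquiv hy : E →L[ℝ] TangentSpace 𝓘(ℝ, E) ((extChartAt 𝓘(ℝ, E) x).symm q)) := by
    have := TangentBundle.symmL_trivializationAt (I := 𝓘(ℝ, E)) (x₀ := x)
      (x := (extChartAt 𝓘(ℝ, E) x).symm q) (by simpa [dom] using hy)
    rw [(extChartAt 𝓘(ℝ, E) x).right_inv hq] at this
    exact this.symm
  have h2 : (mfderivWithin 𝓘(ℝ, E) 𝓘(ℝ, E) (extChartAt 𝓘(ℝ, E) x).symm
      (Set.range 𝓘(ℝ, E)) q).inverse = ((frameEquiv hy).symm : _ →L[ℝ] E) := by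
    rw [h1]
    exact ContinuousLinearMap.inverse_equiv (frameEquiv hy)
  rw [h2]
  rfl

lemma mlieBracket_eq (x : M) (X Y : Π y : M, TangentSpace 𝓘(ℝ, E) y) :
    coframe x x (VectorField.mlieBracket 𝓘(ℝ, E) X Y x)
      = fderiv ℝ (coord x Y) (extChartAt 𝓘(ℝ, E) x x) (coframe x x (X x))
        - fderiv ℝ (coord x X) (extChartAt 𝓘(ℝ, E) x x) (coframe x x (Y x)) := by
  have hev : ∀ Z : Π y : M, TangentSpace 𝓘(ℝ, E) y,
      VectorField.mpullbackWithin 𝓘(ℝ, E) 𝓘(ℝ, E) (extChartAt 𝓘(ℝ, E) x).symm Z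
      (Set.range 𝓘(ℝ, E)) =ᶠ[𝓝 (extChartAt 𝓘(ℝ, E) x x)] coord x Z := fun Z ↦ by
    filter_upwards [extChartAt_target_mem_nhds (I := 𝓘(ℝ, E)) x] with q hq
    exact mpullbackWithin_eq x Z hq
  have key : VectorField.mlieBracket 𝓘(ℝ, E) X Y x = VectorField.lieBracket ℝ
      (VectorField.mpullbackWithin 𝓘(ℝ, E) 𝓘(ℝ, E) (extChartAt 𝓘(ℝ, E) x).symm X
        (Set.range 𝓘(ℝ, E)))
      (VectorField.mpullbackWithin 𝓘(ℝ, E) 𝓘(ℝ, E) (extChartAt 𝓘(ℝ, E) x).symm Y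
        (Set.range 𝓘(ℝ, E))) (extChartAt 𝓘(ℝ, E) x x) := by
    have hset : (extChartAt 𝓘(ℝ, E) x).symm ⁻¹' Set.univ ∩ Set.range 𝓘(ℝ, E) = Set.univ := by
      simp
    rw [VectorField.mlieBracket, VectorField.mlieBracketWithin_apply, hset]
    have hinv : (mfderiv 𝓘(ℝ, E) 𝓘(ℝ, E) (extChartAt 𝓘(ℝ, E) x) x).inverse
        = ContinuousLinearMap.id ℝ E := by
      rw [mfderiv_extChartAt_self]
      exact ContinuousLinearMap.inverse_id
    exact (congrArg (fun T : E →L[ℝ] E ↦ T _) hinv).trans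
      (congrFun (VectorField.lieBracketWithin_univ (𝕜 := ℝ) (E := E)) (extChartAt 𝓘(ℝ, E) x x))
  rw [coframe_self, key, ← coord_self, ← coord_self]
  exact ((hev X).lieBracket_vectorField_eq (hev Y))

end Dictionary

/-! ### Exterior derivatives and the Nijenhuis tensor in coordinates -/

section Tensors

variable {E : Type*} [NormedAddCommGroup E] [NormedSpace ℝ E]
  {M : Type*} [TopologicalSpace M] [ChartedSpace E M] [IsManifold 𝓘(ℝ, E) ∞ M]

lemma frame_self_coframe (x : M) (v : TangentSpace 𝓘(ℝ, E) x) : frame x x (coframe x x v) = v :=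
  frame_coframe (mem_dom_self x) v

lemma coframe_self_frame (x : M) (v : E) : coframe x x (frame x x v) = v :=
  coframe_frame (mem_dom_self x) v

lemma mlieBracket_ext (x : M) (u v : TangentSpace 𝓘(ℝ, E) x) :
    VectorField.mlieBracket 𝓘(ℝ, E) (ext (E := E) u) (ext (E := E) v) x = 0 := by
  rw [← frame_self_coframe x (VectorField.mlieBracket 𝓘(ℝ, E) _ _ x), mlieBracket_eq,
    (coord_ext x u).fderiv_eq, (coord_ext x v).fderiv_eq]
  simp

lemma mvfderiv_frame (h : M → ℝ) (x : M) (u : E) :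
    mvfderiv 𝓘(ℝ, E) h x (frame x x u)
      = fderiv ℝ (fun q ↦ h ((extChartAt 𝓘(ℝ, E) x).symm q)) (extChartAt 𝓘(ℝ, E) x x) u := by
  rw [mvfderiv_eq, coframe_self_frame]

/-- The coordinate expression of a 2-form. -/
def coordForm (x : M) (α : Π y : M, TangentSpace 𝓘(ℝ, E) y → TangentSpace 𝓘(ℝ, E) y → ℝ)
    (q a b : E) : ℝ :=
  α ((extChartAt 𝓘(ℝ, E) x).symm q) (frame x _ a) (frame x _ b)

lemma form_ext_eq (x : M) (α : Π y : M, TangentSpace 𝓘(ℝ, E) y → TangentSpace 𝓘(ℝ, E) y → ℝ)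
    (a b : E) :
    (fun q ↦ α ((extChartAt 𝓘(ℝ, E) x).symm q) (ext (E := E) (frame x x a) _)
      (ext (E := E) (frame x x b) _)) =ᶠ[𝓝 (extChartAt 𝓘(ℝ, E) x x)]
      fun q ↦ coordForm x α q a b := by
  filter_upwards [eventually_chart (dom_mem_nhds (E := E) x)] with q hq
  rw [ext_frame hq, ext_frame hq]
  rfl

lemma mvfderiv_form (x : M) (α : Π y : M, TangentSpace 𝓘(ℝ, E) y → TangentSpace 𝓘(ℝ, E) y → ℝ)
    (a b u : E) :
    mvfderiv 𝓘(ℝ, E) (fun y ↦ α y (ext (E := E) (frame x x a) y) (ext (E := E) (frame x x b) y)) x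
      (frame x x u)
      = fderiv ℝ (fun q ↦ coordForm x α q a b) (extChartAt 𝓘(ℝ, E) x x) u := by
  rw [mvfderiv_frame, (form_ext_eq x α a b).fderiv_eq]

/-- Coordinate fields commute, so the bracket terms are values of α at a zero first argument; `hα`
is all the linearity needed. -/
lemma dTwo_eq (x : M) {α : Π y : M, TangentSpace 𝓘(ℝ, E) y → TangentSpace 𝓘(ℝ, E) y → ℝ}
    (hα : ∀ w, α x 0 w = 0) (u v w : E) :
    dTwo α x (frame x x u) (frame x x v) (frame x x w)
      = Flat.dTwo (coordForm x α) (extChartAt 𝓘(ℝ, E) x x) u v w := by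
  rw [dTwo, mlieBracket_ext, mlieBracket_ext, mlieBracket_ext, hα, hα, hα, mvfderiv_form,
    mvfderiv_form, mvfderiv_form, Flat.dTwo]
  ring

/-- The coordinate expression of a field of endomorphisms. -/
def coordEndo (x : M) (J : Π y : M, TangentSpace 𝓘(ℝ, E) y →L[ℝ] TangentSpace 𝓘(ℝ, E) y) (q : E) :
    E →L[ℝ] E :=
  coframe x ((extChartAt 𝓘(ℝ, E) x).symm q) ∘L J ((extChartAt 𝓘(ℝ, E) x).symm q)
    ∘L frame x ((extChartAt 𝓘(ℝ, E) x).symm q)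

lemma coordEndo_self (x : M) (J : Π y : M, TangentSpace 𝓘(ℝ, E) y →L[ℝ] TangentSpace 𝓘(ℝ, E) y)
    (v : E) : coordEndo x J (extChartAt 𝓘(ℝ, E) x x) v = coframe x x (J x (frame x x v)) := by
  -- Applying the inverse chart to the coordinates of `x` returns `x` only propositionally, so the
  -- base point is generalized before substituting.
  have h : ∀ y, y = x → coframe x y (J y (frame x y v)) = coframe x x (J x (frame x x v)) := by
    rintro y rfl; rfl
  exact h _ (extChartAt_to_inv x)

lemma coord_endo_ext (x : M)
    (J : Π y : M, TangentSpace 𝓘(ℝ, E) y →L[ℝ] TangentSpace 𝓘(ℝ, E) y) (v : E) :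
    coord x (fun y ↦ J y (ext (E := E) (frame x x v) y)) =ᶠ[𝓝 (extChartAt 𝓘(ℝ, E) x x)]
      fun q ↦ coordEndo x J q v := by
  filter_upwards [eventually_chart (dom_mem_nhds (E := E) x)] with q hq
  rw [coord, ext_frame hq]
  rfl

lemma nijenhuis_eq (x : M) {J : Π y : M, TangentSpace 𝓘(ℝ, E) y →L[ℝ] TangentSpace 𝓘(ℝ, E) y}
    (hJ : DifferentiableAt ℝ (coordEndo x J) (extChartAt 𝓘(ℝ, E) x x)) (u v : E) :
    coframe x x (nijenhuis J x (frame x x u) (frame x x v))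
      = Flat.nijenhuis (coordEndo x J) (extChartAt 𝓘(ℝ, E) x x) u v := by
  have h1 : ∀ w : TangentSpace 𝓘(ℝ, E) x, coframe x x (J x w)
      = coordEndo x J (extChartAt 𝓘(ℝ, E) x x) (coframe x x w) := fun w ↦ by
    rw [coordEndo_self, frame_self_coframe]
  have hd : ∀ a b : E, fderiv ℝ (fun q ↦ coordEndo x J q a) (extChartAt 𝓘(ℝ, E) x x) b
      = fderiv ℝ (coordEndo x J) (extChartAt 𝓘(ℝ, E) x x) b a := fun a b ↦ by
    rw [Flat.fderiv_clm_field hJ (differentiableAt_const a)]; simp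
  have hc : ∀ a : E, fderiv ℝ (coord x (ext (E := E) (frame x x a))) (extChartAt 𝓘(ℝ, E) x x) = 0 :=
    fun a ↦ by rw [(coord_ext x _).fderiv_eq]; simp
  rw [nijenhuis, mlieBracket_ext]
  simp only [map_sub, map_add, map_zero, h1, mlieBracket_eq, (coord_endo_ext x J _).fderiv_eq, hc,
    ext_self, coframe_self_frame, hd, zero_apply, Flat.nijenhuis]
  simp only [sub_zero, zero_sub]
  abel

/-! ### Smoothness of coordinate expressions -/

omit [IsManifold 𝓘(ℝ, E) ∞ M] in
lemma contDiffOn_coord_of_contMDiffOn {G : Type*} [NormedAddCommGroup G] [NormedSpace ℝ G]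
    [IsManifold 𝓘(ℝ, E) ∞ M] {x : M} {h : M → G} (hh : ContMDiffOn 𝓘(ℝ, E) 𝓘(ℝ, G) ∞ h (dom E x)) :
    ContDiffOn ℝ ∞ (fun q ↦ h ((extChartAt 𝓘(ℝ, E) x).symm q)) (extChartAt 𝓘(ℝ, E) x).target := by
  rw [← contMDiffOn_iff_contDiffOn]
  exact hh.comp (contMDiffOn_extChartAt_symm x) fun q hq ↦ (extChartAt 𝓘(ℝ, E) x).map_target hq

lemma contMDiffOn_frame (x : M) (v : E) :
    ContMDiffOn 𝓘(ℝ, E) 𝓘(ℝ, E).tangent ∞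
      (fun y ↦ (⟨y, frame x y v⟩ : TangentBundle 𝓘(ℝ, E) M)) (dom E x) := by
  intro y hy
  rw [Trivialization.contMDiffWithinAt_section (F := E) (E := TangentSpace 𝓘(ℝ, E)) (dom E x)
    (e := trivializationAt E (TangentSpace 𝓘(ℝ, E)) x) (mem_baseSet hy)]
  refine (contMDiffWithinAt_const (c := v)).congr_of_mem (fun z hz ↦ ?_) hy
  rw [← Trivialization.continuousLinearMapAt_apply_of_mem (R := ℝ)
      (trivializationAt E (TangentSpace 𝓘(ℝ, E)) x) (mem_baseSet hz)]
  exact coframe_frame hz v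

lemma contMDiffOn_coframe (x : M) {X : Π y : M, TangentSpace 𝓘(ℝ, E) y}
    (hX : ContMDiffOn 𝓘(ℝ, E) 𝓘(ℝ, E).tangent ∞
      (fun y ↦ (⟨y, X y⟩ : TangentBundle 𝓘(ℝ, E) M)) (dom E x)) :
    ContMDiffOn 𝓘(ℝ, E) 𝓘(ℝ, E) ∞ (fun y ↦ coframe x y (X y)) (dom E x) := by
  intro y hy
  have h1 := hX y hy
  rw [Trivialization.contMDiffWithinAt_section (F := E) (E := TangentSpace 𝓘(ℝ, E)) (dom E x)
    (e := trivializationAt E (TangentSpace 𝓘(ℝ, E)) x) (mem_baseSet hy)] at h1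
  refine h1.congr_of_mem (fun z hz ↦ ?_) hy
  rw [← Trivialization.continuousLinearMapAt_apply_of_mem (R := ℝ)
      (trivializationAt E (TangentSpace 𝓘(ℝ, E)) x) (mem_baseSet hz)]
  rfl

lemma contDiffOn_coord (x : M) {X : Π y : M, TangentSpace 𝓘(ℝ, E) y}
    (hX : ContMDiffOn 𝓘(ℝ, E) 𝓘(ℝ, E).tangent ∞
      (fun y ↦ (⟨y, X y⟩ : TangentBundle 𝓘(ℝ, E) M)) (dom E x)) :
    ContDiffOn ℝ ∞ (coord x X) (extChartAt 𝓘(ℝ, E) x).target :=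
  contDiffOn_coord_of_contMDiffOn (contMDiffOn_coframe x hX)

lemma contDiffOn_coordEndo [FiniteDimensional ℝ E] (x : M)
    {J : Π y : M, TangentSpace 𝓘(ℝ, E) y →L[ℝ] TangentSpace 𝓘(ℝ, E) y}
    (hJ : ContMDiff 𝓘(ℝ, E) (𝓘(ℝ, E).prod 𝓘(ℝ, E →L[ℝ] E)) ∞
      (fun x ↦ Bundle.TotalSpace.mk' (E →L[ℝ] E)
      (E := fun y : M ↦ TangentSpace 𝓘(ℝ, E) y →L[ℝ] TangentSpace 𝓘(ℝ, E) y) x (J x))) :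
    ContDiffOn ℝ ∞ (coordEndo x J) (extChartAt 𝓘(ℝ, E) x).target := by
  rw [contDiffOn_clm_apply]
  intro v
  exact contDiffOn_coord x (hJ.contMDiffOn.clm_bundle_apply (contMDiffOn_frame x v))

/-- The coordinate expression of a 1-form. -/
def coordOne (x : M) (η : Π y : M, TangentSpace 𝓘(ℝ, E) y →L[ℝ] ℝ) (q : E) : E →L[ℝ] ℝ :=
  η ((extChartAt 𝓘(ℝ, E) x).symm q) ∘L frame x ((extChartAt 𝓘(ℝ, E) x).symm q)

lemma contDiffOn_coordOne [FiniteDimensional ℝ E] (x : M)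
    {η : Π y : M, TangentSpace 𝓘(ℝ, E) y →L[ℝ] ℝ}
    (hη : ContMDiff 𝓘(ℝ, E) (𝓘(ℝ, E).prod 𝓘(ℝ, E →L[ℝ] ℝ)) ∞
      (fun x ↦ Bundle.TotalSpace.mk' (E →L[ℝ] ℝ)
      (E := fun y : M ↦ TangentSpace 𝓘(ℝ, E) y →L[ℝ] Bundle.Trivial M ℝ y) x (η x))) :
    ContDiffOn ℝ ∞ (coordOne x η) (extChartAt 𝓘(ℝ, E) x).target := by
  rw [contDiffOn_clm_apply]
  intro v
  have h1 : ContMDiffOn 𝓘(ℝ, E) (𝓘(ℝ, E).prod 𝓘(ℝ, ℝ)) ∞ (fun y ↦ Bundle.TotalSpace.mk' ℝ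
      (E := Bundle.Trivial M ℝ) y (η y (frame x y v))) (dom E x) :=
    ContMDiffOn.clm_bundle_apply (F₁ := E) (F₂ := ℝ) (E₁ := TangentSpace 𝓘(ℝ, E))
      (E₂ := Bundle.Trivial M ℝ) (b := fun y ↦ y) (ϕ := η) hη.contMDiffOn (contMDiffOn_frame x v)
  have h2 : ContMDiffOn 𝓘(ℝ, E) 𝓘(ℝ, ℝ) ∞ (fun y ↦ η y (frame x y v)) (dom E x) := by
    intro y hy
    have := h1 y hy
    simp only [contMDiffWithinAt_totalSpace] at this
    exact this.2
  exact contDiffOn_coord_of_contMDiffOn h2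

lemma dOne_eq [FiniteDimensional ℝ E] (x : M) {η : Π y : M, TangentSpace 𝓘(ℝ, E) y →L[ℝ] ℝ}
    (hη : DifferentiableAt ℝ (coordOne x η) (extChartAt 𝓘(ℝ, E) x x)) (u v : E) :
    dOne (fun y w ↦ η y w) x (frame x x u) (frame x x v)
      = fderiv ℝ (coordOne x η) (extChartAt 𝓘(ℝ, E) x x) u v
        - fderiv ℝ (coordOne x η) (extChartAt 𝓘(ℝ, E) x x) v u := by
  have h1 : ∀ a b : E, mvfderiv 𝓘(ℝ, E) (fun y ↦ η y (ext (E := E) (frame x x a) y)) x (frame x x b)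
      = fderiv ℝ (coordOne x η) (extChartAt 𝓘(ℝ, E) x x) b a := by
    intro a b
    have h2 : (fun q ↦ η ((extChartAt 𝓘(ℝ, E) x).symm q) (ext (E := E) (frame x x a) _))
        =ᶠ[𝓝 (extChartAt 𝓘(ℝ, E) x x)] fun q ↦ coordOne x η q a := by
      filter_upwards [eventually_chart (dom_mem_nhds (E := E) x)] with q hq
      rw [ext_frame hq]
      rfl
    rw [mvfderiv_frame, h2.fderiv_eq, Flat.fderiv_clm_field hη (differentiableAt_const a)]
    simp
  rw [dOne, mlieBracket_ext, h1, h1, map_zero, sub_zero]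

end Tensors

/-! ### The metric and the Levi-Civita connection in coordinates -/

section Metric

variable {E : Type*} [NormedAddCommGroup E] [NormedSpace ℝ E]
  {M : Type*} [TopologicalSpace M] [ChartedSpace E M] [IsManifold 𝓘(ℝ, E) ∞ M]
  [RiemannianBundle (fun x : M ↦ TangentSpace 𝓘(ℝ, E) x)]

/-- The metric in the coordinate frame of the chart around `x`, at `y`. -/
def frameMetric (x y : M) : E →L[ℝ] E →L[ℝ] ℝ :=
  (innerSL ℝ (E := TangentSpace 𝓘(ℝ, E) y)).bilinearComp (frame x y) (frame x y)

lemma frameMetric_apply (x y : M) (u v : E) :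
    frameMetric x y u v = inner ℝ (frame x y u) (frame x y v) := rfl

/-- The coordinate expression of the metric. -/
def coordMetric (x : M) (q : E) : E →L[ℝ] E →L[ℝ] ℝ :=
  frameMetric x ((extChartAt 𝓘(ℝ, E) x).symm q)

lemma coordMetric_self (x : M) (u v : E) :
    coordMetric x (extChartAt 𝓘(ℝ, E) x x) u v = inner ℝ (frame x x u) (frame x x v) := by
  rw [coordMetric, extChartAt_to_inv, frameMetric_apply]

lemma coordMetric_symm (x : M) (q u v : E) : coordMetric x q u v = coordMetric x q v u := by
  rw [coordMetric, frameMetric_apply, frameMetric_apply, real_inner_comm]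

lemma coordMetric_coframe {x : M} {q : E} (hq : (extChartAt 𝓘(ℝ, E) x).symm q ∈ dom E x)
    (u v : TangentSpace 𝓘(ℝ, E) ((extChartAt 𝓘(ℝ, E) x).symm q)) :
    coordMetric x q (coframe x _ u) (coframe x _ v) = inner ℝ u v := by
  rw [coordMetric, frameMetric_apply, frame_coframe hq, frame_coframe hq]

lemma coordMetric_pos {x : M} {q : E} (hq : (extChartAt 𝓘(ℝ, E) x).symm q ∈ dom E x) (u : E)
    (hu : u ≠ 0) : 0 < coordMetric x q u u := by
  rw [coordMetric, frameMetric_apply]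
  refine real_inner_self_pos.2 fun h ↦ hu ?_
  rw [← coframe_frame hq u, h, map_zero]

lemma contDiffOn_coordMetric [FiniteDimensional ℝ E]
    [IsContMDiffRiemannianBundle 𝓘(ℝ, E) ∞ E (fun x : M ↦ TangentSpace 𝓘(ℝ, E) x)] (x : M) :
    ContDiffOn ℝ ∞ (coordMetric (E := E) x) (extChartAt 𝓘(ℝ, E) x).target := by
  rw [contDiffOn_clm_apply]
  intro u
  rw [contDiffOn_clm_apply]
  intro v
  exact contDiffOn_coord_of_contMDiffOn (h := fun y ↦ inner ℝ (frame x y u) (frame x y v))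
    (ContMDiffOn.inner_bundle (F := E) (E := fun y : M ↦ TangentSpace 𝓘(ℝ, E) y) (b := fun y ↦ y)
      (contMDiffOn_frame x u) (contMDiffOn_frame x v))

lemma koszul_eq (x : M) (Y : Π y : M, TangentSpace 𝓘(ℝ, E) y) (u z : E) :
    koszul (ext (E := E) (frame x x u)) Y (ext (E := E) (frame x x z)) x
      = Flat.conn (coordMetric x) (coord x Y) (extChartAt 𝓘(ℝ, E) x x) u z := by
  have hb : ∀ v w : TangentSpace 𝓘(ℝ, E) x, inner ℝ v w
      = coordMetric x (extChartAt 𝓘(ℝ, E) x x) (coframe x x v) (coframe x x w) := fun v w ↦ by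
    rw [coordMetric_self, frame_self_coframe, frame_self_coframe]
  have hc : ∀ a : E, fderiv ℝ (coord x (ext (E := E) (frame x x a))) (extChartAt 𝓘(ℝ, E) x x) = 0 :=
    fun a ↦ by rw [(coord_ext x _).fderiv_eq]; simp
  have hdom : ∀ᶠ q in 𝓝 (extChartAt 𝓘(ℝ, E) x x), (extChartAt 𝓘(ℝ, E) x).symm q ∈ dom E x :=
    eventually_chart (dom_mem_nhds (E := E) x)
  have e1 : (fun q ↦ inner ℝ (Y ((extChartAt 𝓘(ℝ, E) x).symm q))
      (ext (E := E) (frame x x z) ((extChartAt 𝓘(ℝ, E) x).symm q)))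
      =ᶠ[𝓝 (extChartAt 𝓘(ℝ, E) x x)] fun q ↦ coordMetric x q (coord x Y q) z := by
    filter_upwards [hdom] with q hq
    rw [ext_frame hq, coord, ← coordMetric_coframe hq, coframe_frame hq]
  have e2 : (fun q ↦ inner ℝ (ext (E := E) (frame x x z) ((extChartAt 𝓘(ℝ, E) x).symm q))
      (ext (E := E) (frame x x u) ((extChartAt 𝓘(ℝ, E) x).symm q)))
      =ᶠ[𝓝 (extChartAt 𝓘(ℝ, E) x x)] fun q ↦ coordMetric x q z u := by
    filter_upwards [hdom] with q hq
    rw [ext_frame hq, ext_frame hq]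
    rfl
  have e3 : (fun q ↦ inner ℝ (ext (E := E) (frame x x u) ((extChartAt 𝓘(ℝ, E) x).symm q))
      (Y ((extChartAt 𝓘(ℝ, E) x).symm q)))
      =ᶠ[𝓝 (extChartAt 𝓘(ℝ, E) x x)] fun q ↦ coordMetric x q u (coord x Y q) := by
    filter_upwards [hdom] with q hq
    rw [ext_frame hq, coord, ← coordMetric_coframe hq, coframe_frame hq]
  rw [koszul, mlieBracket_ext, Flat.conn]
  simp only [mvfderiv_eq, e1.fderiv_eq, e2.fderiv_eq, e3.fderiv_eq, hb, mlieBracket_eq, hc,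
    ext_self, coframe_self_frame, coord_self, zero_apply, map_zero, sub_zero, zero_sub, map_neg,
    neg_apply, add_zero]
  ring

lemma conn_isLinear {g : E → E →L[ℝ] E →L[ℝ] ℝ} {Y : E → E} {p : E}
    (hg : DifferentiableAt ℝ g p) (hY : DifferentiableAt ℝ Y p) (hs : ∀ u v, g p u v = g p v u)
    (u : E) : IsLinearMap ℝ fun z ↦ Flat.conn g Y p u z := by
  constructor
  · intro a b
    simp only [Flat.conn_eq hg hY hs, map_add, add_apply]
    ring
  · intro c a
    simp only [Flat.conn_eq hg hY hs, map_smul, smul_apply, smul_eq_mul]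
    ring

variable [FiniteDimensional ℝ E]

/-- The basis expansion defining `leviCivita` gives back the Koszul functional on every vector
because that functional is linear in `z`; this is where differentiability of the metric and of `Y`
is needed. -/
lemma inner_leviCivita {x : M} {Y : Π y : M, TangentSpace 𝓘(ℝ, E) y}
    (hg : DifferentiableAt ℝ (coordMetric (E := E) x) (extChartAt 𝓘(ℝ, E) x x))
    (hY : DifferentiableAt ℝ (coord x Y) (extChartAt 𝓘(ℝ, E) x x)) (u z : E) :
    inner ℝ (leviCivita (frame x x u) Y) (frame x x z)
      = Flat.conn (coordMetric x) (coord x Y) (extChartAt 𝓘(ℝ, E) x x) u z := by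
  set b := stdOrthonormalBasis ℝ (TangentSpace 𝓘(ℝ, E) x) with hb
  have hl := conn_isLinear hg hY (coordMetric_symm x _) u
  have h1 : ∀ i, koszul (ext (E := E) (frame x x u)) Y (ext (E := E) (b i)) x
      = Flat.conn (coordMetric x) (coord x Y) (extChartAt 𝓘(ℝ, E) x x) u (coframe x x (b i)) := by
    intro i
    rw [← koszul_eq, frame_self_coframe]
  have h2 : z = ∑ i, inner ℝ (b i) (frame x x z) • coframe x x (b i) := by
    conv_lhs => rw [← coframe_self_frame x z, ← b.sum_repr' (frame x x z)]
    rw [map_sum]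
    simp only [map_smul]
  rw [leviCivita, sum_inner]
  simp only [← hb, h1, real_inner_smul_left]
  conv_rhs => rw [h2]
  have h3 := map_sum hl.mk' (fun i ↦ inner ℝ (b i) (frame x x z) • coframe x x (b i)) Finset.univ
  simp only [map_smul, IsLinearMap.mk'_apply, smul_eq_mul] at h3
  rw [h3]
  exact Finset.sum_congr rfl fun i _ ↦ mul_comm _ _

end Metric

/-! ### Maps between manifolds read in charts -/

section Maps

variable {E : Type*} [NormedAddCommGroup E] [NormedSpace ℝ E]
  {M : Type*} [TopologicalSpace M] [ChartedSpace E M] [IsManifold 𝓘(ℝ, E) ∞ M]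
  {F : Type*} [NormedAddCommGroup F] [NormedSpace ℝ F]
  {N : Type*} [TopologicalSpace N] [ChartedSpace F N] [IsManifold 𝓘(ℝ, F) ∞ N]

variable (E F) in
/-- A map between manifolds, read in the charts around `x` and `f x`. -/
def coordMap (x : M) (f : M → N) (q : E) : F :=
  extChartAt 𝓘(ℝ, F) (f x) (f ((extChartAt 𝓘(ℝ, E) x).symm q))

lemma coordMap_self (x : M) (f : M → N) :
    coordMap E F x f (extChartAt 𝓘(ℝ, E) x x) = extChartAt 𝓘(ℝ, F) (f x) (f x) := by
  rw [coordMap, extChartAt_to_inv]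

lemma symm_coordMap {x : M} {f : M → N} {q : E}
    (hq : f ((extChartAt 𝓘(ℝ, E) x).symm q) ∈ dom F (f x)) :
    (extChartAt 𝓘(ℝ, F) (f x)).symm (coordMap E F x f q) = f ((extChartAt 𝓘(ℝ, E) x).symm q) :=
  (extChartAt 𝓘(ℝ, F) (f x)).left_inv hq

lemma contDiffAt_coordMap {f : M → N} (hf : ContMDiff 𝓘(ℝ, E) 𝓘(ℝ, F) ∞ f) (x : M) :
    ContDiffAt ℝ ∞ (coordMap E F x f) (extChartAt 𝓘(ℝ, E) x x) := by
  have h := ((contMDiffAt_iff).1 (hf x)).2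
  simp only [modelWithCornersSelf_coe, Set.range_id] at h
  exact h.contDiffAt univ_mem

lemma frame_eq_mfderiv {x : M} {q : E} (hq : q ∈ (extChartAt 𝓘(ℝ, E) x).target) :
    mfderivWithin 𝓘(ℝ, E) 𝓘(ℝ, E) (extChartAt 𝓘(ℝ, E) x).symm (Set.range 𝓘(ℝ, E)) q
      = frame (E := E) x ((extChartAt 𝓘(ℝ, E) x).symm q) := by
  have hy : (extChartAt 𝓘(ℝ, E) x).symm q ∈ dom E x := (extChartAt 𝓘(ℝ, E) x).map_target hq
  have := TangentBundle.symmL_trivializationAt (I := 𝓘(ℝ, E)) (x₀ := x)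
    (x := (extChartAt 𝓘(ℝ, E) x).symm q) (by simpa [dom] using hy)
  rw [(extChartAt 𝓘(ℝ, E) x).right_inv hq] at this
  exact this.symm

lemma coframe_eq_mfderiv {x y : M} (hy : y ∈ dom E x) :
    coframe x y = mfderiv 𝓘(ℝ, E) 𝓘(ℝ, E) (extChartAt 𝓘(ℝ, E) x) y :=
  TangentBundle.continuousLinearMapAt_trivializationAt (by simpa [dom] using hy)

lemma fderiv_coordMap {f : M → N} (hf : ContMDiff 𝓘(ℝ, E) 𝓘(ℝ, F) ∞ f) {x : M} {q : E}
    (hq : q ∈ (extChartAt 𝓘(ℝ, E) x).target)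
    (hq' : f ((extChartAt 𝓘(ℝ, E) x).symm q) ∈ dom F (f x)) (u : E) :
    fderiv ℝ (coordMap E F x f) q u = coframe (f x) (f ((extChartAt 𝓘(ℝ, E) x).symm q))
      (mfderiv 𝓘(ℝ, E) 𝓘(ℝ, F) f ((extChartAt 𝓘(ℝ, E) x).symm q)
        (frame x ((extChartAt 𝓘(ℝ, E) x).symm q) u)) := by
  have h1 : MDifferentiableAt 𝓘(ℝ, E) 𝓘(ℝ, E) (extChartAt 𝓘(ℝ, E) x).symm q := by
    have := mdifferentiableWithinAt_extChartAt_symm (I := 𝓘(ℝ, E)) hq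
    rwa [modelWithCornersSelf_coe, Set.range_id, mdifferentiableWithinAt_univ] at this
  have h2 : MDifferentiableAt 𝓘(ℝ, E) 𝓘(ℝ, F) f ((extChartAt 𝓘(ℝ, E) x).symm q) :=
    (hf _).mdifferentiableAt (by simp)
  have h3 : MDifferentiableAt 𝓘(ℝ, F) 𝓘(ℝ, F) (extChartAt 𝓘(ℝ, F) (f x))
      (f ((extChartAt 𝓘(ℝ, E) x).symm q)) :=
    mdifferentiableAt_extChartAt (by simpa [dom] using hq')
  have hw : mfderiv 𝓘(ℝ, E) 𝓘(ℝ, E) (extChartAt 𝓘(ℝ, E) x).symm q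
      = frame (E := E) x ((extChartAt 𝓘(ℝ, E) x).symm q) := by
    rw [← frame_eq_mfderiv hq, modelWithCornersSelf_coe, Set.range_id, mfderivWithin_univ]
  have h4 : mfderiv 𝓘(ℝ, E) 𝓘(ℝ, F) (coordMap E F x f) q
      = (mfderiv 𝓘(ℝ, F) 𝓘(ℝ, F) (extChartAt 𝓘(ℝ, F) (f x))
        (f ((extChartAt 𝓘(ℝ, E) x).symm q))).comp
        ((mfderiv 𝓘(ℝ, E) 𝓘(ℝ, F) f ((extChartAt 𝓘(ℝ, E) x).symm q)).comp
          (mfderiv 𝓘(ℝ, E) 𝓘(ℝ, E) (extChartAt 𝓘(ℝ, E) x).symm q)) := by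
    have h5 := mfderiv_comp q h2 h1
    have h6 := mfderiv_comp q (g := extChartAt 𝓘(ℝ, F) (f x))
      (f := f ∘ (extChartAt 𝓘(ℝ, E) x).symm) h3 (h2.comp q h1)
    rw [h5] at h6
    exact h6
  rw [mfderiv_eq_fderiv, hw, ← coframe_eq_mfderiv hq'] at h4
  exact congrArg (fun T : E →L[ℝ] F ↦ T u) h4

lemma fderiv_coordMap_coframe {f : M → N} (hf : ContMDiff 𝓘(ℝ, E) 𝓘(ℝ, F) ∞ f) {x : M} {q : E}
    (hq : q ∈ (extChartAt 𝓘(ℝ, E) x).target)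
    (hq' : f ((extChartAt 𝓘(ℝ, E) x).symm q) ∈ dom F (f x))
    (u : TangentSpace 𝓘(ℝ, E) ((extChartAt 𝓘(ℝ, E) x).symm q)) :
    fderiv ℝ (coordMap E F x f) q (coframe x _ u) = coframe (f x) _
      (mfderiv 𝓘(ℝ, E) 𝓘(ℝ, F) f ((extChartAt 𝓘(ℝ, E) x).symm q) u) := by
  rw [fderiv_coordMap hf hq hq', frame_coframe ((extChartAt 𝓘(ℝ, E) x).map_target hq)]

lemma eventually_good {f : M → N} (hf : Continuous f) (x : M) :
    ∀ᶠ q in 𝓝 (extChartAt 𝓘(ℝ, E) x x), q ∈ (extChartAt 𝓘(ℝ, E) x).target ∧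
      f ((extChartAt 𝓘(ℝ, E) x).symm q) ∈ dom F (f x) :=
  Filter.Eventually.and (extChartAt_target_mem_nhds (I := 𝓘(ℝ, E)) x)
    (eventually_chart (P := fun y ↦ f y ∈ dom F (f x))
      (hf.continuousAt.eventually (dom_mem_nhds (E := F) (f x))))

lemma coframe_injective {x y : M} (hy : y ∈ dom E x) : Function.Injective (coframe (E := E) x y) :=
  Function.LeftInverse.injective (g := frame x y) (frame_coframe hy)

end Maps

/-! ### Vertical and horizontal spaces in coordinates -/

section Horizontal

variable {E : Type*} [NormedAddCommGroup E] [NormedSpace ℝ E] [FiniteDimensional ℝ E]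
  {M : Type*} [TopologicalSpace M] [ChartedSpace E M] [IsManifold 𝓘(ℝ, E) ∞ M]
  [RiemannianBundle (fun x : M ↦ TangentSpace 𝓘(ℝ, E) x)]
  {F : Type*} [NormedAddCommGroup F] [NormedSpace ℝ F]
  {N : Type*} [TopologicalSpace N] [ChartedSpace F N]

section

variable {f : M → N} {x : M} {u v : TangentSpace 𝓘(ℝ, E) x}

lemma mem_vertical : u ∈ vertical E F f x ↔ mfderiv 𝓘(ℝ, E) 𝓘(ℝ, F) f x u = 0 := Iff.rfl

lemma mem_horizontal : u ∈ horizontal E F f x ↔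
    ∀ k ∈ vertical E F f x, inner ℝ u k = 0 := by
  rw [horizontal, Submodule.mem_orthogonal']

lemma hproj_mem (u : TangentSpace 𝓘(ℝ, E) x) : hproj F f x u ∈ horizontal E F f x :=
  Submodule.starProjection_apply_mem _ _

lemma vproj_mem (u : TangentSpace 𝓘(ℝ, E) x) : vproj F f x u ∈ vertical E F f x :=
  Submodule.starProjection_apply_mem _ _

lemma hproj_add_vproj (u : TangentSpace 𝓘(ℝ, E) x) : hproj F f x u + vproj F f x u = u := by
  have h := (vertical E F f x).starProjection_add_starProjection_orthogonal u
  rw [add_comm]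
  exact h

lemma hproj_of_vertical (h : u ∈ vertical E F f x) : hproj F f x u = 0 :=
  (Submodule.starProjection_apply_eq_zero_iff _).2 ((Submodule.le_orthogonal_orthogonal _) h)

lemma hproj_of_horizontal (h : u ∈ horizontal E F f x) : hproj F f x u = u :=
  Submodule.starProjection_eq_self_iff.2 h

lemma hproj_eq_zero (h : ∀ z ∈ horizontal E F f x, inner ℝ u z = 0) : hproj F f x u = 0 :=
  (Submodule.starProjection_apply_eq_zero_iff _).2 ((Submodule.mem_orthogonal' _ _).2 h)

lemma vproj_eq_zero (h : ∀ z ∈ vertical E F f x, inner ℝ u z = 0) : vproj F f x u = 0 :=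
  (Submodule.starProjection_apply_eq_zero_iff _).2 ((Submodule.mem_orthogonal' _ _).2 h)

end

variable [IsManifold 𝓘(ℝ, F) ∞ N] {f : M → N} (hf : ContMDiff 𝓘(ℝ, E) 𝓘(ℝ, F) ∞ f) {x : M} {q : E}
  (hq : q ∈ (extChartAt 𝓘(ℝ, E) x).target)
  (hq' : f ((extChartAt 𝓘(ℝ, E) x).symm q) ∈ dom F (f x))

include hf hq hq'

lemma fderiv_coordMap_eq_zero (u : TangentSpace 𝓘(ℝ, E) ((extChartAt 𝓘(ℝ, E) x).symm q)) :
    fderiv ℝ (coordMap E F x f) q (coframe x _ u) = 0 ↔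
      u ∈ vertical E F f ((extChartAt 𝓘(ℝ, E) x).symm q) := by
  rw [fderiv_coordMap_coframe hf hq hq', mem_vertical]
  exact map_eq_zero_iff _ (coframe_injective hq')

lemma hor_coframe_iff (u : TangentSpace 𝓘(ℝ, E) ((extChartAt 𝓘(ℝ, E) x).symm q)) :
    Flat.Hor (coordMetric x) (coordMap E F x f) q (coframe x _ u) ↔
      u ∈ horizontal E F f ((extChartAt 𝓘(ℝ, E) x).symm q) := by
  have hy := (extChartAt 𝓘(ℝ, E) x).map_target hq
  rw [mem_horizontal, Flat.Hor]
  constructor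
  · intro h k hk
    rw [← coordMetric_coframe hy]
    exact h _ ((fderiv_coordMap_eq_zero hf hq hq' k).2 hk)
  · intro h k hk
    rw [← coframe_frame hy k, fderiv_coordMap_eq_zero hf hq hq'] at hk
    rw [← coframe_frame hy k, coordMetric_coframe hy]
    exact h _ hk

end Horizontal

lemma Flat.dTwo_congr {E : Type*} [NormedAddCommGroup E] [NormedSpace ℝ E]
    {α β : E → E → E → ℝ} {p : E} (h : ∀ᶠ q in 𝓝 p, ∀ a b, α q a b = β q a b) (u v w : E) :
    Flat.dTwo α p u v w = Flat.dTwo β p u v w := by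
  have h1 : ∀ a b, (fun q ↦ α q a b) =ᶠ[𝓝 p] fun q ↦ β q a b := fun a b ↦ by
    filter_upwards [h] with q hq using hq a b
  simp only [Flat.dTwo, (h1 _ _).fderiv_eq]

section Single

variable {E : Type*} [NormedAddCommGroup E] [NormedSpace ℝ E]
  {M : Type*} [TopologicalSpace M] [ChartedSpace E M] [IsManifold 𝓘(ℝ, E) ∞ M]
  [RiemannianBundle (fun x : M ↦ TangentSpace 𝓘(ℝ, E) x)]

lemma coordForm_inner (x : M) (J : Π y : M, TangentSpace 𝓘(ℝ, E) y →L[ℝ] TangentSpace 𝓘(ℝ, E) y) :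
    ∀ᶠ q in 𝓝 (extChartAt 𝓘(ℝ, E) x x), ∀ a b, coordForm x (fun y a b ↦ inner ℝ a (J y b)) q a b
      = coordMetric x q a (coordEndo x J q b) := by
  filter_upwards [eventually_chart (P := fun y ↦ y ∈ dom E x) (dom_mem_nhds (E := E) x)] with q hq a b
  rw [coordMetric, frameMetric_apply, coordForm]
  exact congrArg (inner ℝ _) (frame_coframe hq _).symm

lemma coordEndo_coframe (x : M)
    (J : Π y : M, TangentSpace 𝓘(ℝ, E) y →L[ℝ] TangentSpace 𝓘(ℝ, E) y) {q : E}
    (hq : (extChartAt 𝓘(ℝ, E) x).symm q ∈ dom E x)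
    (u : TangentSpace 𝓘(ℝ, E) ((extChartAt 𝓘(ℝ, E) x).symm q)) :
    coordEndo x J q (coframe x _ u) = coframe x _ (J _ u) :=
  congrArg (fun w ↦ coframe x _ (J _ w)) (frame_coframe hq u)

/-- The base point is a free `y` with an equation because on `N` the point f(q) is recovered from
its coordinates only up to a propositional equality. -/
lemma coordEndo_eq (x : M)
    (J : Π y : M, TangentSpace 𝓘(ℝ, E) y →L[ℝ] TangentSpace 𝓘(ℝ, E) y) {q : E} {y : M}
    (hy : (extChartAt 𝓘(ℝ, E) x).symm q = y) (hq : y ∈ dom E x) (u : TangentSpace 𝓘(ℝ, E) y) :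
    coordEndo x J q (coframe x y u) = coframe x y (J y u) := by
  subst hy
  exact coordEndo_coframe x J hq u

lemma coordMetric_eq (x : M) {q : E} {y : M} (hy : (extChartAt 𝓘(ℝ, E) x).symm q = y)
    (hq : y ∈ dom E x) (u v : TangentSpace 𝓘(ℝ, E) y) :
    coordMetric x q (coframe x y u) (coframe x y v) = inner ℝ u v := by
  subst hy
  exact coordMetric_coframe hq u v

lemma coordOne_coframe (x : M) (η : Π y : M, TangentSpace 𝓘(ℝ, E) y →L[ℝ] ℝ) {q : E}
    (hq : (extChartAt 𝓘(ℝ, E) x).symm q ∈ dom E x)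
    (u : TangentSpace 𝓘(ℝ, E) ((extChartAt 𝓘(ℝ, E) x).symm q)) :
    coordOne x η q (coframe x _ u) = η _ u :=
  congrArg (fun w ↦ η _ w) (frame_coframe hq u)

end Single

/-! ### A contact-complex submersion in charts -/

section Submersion

variable {E : Type*} [NormedAddCommGroup E] [NormedSpace ℝ E] [FiniteDimensional ℝ E]
    {M : Type*} [TopologicalSpace M]
    [ChartedSpace E M] [IsManifold 𝓘(ℝ, E) ∞ M]
    [RiemannianBundle (fun x : M ↦ TangentSpace 𝓘(ℝ, E) x)]
    [IsContMDiffRiemannianBundle 𝓘(ℝ, E) ∞ E (fun x : M ↦ TangentSpace 𝓘(ℝ, E) x)]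
    {F : Type*} [NormedAddCommGroup F] [NormedSpace ℝ F] [FiniteDimensional ℝ F]
    {N : Type*} [TopologicalSpace N]
    [ChartedSpace F N] [IsManifold 𝓘(ℝ, F) ∞ N]
    [RiemannianBundle (fun x : N ↦ TangentSpace 𝓘(ℝ, F) x)]
    [IsContMDiffRiemannianBundle 𝓘(ℝ, F) ∞ F (fun x : N ↦ TangentSpace 𝓘(ℝ, F) x)]

lemma differentiableAt_coordMetric (x : M) :
    DifferentiableAt ℝ (coordMetric (E := E) x) (extChartAt 𝓘(ℝ, E) x x) :=
  ((contDiffOn_coordMetric x).contDiffAt (extChartAt_target_mem_nhds x)).differentiableAt (by simp)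

lemma AlmostContactMetric.differentiableAt_φ (S : AlmostContactMetric E M) (x : M) :
    DifferentiableAt ℝ (coordEndo x S.φ) (extChartAt 𝓘(ℝ, E) x x) :=
  ((contDiffOn_coordEndo x S.contMDiff_φ).contDiffAt
    (extChartAt_target_mem_nhds x)).differentiableAt (by simp)

lemma AlmostContactMetric.differentiableAt_η (S : AlmostContactMetric E M) (x : M) :
    DifferentiableAt ℝ (coordOne x S.η) (extChartAt 𝓘(ℝ, E) x x) :=
  ((contDiffOn_coordOne x S.contMDiff_η).contDiffAt
    (extChartAt_target_mem_nhds x)).differentiableAt (by simp)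

lemma AlmostContactMetric.differentiableAt_ξ (S : AlmostContactMetric E M) (x : M) :
    DifferentiableAt ℝ (coord x S.ξ) (extChartAt 𝓘(ℝ, E) x x) :=
  ((contDiffOn_coord x S.contMDiff_ξ.contMDiffOn).contDiffAt
    (extChartAt_target_mem_nhds x)).differentiableAt (by simp)

lemma AlmostHermitian.differentiableAt_J (T : AlmostHermitian F N) (x : N) :
    DifferentiableAt ℝ (coordEndo x T.J) (extChartAt 𝓘(ℝ, F) x x) :=
  ((contDiffOn_coordEndo x T.contMDiff_J).contDiffAt
    (extChartAt_target_mem_nhds x)).differentiableAt (by simp)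

theorem IsContactComplexSubmersion.localSubmersion {S : AlmostContactMetric E M}
    {T : AlmostHermitian F N} {f : M → N} (hf : IsContactComplexSubmersion S T f)
    (hcos : S.AlmostCosymplectic) (x : M) :
    Flat.LocalSubmersion (coordMetric x) (coordEndo x S.φ) (coord x S.ξ) (coordOne x S.η)
      (coordMap E F x f) (coordMetric (f x)) (coordEndo (f x) T.J) (extChartAt 𝓘(ℝ, E) x x) := by
  have hgood := eventually_good (E := E) (F := F) hf.contMDiff.continuous x
  -- Pointwise identities hold wherever both charts are available, and these points form a
  -- neighbourhood of the coordinates of x.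
  have key : ∀ {P : E → Prop}, (∀ q, q ∈ (extChartAt 𝓘(ℝ, E) x).target →
      (extChartAt 𝓘(ℝ, E) x).symm q ∈ dom E x →
      f ((extChartAt 𝓘(ℝ, E) x).symm q) ∈ dom F (f x) → P q) →
      ∀ᶠ q in 𝓝 (extChartAt 𝓘(ℝ, E) x x), P q := by
    intro P hP
    filter_upwards [hgood] with q hq
    exact hP q hq.1 ((extChartAt 𝓘(ℝ, E) x).map_target hq.1) hq.2
  constructor
  case diff_g => exact differentiableAt_coordMetric x
  case diff_φ => exact S.differentiableAt_φ x
  case diff_η => exact S.differentiableAt_η x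
  case diff_f => exact (contDiffAt_coordMap hf.contMDiff x).of_le (by norm_cast)
  case diff_g' => rw [coordMap_self]; exact differentiableAt_coordMetric (f x)
  case diff_J => rw [coordMap_self]; exact T.differentiableAt_J (f x)
  case symm => exact Eventually.of_forall fun q ↦ coordMetric_symm x q
  case pos => exact key fun q _ hy _ u hu ↦ coordMetric_pos hy u hu
  case φ_φ =>
    refine key fun q _ hy _ u ↦ ?_
    rw [← coframe_frame hy u, coordEndo_coframe x S.φ hy, coordEndo_coframe x S.φ hy, S.φ_φ,
      coordOne_coframe x S.η hy, map_add, map_neg, map_smul]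
    rfl
  case η_ξ =>
    refine key fun q _ hy _ ↦ ?_
    rw [coord, coordOne_coframe x S.η hy, S.η_ξ]
  case g_φ_φ =>
    refine key fun q _ hy _ u v ↦ ?_
    rw [← coframe_frame hy u, ← coframe_frame hy v, coordEndo_coframe x S.φ hy,
      coordEndo_coframe x S.φ hy, coordMetric_coframe hy, coordMetric_coframe hy,
      coordOne_coframe x S.η hy, coordOne_coframe x S.η hy, S.inner_φ_φ]
  case surj =>
    refine key fun q hq hy hy' w ↦ ?_
    obtain ⟨u, hu⟩ := hf.submersion _ (frame (f x) (f ((extChartAt 𝓘(ℝ, E) x).symm q)) w)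
    refine ⟨coframe x _ u, ?_⟩
    rw [fderiv_coordMap_coframe hf.contMDiff hq hy', hu, coframe_frame hy']
  case iso =>
    refine key fun q hq hy hy' u v hu hv ↦ ?_
    rw [← coframe_frame hy u, ← coframe_frame hy v] at *
    rw [hor_coframe_iff hf.contMDiff hq hy'] at hu hv
    rw [fderiv_coordMap_coframe hf.contMDiff hq hy', fderiv_coordMap_coframe hf.contMDiff hq hy',
      coordMetric_eq (f x) (symm_coordMap hy') hy', coordMetric_coframe hy, hf.isometry _ _ hu _ hv]
  case hol =>
    refine key fun q hq hy hy' u ↦ ?_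
    rw [← coframe_frame hy u, fderiv_coordMap_coframe hf.contMDiff hq hy', coordEndo_coframe x S.φ hy,
      coordEndo_eq (f x) T.J (symm_coordMap hy') hy', hf.holomorphic,
      fderiv_coordMap_coframe hf.contMDiff hq hy']
  case J_J =>
    refine key fun q hq hy hy' u ↦ ?_
    rw [← coframe_frame hy' u, coordEndo_eq (f x) T.J (symm_coordMap hy') hy',
      coordEndo_eq (f x) T.J (symm_coordMap hy') hy', T.J_J, map_neg]
  case symm' => exact coordMetric_symm (f x) _
  case g_J_J =>
    intro u v
    have hy' := mem_dom_self (E := F) (f x)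
    have hs := extChartAt_to_inv (I := 𝓘(ℝ, F)) (f x)
    rw [coordMap_self, ← coframe_frame hy' u, ← coframe_frame hy' v,
      coordEndo_eq (f x) T.J hs hy', coordEndo_eq (f x) T.J hs hy',
      coordMetric_eq (f x) hs hy', coordMetric_eq (f x) hs hy', T.inner_J_J]
  case closed_η =>
    intro u v
    have := dOne_eq x (S.differentiableAt_η x) u v
    rw [hcos.1] at this
    linarith
  case closed_Φ =>
    intro u v w
    rw [← Flat.dTwo_congr (coordForm_inner x S.φ), ← dTwo_eq]
    · exact hcos.2 x _ _ _
    · intro w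
      exact inner_zero_left _

end Submersion

/-! ### Vanishing of the tensors A and B -/

section Vanishing

variable {E : Type*} [NormedAddCommGroup E] [NormedSpace ℝ E] [FiniteDimensional ℝ E]
    {M : Type*} [TopologicalSpace M]
    [ChartedSpace E M] [IsManifold 𝓘(ℝ, E) ∞ M]
    [RiemannianBundle (fun x : M ↦ TangentSpace 𝓘(ℝ, E) x)]
    [IsContMDiffRiemannianBundle 𝓘(ℝ, E) ∞ E (fun x : M ↦ TangentSpace 𝓘(ℝ, E) x)]
    {F : Type*} [NormedAddCommGroup F] [NormedSpace ℝ F] [FiniteDimensional ℝ F]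
    {N : Type*} [TopologicalSpace N]
    [ChartedSpace F N] [IsManifold 𝓘(ℝ, F) ∞ N]
    [RiemannianBundle (fun x : N ↦ TangentSpace 𝓘(ℝ, F) x)]
    [IsContMDiffRiemannianBundle 𝓘(ℝ, F) ∞ F (fun x : N ↦ TangentSpace 𝓘(ℝ, F) x)]
    {S : AlmostContactMetric E M} {T : AlmostHermitian F N} {f : M → N}

lemma fderiv_coordMap_eq_zero_of_eq (hf : ContMDiff 𝓘(ℝ, E) 𝓘(ℝ, F) ∞ f) {x y : M} {q : E}
    (hq : q ∈ (extChartAt 𝓘(ℝ, E) x).target) (hy : (extChartAt 𝓘(ℝ, E) x).symm q = y)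
    (hq' : f y ∈ dom F (f x)) (u : TangentSpace 𝓘(ℝ, E) y) :
    fderiv ℝ (coordMap E F x f) q (coframe x y u) = 0 ↔ u ∈ vertical E F f y := by
  subst hy
  exact fderiv_coordMap_eq_zero hf hq hq' u

lemma hor_coframe_iff_of_eq (hf : ContMDiff 𝓘(ℝ, E) 𝓘(ℝ, F) ∞ f) {x y : M} {q : E}
    (hq : q ∈ (extChartAt 𝓘(ℝ, E) x).target) (hy : (extChartAt 𝓘(ℝ, E) x).symm q = y)
    (hq' : f y ∈ dom F (f x)) (u : TangentSpace 𝓘(ℝ, E) y) :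
    Flat.Hor (coordMetric x) (coordMap E F x f) q (coframe x y u) ↔ u ∈ horizontal E F f y := by
  subst hy
  exact hor_coframe_iff hf hq hq' u

lemma fderiv_coordMap_self_eq_zero (hf : ContMDiff 𝓘(ℝ, E) 𝓘(ℝ, F) ∞ f) (x : M)
    (u : TangentSpace 𝓘(ℝ, E) x) :
    fderiv ℝ (coordMap E F x f) (extChartAt 𝓘(ℝ, E) x x) (coframe x x u) = 0 ↔
      u ∈ vertical E F f x :=
  fderiv_coordMap_eq_zero_of_eq hf (mem_extChartAt_target x) (extChartAt_to_inv x) (mem_dom_self _) u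

lemma hor_coframe_self_iff (hf : ContMDiff 𝓘(ℝ, E) 𝓘(ℝ, F) ∞ f) (x : M)
    (u : TangentSpace 𝓘(ℝ, E) x) :
    Flat.Hor (coordMetric x) (coordMap E F x f) (extChartAt 𝓘(ℝ, E) x x) (coframe x x u) ↔
      u ∈ horizontal E F f x :=
  hor_coframe_iff_of_eq hf (mem_extChartAt_target x) (extChartAt_to_inv x) (mem_dom_self _) u

lemma differentiableAt_coord_endo {x : M}
    {J : Π y : M, TangentSpace 𝓘(ℝ, E) y →L[ℝ] TangentSpace 𝓘(ℝ, E) y}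
    (hJ : DifferentiableAt ℝ (coordEndo x J) (extChartAt 𝓘(ℝ, E) x x))
    {Y : Π y : M, TangentSpace 𝓘(ℝ, E) y}
    (hY : DifferentiableAt ℝ (coord x Y) (extChartAt 𝓘(ℝ, E) x x)) :
    DifferentiableAt ℝ (coord x (fun y ↦ J y (Y y))) (extChartAt 𝓘(ℝ, E) x x) := by
  refine (hJ.clm_apply hY).congr_of_eventuallyEq ?_
  filter_upwards [eventually_chart (P := fun y ↦ y ∈ dom E x) (dom_mem_nhds (E := E) x)] with q hq
  exact (coordEndo_coframe x J hq _).symm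

lemma differentiableAt_coord_ext {x : M} (v : TangentSpace 𝓘(ℝ, E) x) :
    DifferentiableAt ℝ (coord x (ext (E := E) v)) (extChartAt 𝓘(ℝ, E) x x) :=
  (differentiableAt_const _).congr_of_eventuallyEq (coord_ext x v)

namespace IsContactComplexSubmersion

variable (hf : IsContactComplexSubmersion S T f)

include hf

lemma φ_mem_vertical {x : M} {u : TangentSpace 𝓘(ℝ, E) x} (hu : u ∈ vertical E F f x) :
    S.φ x u ∈ vertical E F f x := by
  rw [mem_vertical] at hu ⊢
  rw [← hf.holomorphic, hu, map_zero]

variable (hcos : S.AlmostCosymplectic)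

include hcos

lemma φ_mem_horizontal {x : M} {u : TangentSpace 𝓘(ℝ, E) x} (hu : u ∈ horizontal E F f x) :
    S.φ x u ∈ horizontal E F f x := by
  have h := hf.localSubmersion hcos x
  rw [← hor_coframe_self_iff hf.contMDiff] at hu ⊢
  have h1 := h.contact.self_of_nhds.hor_φ h.hol.self_of_nhds hu
  rw [coordEndo_self, frame_self_coframe] at h1
  exact h1

/-- The differentiable family of `exists_projection` is the orthogonal projection: its values are
horizontal and differ from the given field by vertical vectors. Horizontal and vertical parts of
fields can then enter `inner_leviCivita`. -/
lemma differentiableAt_hproj {x : M} {Y : Π y : M, TangentSpace 𝓘(ℝ, E) y}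
    (hY : DifferentiableAt ℝ (coord x Y) (extChartAt 𝓘(ℝ, E) x x)) :
    DifferentiableAt ℝ (coord x (fun y ↦ hproj F f y (Y y))) (extChartAt 𝓘(ℝ, E) x x) := by
  have h := hf.localSubmersion hcos x
  obtain ⟨P, hP, hP'⟩ := h.exists_projection
  refine (hP.clm_apply hY).congr_of_eventuallyEq ?_
  filter_upwards [hP', eventually_good (E := E) (F := F) hf.contMDiff.continuous x] with q h1 hq
  have hy := (extChartAt 𝓘(ℝ, E) x).map_target hq.1
  obtain ⟨h2, h3⟩ := h1 (coord x Y q)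
  rw [← coframe_frame hy (P q (coord x Y q)), hor_coframe_iff hf.contMDiff hq.1 hq.2] at h2
  rw [← coframe_frame hy (P q (coord x Y q)), coord,
    fderiv_coordMap_coframe hf.contMDiff hq.1 hq.2,
    fderiv_coordMap_coframe hf.contMDiff hq.1 hq.2] at h3
  have h4 := coframe_injective hq.2 h3
  set w := frame x ((extChartAt 𝓘(ℝ, E) x).symm q) (P q (coord x Y q)) with hw
  have h5 : Y ((extChartAt 𝓘(ℝ, E) x).symm q) - w ∈ vertical E F f _ := by
    rw [mem_vertical, map_sub, sub_eq_zero]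
    exact h4.symm
  have h6 : hproj F f _ (Y ((extChartAt 𝓘(ℝ, E) x).symm q)) = w := by
    have h7 : hproj F f _ (Y ((extChartAt 𝓘(ℝ, E) x).symm q) - w) = 0 := hproj_of_vertical h5
    have h8 : hproj F f _ (Y ((extChartAt 𝓘(ℝ, E) x).symm q) - w)
        = hproj F f _ (Y ((extChartAt 𝓘(ℝ, E) x).symm q)) - hproj F f _ w :=
      map_sub (Submodule.starProjection _) _ _
    rw [h8, hproj_of_horizontal h2, sub_eq_zero] at h7
    exact h7
  rw [coord, h6, hw, coframe_frame hy]

lemma differentiableAt_vproj {x : M} {Y : Π y : M, TangentSpace 𝓘(ℝ, E) y}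
    (hY : DifferentiableAt ℝ (coord x Y) (extChartAt 𝓘(ℝ, E) x x)) :
    DifferentiableAt ℝ (coord x (fun y ↦ vproj F f y (Y y))) (extChartAt 𝓘(ℝ, E) x x) := by
  have h1 : coord x (fun y ↦ vproj F f y (Y y))
      = fun q ↦ coord x Y q - coord x (fun y ↦ hproj F f y (Y y)) q := by
    funext q
    rw [coord, coord, coord, ← map_sub, eq_sub_of_add_eq' (hproj_add_vproj (F := F) (f := f) _)]
  rw [h1]
  exact hY.sub (hf.differentiableAt_hproj hcos hY)

/-- The horizontal distribution is totally geodesic: `∇_u Y` is horizontal for `Y` horizontal. -/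
lemma vproj_leviCivita {x : M} {Y : Π y : M, TangentSpace 𝓘(ℝ, E) y}
    (hY : DifferentiableAt ℝ (coord x Y) (extChartAt 𝓘(ℝ, E) x x))
    (hY' : ∀ y, Y y ∈ horizontal E F f y) {u : TangentSpace 𝓘(ℝ, E) x}
    (hu : u ∈ horizontal E F f x) : vproj F f x (leviCivita u Y) = 0 := by
  have h := hf.localSubmersion hcos x
  refine vproj_eq_zero fun z hz ↦ ?_
  rw [← fderiv_coordMap_self_eq_zero hf.contMDiff] at hz
  rw [← hor_coframe_self_iff hf.contMDiff] at hu
  rw [← frame_self_coframe x u, ← frame_self_coframe x z,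
    inner_leviCivita (differentiableAt_coordMetric x) hY]
  refine h.conn_hor_ver hY ?_ hu hz
  filter_upwards [eventually_good (E := E) (F := F) hf.contMDiff.continuous x] with q hq
  exact (hor_coframe_iff hf.contMDiff hq.1 hq.2 _).2 (hY' _)

/-- `∇_u Y` is vertical for `Y` vertical and `u` horizontal. -/
lemma hproj_leviCivita {x : M} {Y : Π y : M, TangentSpace 𝓘(ℝ, E) y}
    (hY : DifferentiableAt ℝ (coord x Y) (extChartAt 𝓘(ℝ, E) x x))
    (hY' : ∀ y, Y y ∈ vertical E F f y) {u : TangentSpace 𝓘(ℝ, E) x}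
    (hu : u ∈ horizontal E F f x) : hproj F f x (leviCivita u Y) = 0 := by
  have h := hf.localSubmersion hcos x
  refine hproj_eq_zero fun z hz ↦ ?_
  rw [← hor_coframe_self_iff hf.contMDiff] at hu hz
  rw [← frame_self_coframe x u, ← frame_self_coframe x z,
    inner_leviCivita (differentiableAt_coordMetric x) hY]
  refine h.conn_ver_hor hY ?_ hu hz
  filter_upwards [eventually_good (E := E) (F := F) hf.contMDiff.continuous x] with q hq
  exact (fderiv_coordMap_eq_zero hf.contMDiff hq.1 hq.2 _).2 (hY' _)

/-- Each of the two terms is zero by itself: the parts hY and vY stay horizontal and vertical,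
respectively, under horizontal differentiation. -/
theorem oneillA_eq_zero {x : M} (u : TangentSpace 𝓘(ℝ, E) x)
    {Y : Π y : M, TangentSpace 𝓘(ℝ, E) y}
    (hY : DifferentiableAt ℝ (coord x Y) (extChartAt 𝓘(ℝ, E) x x)) :
    oneillA F f u Y = 0 := by
  rw [oneillA, hf.vproj_leviCivita hcos (hf.differentiableAt_hproj hcos hY)
    (fun _ ↦ hproj_mem _) (hproj_mem u), hf.hproj_leviCivita hcos
    (hf.differentiableAt_vproj hcos hY) (fun _ ↦ vproj_mem _) (hproj_mem u), add_zero]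

/-- As φ preserves H and V, each of the four terms is the vertical part of a derivative of a
horizontal field or the horizontal part of a derivative of a vertical one, in a horizontal
direction. -/
theorem tensorB_eq_zero {x : M} (u : TangentSpace 𝓘(ℝ, E) x)
    {Y : Π y : M, TangentSpace 𝓘(ℝ, E) y}
    (hY : DifferentiableAt ℝ (coord x Y) (extChartAt 𝓘(ℝ, E) x x)) :
    tensorB F S f u Y = 0 := by
  have hh := hf.differentiableAt_hproj hcos hY
  have hv := hf.differentiableAt_vproj hcos hY
  have hφ := S.differentiableAt_φ x
  have hu := hf.φ_mem_horizontal hcos (hproj_mem u)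
  rw [tensorB, hf.vproj_leviCivita hcos (differentiableAt_coord_endo hφ hh)
      (fun _ ↦ hf.φ_mem_horizontal hcos (hproj_mem _)) (hproj_mem u),
    hf.vproj_leviCivita hcos hh (fun _ ↦ hproj_mem _) hu,
    hf.hproj_leviCivita hcos (differentiableAt_coord_endo hφ hv)
      (fun _ ↦ hf.φ_mem_vertical (vproj_mem _)) (hproj_mem u),
    hf.hproj_leviCivita hcos hv (fun _ ↦ vproj_mem _) hu]
  simp

end IsContactComplexSubmersion

end Vanishing

/-! ### A closed fundamental form is harmonic -/

section Harmonic

variable {F : Type*} [NormedAddCommGroup F] [NormedSpace ℝ F] [FiniteDimensional ℝ F]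
    {N : Type*} [TopologicalSpace N]
    [ChartedSpace F N] [IsManifold 𝓘(ℝ, F) ∞ N]
    [RiemannianBundle (fun x : N ↦ TangentSpace 𝓘(ℝ, F) x)]
    [IsContMDiffRiemannianBundle 𝓘(ℝ, F) ∞ F (fun x : N ↦ TangentSpace 𝓘(ℝ, F) x)]

namespace AlmostHermitian

variable (T : AlmostHermitian F N)

lemma inner_J_left {x : N} (u v : TangentSpace 𝓘(ℝ, F) x) :
    inner ℝ u (T.J x v) = - inner ℝ (T.J x u) v := by
  have h := T.inner_J_J x u (T.J x v)
  rw [T.J_J, inner_neg_right] at h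
  linarith

lemma dTwo_eq (x : N) (u v w : F) :
    dTwo T.fundamentalForm x (frame x x u) (frame x x v) (frame x x w)
      = Flat.dTwo (fun q a b ↦ coordMetric x q a (coordEndo x T.J q b))
        (extChartAt 𝓘(ℝ, F) x x) u v w := by
  rw [← Flat.dTwo_congr (coordForm_inner x T.J), ← ContactComplex.dTwo_eq]
  · rfl
  · exact fun w ↦ inner_zero_left _

lemma inner_leviCivita_ext (x : N) (u v w : F) :
    inner ℝ (leviCivita (frame x x u) (ext (E := F) (frame x x v))) (frame x x w)
      = (1 / 2 : ℝ) * (fderiv ℝ (coordMetric x) (extChartAt 𝓘(ℝ, F) x x) u v w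
        + fderiv ℝ (coordMetric x) (extChartAt 𝓘(ℝ, F) x x) v w u
        - fderiv ℝ (coordMetric x) (extChartAt 𝓘(ℝ, F) x x) w u v) := by
  have hg := differentiableAt_coordMetric (E := F) x
  rw [inner_leviCivita hg (differentiableAt_coord_ext _),
    Flat.conn_eq hg (differentiableAt_coord_ext _) (coordMetric_symm x _),
    (coord_ext x _).fderiv_eq, coord_self, ext_self, coframe_self_frame]
  simp

/-- J is skew, so Ω(v, ∇_u w) = -g(Jv, ∇_u w); hence the opposite signs of the two Christoffel terms
in `Flat.covForm`. -/
lemma covTwo_eq (x : N) (u v w : F) :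
    covTwo T.fundamentalForm x (frame x x u) (frame x x v) (frame x x w)
      = Flat.covForm (coordMetric x) (coordEndo x T.J) (extChartAt 𝓘(ℝ, F) x x) u v w := by
  have hg := differentiableAt_coordMetric (E := F) x
  have hJ := T.differentiableAt_J x
  have hJ' : ∀ a, T.J x (frame x x a)
      = frame x x (coordEndo x T.J (extChartAt 𝓘(ℝ, F) x x) a) := fun a ↦ by
    rw [coordEndo_self, frame_self_coframe]
  have h1 : mvfderiv 𝓘(ℝ, F) (fun y ↦ T.fundamentalForm y (ext (E := F) (frame x x v) y)
      (ext (E := F) (frame x x w) y)) x (frame x x u)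
      = fderiv ℝ (Flat.form (coordMetric x) (coordEndo x T.J)) (extChartAt 𝓘(ℝ, F) x x) u v w := by
    rw [mvfderiv_form, ← Flat.fderiv_bilin_const (Flat.differentiableAt_form hg hJ)]
    refine Flat.fderiv_apply_congr ?_ u
    filter_upwards [coordForm_inner x T.J] with q hq using hq v w
  rw [covTwo, h1, fundamentalForm, fundamentalForm, hJ', inner_leviCivita_ext, inner_J_left,
    real_inner_comm, hJ', inner_leviCivita_ext, Flat.covForm]
  ring

variable {T}

lemma codiffTwo_eq_zero
    (hc : ∀ (x : N) (u v w : TangentSpace 𝓘(ℝ, F) x), dTwo T.fundamentalForm x u v w = 0)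
    (x : N) (v : TangentSpace 𝓘(ℝ, F) x) : codiffTwo T.fundamentalForm x v = 0 := by
  have hg := differentiableAt_coordMetric (E := F) x
  have hJ := T.differentiableAt_J x
  have hdom : ∀ᶠ q in 𝓝 (extChartAt 𝓘(ℝ, F) x x), (extChartAt 𝓘(ℝ, F) x).symm q ∈ dom F x :=
    eventually_chart (dom_mem_nhds (E := F) x)
  have hs : ∀ᶠ q in 𝓝 (extChartAt 𝓘(ℝ, F) x x), ∀ u v,
      coordMetric x q u v = coordMetric x q v u := Eventually.of_forall fun q ↦ coordMetric_symm x q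
  have hJJ : ∀ᶠ q in 𝓝 (extChartAt 𝓘(ℝ, F) x x), ∀ u,
      coordEndo x T.J q (coordEndo x T.J q u) = -u := by
    filter_upwards [hdom] with q hq u
    rw [← coframe_frame hq u, coordEndo_coframe x T.J hq, coordEndo_coframe x T.J hq, T.J_J, map_neg]
  have hgJ : ∀ᶠ q in 𝓝 (extChartAt 𝓘(ℝ, F) x x), ∀ u v,
      coordMetric x q (coordEndo x T.J q u) (coordEndo x T.J q v) = coordMetric x q u v := by
    filter_upwards [hdom] with q hq u v
    rw [← coframe_frame hq u, ← coframe_frame hq v, coordEndo_coframe x T.J hq,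
      coordEndo_coframe x T.J hq, coordMetric_coframe hq, coordMetric_coframe hq, T.inner_J_J]
  have hc' : ∀ u v w, Flat.dTwo (fun q a b ↦ coordMetric x q a (coordEndo x T.J q b))
      (extChartAt 𝓘(ℝ, F) x x) u v w = 0 := fun u v w ↦ by rw [← T.dTwo_eq, hc]
  have hcov : ∀ u v w : TangentSpace 𝓘(ℝ, F) x, covTwo T.fundamentalForm x u v w
      = Flat.covForm (coordMetric x) (coordEndo x T.J) (extChartAt 𝓘(ℝ, F) x x)
        (coframe x x u) (coframe x x v) (coframe x x w) := fun u v w ↦ by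
    rw [← T.covTwo_eq, frame_self_coframe, frame_self_coframe, frame_self_coframe]
  have hJc : ∀ u, coframe x x (T.J x u)
      = coordEndo x T.J (extChartAt 𝓘(ℝ, F) x x) (coframe x x u) := fun u ↦
    (coordEndo_eq x T.J (extChartAt_to_inv x) (mem_dom_self x) u).symm
  rw [codiffTwo, neg_eq_zero]
  refine trace_cov_eq_zero _ (T.J x).toLinearMap (T.J_J x) (T.inner_J_J x)
    (covTwo T.fundamentalForm x) ?_ ?_ ?_ ?_ ?_ ?_ v
  · intro v w
    have h := Flat.covForm_isLinear₁ (coordMetric x) (coordEndo x T.J) (extChartAt 𝓘(ℝ, F) x x)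
      (coframe x x v) (coframe x x w)
    exact ⟨fun a b ↦ by simp only [hcov, map_add, h.map_add],
      fun c a ↦ by simp only [hcov, map_smul, h.map_smul]⟩
  · intro u w
    have h := Flat.covForm_isLinear₂ (coordMetric x) (coordEndo x T.J) (extChartAt 𝓘(ℝ, F) x x)
      (coframe x x u) (coframe x x w)
    exact ⟨fun a b ↦ by simp only [hcov, map_add, h.map_add],
      fun c a ↦ by simp only [hcov, map_smul, h.map_smul]⟩
  · intro u v
    have h := Flat.covForm_isLinear₃ (coordMetric x) (coordEndo x T.J) (extChartAt 𝓘(ℝ, F) x x)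
      (coframe x x u) (coframe x x v)
    exact ⟨fun a b ↦ by simp only [hcov, map_add, h.map_add],
      fun c a ↦ by simp only [hcov, map_smul, h.map_smul]⟩
  · intro u v w
    simp only [hcov]
    exact Flat.covForm_swap hg hJ hs hJJ hgJ _ _ _
  · intro u v w
    simp only [hcov]
    exact Flat.covForm_cyclic hg hJ hs hJJ hgJ hc' _ _ _
  · intro u v w
    simp only [hcov, ContinuousLinearMap.coe_coe, hJc]
    exact Flat.covForm_J hg hJ hs hJJ hgJ _ _ _

/-- Both δΩ and dΩ vanish identically, so dδΩ and δdΩ vanish separately. -/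
theorem isHarmonic_of_closed
    (hc : ∀ (x : N) (u v w : TangentSpace 𝓘(ℝ, F) x), dTwo T.fundamentalForm x u v w = 0) :
    IsHarmonic T.fundamentalForm := by
  intro x u v
  have h0 : ∀ (x : N) (u : TangentSpace 𝓘(ℝ, F) x),
      mvfderiv 𝓘(ℝ, F) (fun _ : N ↦ (0 : ℝ)) x u = 0 := fun x u ↦ by
    rw [mvfderiv_eq]; simp
  have h1 : dOne (codiffTwo T.fundamentalForm) x u v = 0 := by
    simp only [dOne, codiffTwo_eq_zero hc, h0, sub_zero]
  have h2 : codiffThree (dTwo T.fundamentalForm) x u v = 0 := by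
    simp only [codiffThree, covThree, hc, h0, sub_zero, Finset.sum_const_zero, neg_zero]
  rw [h1, h2, add_zero]

end AlmostHermitian

/-- Every point of N lies under a point of M, and around that point the chart computation `closed_Ω`
applies. -/
theorem IsContactComplexSubmersion.closed_fundamentalForm
    {E : Type*} [NormedAddCommGroup E] [NormedSpace ℝ E] [FiniteDimensional ℝ E]
    {M : Type*} [TopologicalSpace M]
    [ChartedSpace E M] [IsManifold 𝓘(ℝ, E) ∞ M]
    [RiemannianBundle (fun x : M ↦ TangentSpace 𝓘(ℝ, E) x)]
    [IsContMDiffRiemannianBundle 𝓘(ℝ, E) ∞ E (fun x : M ↦ TangentSpace 𝓘(ℝ, E) x)]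
    {S : AlmostContactMetric E M} {T : AlmostHermitian F N} {f : M → N}
    (hf : IsContactComplexSubmersion S T f) (hcos : S.AlmostCosymplectic)
    (y : N) (u v w : TangentSpace 𝓘(ℝ, F) y) : dTwo T.fundamentalForm y u v w = 0 := by
  obtain ⟨x, rfl⟩ := hf.surjective y
  have h := (hf.localSubmersion hcos x).closed_Ω
  rw [coordMap_self] at h
  rw [← frame_self_coframe _ u, ← frame_self_coframe _ v, ← frame_self_coframe _ w, T.dTwo_eq, h]

end Harmonic

/-- The pull-back of a closed 1-form is closed. -/
lemma Flat.closed_pullback {E F : Type*} [NormedAddCommGroup E] [NormedSpace ℝ E]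
    [NormedAddCommGroup F] [NormedSpace ℝ F] {θ : E → E →L[ℝ] ℝ} {τ : F → F →L[ℝ] ℝ} {χ : E → F}
    {q : E} (hτ : DifferentiableAt ℝ τ (χ q)) (hχ : ContDiffAt ℝ 2 χ q)
    (h : ∀ᶠ z in 𝓝 q, ∀ v, θ z v = τ (χ z) (fderiv ℝ χ z v))
    (hc : ∀ u v, fderiv ℝ τ (χ q) u v = fderiv ℝ τ (χ q) v u) (u v : E) :
    fderiv ℝ θ q u v = fderiv ℝ θ q v u := by
  have hA : DifferentiableAt ℝ (fderiv ℝ χ) q :=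
    (hχ.fderiv_right (m := 1) (by norm_num)).differentiableAt one_ne_zero
  have hd : DifferentiableAt ℝ χ q := hχ.differentiableAt two_ne_zero
  have hτχ : DifferentiableAt ℝ (fun z ↦ τ (χ z)) q := DifferentiableAt.comp (g := τ) q hτ hd
  have hs : ∀ a b, fderiv ℝ (fderiv ℝ χ) q a b = fderiv ℝ (fderiv ℝ χ) q b a := fun a b ↦
    (hχ.isSymmSndFDerivAt (by simp)) a b
  have hθ : θ =ᶠ[𝓝 q] fun z ↦ (τ (χ z)).comp (fderiv ℝ χ z) := by
    filter_upwards [h] with z hz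
    ext v
    exact hz v
  have hθd : DifferentiableAt ℝ θ q := (hτχ.clm_comp hA).congr_of_eventuallyEq hθ
  have h2 : ∀ a, fderiv ℝ (fun z ↦ τ (χ z)) q a = fderiv ℝ τ (χ q) (fderiv ℝ χ q a) := fun a ↦ by
    rw [show (fun z ↦ τ (χ z)) = τ ∘ χ from rfl, fderiv_comp (g := τ) q hτ hd]
    rfl
  -- The part of the derivative coming from the second derivative of χ is symmetric, so it does not
  -- affect closedness.
  have key : ∀ a b, fderiv ℝ θ q a b = fderiv ℝ τ (χ q) (fderiv ℝ χ q a) (fderiv ℝ χ q b)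
      + τ (χ q) (fderiv ℝ (fderiv ℝ χ) q a b) := fun a b ↦ by
    have h3 : fderiv ℝ (fun z ↦ θ z b) q a = fderiv ℝ θ q a b := by
      rw [fderiv_clm_field hθd (differentiableAt_const b)]; simp
    have h4 : (fun z ↦ θ z b) =ᶠ[𝓝 q] fun z ↦ τ (χ z) (fderiv ℝ χ z b) := by
      filter_upwards [h] with z hz using hz b
    have h5 : fderiv ℝ (fun z ↦ fderiv ℝ χ z b) q a = fderiv ℝ (fderiv ℝ χ) q a b := by
      rw [fderiv_clm_field hA (differentiableAt_const b)]; simp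
    rw [← h3, fderiv_apply_congr h4,
      fderiv_clm_field hτχ (hA.clm_apply (differentiableAt_const b)), h2, h5]
  rw [key, key, hc, hs]

/-! ### Closedness of η at all points of one chart -/

section Transition

variable {E : Type*} [NormedAddCommGroup E] [NormedSpace ℝ E]
  {M : Type*} [TopologicalSpace M] [ChartedSpace E M] [IsManifold 𝓘(ℝ, E) ∞ M]

lemma mdifferentiableAt_chart_symm {x : M} {q : E} (hq : q ∈ (extChartAt 𝓘(ℝ, E) x).target) :
    MDifferentiableAt 𝓘(ℝ, E) 𝓘(ℝ, E) (extChartAt 𝓘(ℝ, E) x).symm q := by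
  have := mdifferentiableWithinAt_extChartAt_symm (I := 𝓘(ℝ, E)) hq
  rwa [modelWithCornersSelf_coe, Set.range_id, mdifferentiableWithinAt_univ] at this

lemma mfderiv_chart_symm {x : M} {q : E} (hq : q ∈ (extChartAt 𝓘(ℝ, E) x).target) :
    mfderiv 𝓘(ℝ, E) 𝓘(ℝ, E) (extChartAt 𝓘(ℝ, E) x).symm q
      = frame (E := E) x ((extChartAt 𝓘(ℝ, E) x).symm q) := by
  rw [← frame_eq_mfderiv hq, modelWithCornersSelf_coe, Set.range_id, mfderivWithin_univ]

lemma fderiv_transition {x y : M} {q : E} (hq : q ∈ (extChartAt 𝓘(ℝ, E) x).target)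
    (hq' : (extChartAt 𝓘(ℝ, E) x).symm q ∈ dom E y) (u : E) :
    fderiv ℝ (extChartAt 𝓘(ℝ, E) y ∘ (extChartAt 𝓘(ℝ, E) x).symm) q u
      = coframe y ((extChartAt 𝓘(ℝ, E) x).symm q)
        (frame x ((extChartAt 𝓘(ℝ, E) x).symm q) u) := by
  have h3 : MDifferentiableAt 𝓘(ℝ, E) 𝓘(ℝ, E) (extChartAt 𝓘(ℝ, E) y)
      ((extChartAt 𝓘(ℝ, E) x).symm q) :=
    mdifferentiableAt_extChartAt (by simpa [dom] using hq')
  have h4 := mfderiv_comp q h3 (mdifferentiableAt_chart_symm hq)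
  rw [mfderiv_eq_fderiv, mfderiv_chart_symm hq, ← coframe_eq_mfderiv hq'] at h4
  exact congrArg (fun T : E →L[ℝ] E ↦ T u) h4

lemma contDiffAt_transition {x y : M} {q : E} (hq : q ∈ (extChartAt 𝓘(ℝ, E) x).target)
    (hq' : (extChartAt 𝓘(ℝ, E) x).symm q ∈ dom E y) :
    ContDiffAt ℝ ∞ (extChartAt 𝓘(ℝ, E) y ∘ (extChartAt 𝓘(ℝ, E) x).symm) q := by
  rw [← contMDiffAt_iff_contDiffAt]
  have h1 : ContMDiffAt 𝓘(ℝ, E) 𝓘(ℝ, E) ∞ (extChartAt 𝓘(ℝ, E) x).symm q :=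
    (contMDiffOn_extChartAt_symm x).contMDiffAt
      ((isOpen_extChartAt_target (I := 𝓘(ℝ, E)) x).mem_nhds hq)
  have h2 : ContMDiffAt 𝓘(ℝ, E) 𝓘(ℝ, E) ∞ (extChartAt 𝓘(ℝ, E) y)
      ((extChartAt 𝓘(ℝ, E) x).symm q) := contMDiffAt_extChartAt' (by simpa [dom] using hq')
  exact h2.comp q h1

variable [FiniteDimensional ℝ E] [RiemannianBundle (fun x : M ↦ TangentSpace 𝓘(ℝ, E) x)]

/-- A closed 1-form is closed in every chart. -/
lemma AlmostContactMetric.closed_coordOne (S : AlmostContactMetric E M)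
    (hcl : ∀ (x : M) (u v : TangentSpace 𝓘(ℝ, E) x), dOne (fun y w ↦ S.η y w) x u v = 0)
    {x : M} {q : E} (hq : q ∈ (extChartAt 𝓘(ℝ, E) x).target) (u v : E) :
    fderiv ℝ (coordOne x S.η) q u v = fderiv ℝ (coordOne x S.η) q v u := by
  -- The exterior derivative at y is computed in the chart centred at y, whereas the Poincaré lemma
  -- needs closedness on a ball in a single chart. The two expressions of η differ by pull-back
  -- along the transition map.
  set y := (extChartAt 𝓘(ℝ, E) x).symm q with hy
  have hd : DifferentiableAt ℝ (coordOne y S.η) (extChartAt 𝓘(ℝ, E) y y) :=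
    ((contDiffOn_coordOne y S.contMDiff_η).contDiffAt
      (extChartAt_target_mem_nhds y)).differentiableAt (by simp)
  have hyq : (extChartAt 𝓘(ℝ, E) x).symm q ∈ dom E y := mem_dom_self (E := E) y
  have hdom : ∀ᶠ z in 𝓝 q, (extChartAt 𝓘(ℝ, E) x).symm z ∈ dom E y :=
    (mdifferentiableAt_chart_symm hq).continuousAt.eventually
      (extChartAt_source_mem_nhds (I := 𝓘(ℝ, E)) y)
  have ht : ∀ᶠ z in 𝓝 q, z ∈ (extChartAt 𝓘(ℝ, E) x).target :=
    (isOpen_extChartAt_target (I := 𝓘(ℝ, E)) x).mem_nhds hq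
  refine Flat.closed_pullback (τ := coordOne y S.η)
    (χ := extChartAt 𝓘(ℝ, E) y ∘ (extChartAt 𝓘(ℝ, E) x).symm) hd
    ((contDiffAt_transition hq hyq).of_le (by norm_cast)) ?_ ?_ u v
  · filter_upwards [hdom, ht] with z hz1 hz2 w
    rw [fderiv_transition hz2 hz1]
    have hs : (extChartAt 𝓘(ℝ, E) y).symm
        ((extChartAt 𝓘(ℝ, E) y ∘ (extChartAt 𝓘(ℝ, E) x).symm) z)
          = (extChartAt 𝓘(ℝ, E) x).symm z := (extChartAt 𝓘(ℝ, E) y).left_inv hz1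
    have key : ∀ a : M, a = (extChartAt 𝓘(ℝ, E) x).symm z →
        S.η a (frame y a (coframe y ((extChartAt 𝓘(ℝ, E) x).symm z)
          (frame x ((extChartAt 𝓘(ℝ, E) x).symm z) w)))
        = S.η ((extChartAt 𝓘(ℝ, E) x).symm z) (frame x ((extChartAt 𝓘(ℝ, E) x).symm z) w) := by
      rintro a rfl
      rw [frame_coframe hz1]
    exact (key _ hs).symm
  · intro a b
    have := dOne_eq y hd a b
    rw [hcl] at this
    change fderiv ℝ (coordOne y S.η) (extChartAt 𝓘(ℝ, E) y y) a b
      = fderiv ℝ (coordOne y S.η) (extChartAt 𝓘(ℝ, E) y y) b a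
    linarith

end Transition

/-! ### Integrability of J through the leaves of ker η -/

section Leaf

variable {K : Type*} [NormedAddCommGroup K] [NormedSpace ℝ K]

lemma frame_model (y z : K) : frame (M := K) y z = ContinuousLinearMap.id ℝ K :=
  TangentBundle.symmL_model_space (𝕜 := ℝ) y z

lemma coframe_model (y z : K) : coframe (M := K) y z = ContinuousLinearMap.id ℝ K :=
  TangentBundle.continuousLinearMapAt_model_space (𝕜 := ℝ) y z

lemma coordEndo_model (y : K) (J : K → K →L[ℝ] K) :
    coordEndo (M := K) y (fun z ↦ (J z : TangentSpace 𝓘(ℝ, K) z →L[ℝ] TangentSpace 𝓘(ℝ, K) z))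
      = J := by
  funext q
  have h1 := frame_model y q
  have h2 := coframe_model y q
  ext v
  have h3 : frame (M := K) y q v = v := congrArg (fun T : K →L[ℝ] K ↦ T v) h1
  exact (congrArg (fun T : K →L[ℝ] K ↦ T (J q (frame (M := K) y q v))) h2).trans
    (congrArg (J q) h3)

lemma nijenhuis_model {J : K → K →L[ℝ] K} {y : K} (hJ : DifferentiableAt ℝ J y)
    (hN : ∀ u v : TangentSpace 𝓘(ℝ, K) y, nijenhuis (M := K)
      (fun z ↦ (J z : TangentSpace 𝓘(ℝ, K) z →L[ℝ] TangentSpace 𝓘(ℝ, K) z)) y u v = 0)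
    (u v : K) : Flat.nijenhuis J y u v = 0 := by
  have h := nijenhuis_eq (M := K) y
    (J := fun z ↦ (J z : TangentSpace 𝓘(ℝ, K) z →L[ℝ] TangentSpace 𝓘(ℝ, K) z))
    (by rw [coordEndo_model]; exact hJ) u v
  rw [hN, map_zero, coordEndo_model] at h
  exact h.symm

end Leaf

/-- An endomorphism preserving the range of an injective map is induced from its source. -/
lemma exists_induced_endomorphism {K E : Type*} [NormedAddCommGroup K] [NormedSpace ℝ K]
    [FiniteDimensional ℝ K] [NormedAddCommGroup E] [NormedSpace ℝ E] [FiniteDimensional ℝ E]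
    (A : K →L[ℝ] E) (φ : E →L[ℝ] E) (hA : Function.Injective A)
    (h : ∀ v, φ (A v) ∈ Set.range A) : ∃ C : K →L[ℝ] K, ∀ v, A (C v) = φ (A v) := by
  obtain ⟨R, hR⟩ := LinearMap.exists_leftInverse_of_injective A.toLinearMap
    (LinearMap.ker_eq_bot.2 hA)
  refine ⟨(LinearMap.toContinuousLinearMap R) ∘L φ ∘L A, fun v ↦ ?_⟩
  obtain ⟨w, hw⟩ := h v
  have h1 : R (A w) = w := congrArg (fun T ↦ T w) hR
  change A (R (φ (A v))) = _
  rw [← hw, h1]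

section Base

variable {E : Type*} [NormedAddCommGroup E] [NormedSpace ℝ E] [FiniteDimensional ℝ E]
    {M : Type*} [TopologicalSpace M]
    [ChartedSpace E M] [IsManifold 𝓘(ℝ, E) ∞ M]
    [RiemannianBundle (fun x : M ↦ TangentSpace 𝓘(ℝ, E) x)]

section Immersion

variable {K : Type*} [NormedAddCommGroup K] [NormedSpace ℝ K] {x : M} {ζ : K → E}
  (hζ : ContDiff ℝ ∞ ζ) (ht : ∀ y, ζ y ∈ (extChartAt 𝓘(ℝ, E) x).target)
include hζ ht

lemma contMDiff_chart_symm_comp :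
    ContMDiff 𝓘(ℝ, K) 𝓘(ℝ, E) ∞ ((extChartAt 𝓘(ℝ, E) x).symm ∘ ζ) := by
  rw [← contMDiffOn_univ]
  exact (contMDiffOn_extChartAt_symm x).comp hζ.contMDiff.contMDiffOn fun y _ ↦ ht y

lemma mfderiv_chart_symm_comp (y : K) (v : K) :
    mfderiv 𝓘(ℝ, K) 𝓘(ℝ, E) ((extChartAt 𝓘(ℝ, E) x).symm ∘ ζ) y v
      = frame x ((extChartAt 𝓘(ℝ, E) x).symm (ζ y)) (fderiv ℝ ζ y v) := by
  have h1 : MDifferentiableAt 𝓘(ℝ, K) 𝓘(ℝ, E) ζ y :=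
    ((hζ.differentiable (by simp)) y).mdifferentiableAt
  have h4 := mfderiv_comp y (mdifferentiableAt_chart_symm (ht y)) h1
  rw [mfderiv_eq_fderiv, mfderiv_chart_symm (ht y)] at h4
  exact congrArg (fun T : K →L[ℝ] E ↦ T v) h4

end Immersion

/-- The derivative of the inverse chart is the coordinate frame, an isomorphism at each point, so
injectivity and the description of the range carry over from ζ. -/
lemma AlmostContactMetric.isIntegralManifold (S : AlmostContactMetric E M) {k : ℕ}
    {ζ : EuclideanSpace ℝ (Fin k) → E} {x : M} (hζ : ContDiff ℝ ∞ ζ)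
    (ht : ∀ y, ζ y ∈ (extChartAt 𝓘(ℝ, E) x).target)
    (hi : ∀ y, Function.Injective (fderiv ℝ ζ y))
    (hr : ∀ y, Set.range (fderiv ℝ ζ y) = {v | coordOne x S.η (ζ y) v = 0}) :
    S.IsIntegralManifold k ((extChartAt 𝓘(ℝ, E) x).symm ∘ ζ) := by
  refine ⟨contMDiff_chart_symm_comp hζ ht, fun y ↦ ?_⟩
  have hy := (extChartAt 𝓘(ℝ, E) x).map_target (ht y)
  constructor
  · intro u v huv
    have h1 := (mfderiv_chart_symm_comp hζ ht y u).symm.trans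
      (huv.trans (mfderiv_chart_symm_comp hζ ht y v))
    have h2 := congrArg (coframe x ((extChartAt 𝓘(ℝ, E) x).symm (ζ y))) h1
    rw [coframe_frame hy, coframe_frame hy] at h2
    exact hi y h2
  · ext w
    constructor
    · rintro ⟨v, rfl⟩
      have h1 : fderiv ℝ ζ y v ∈ {v | coordOne x S.η (ζ y) v = 0} := hr y ▸ ⟨v, rfl⟩
      exact (congrArg (S.η _) (mfderiv_chart_symm_comp hζ ht y v)).trans h1
    · intro hw
      have h1 : coframe x _ w ∈ Set.range (fderiv ℝ ζ y) := by
        rw [hr y]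
        exact (coordOne_coframe x S.η hy w).trans hw
      obtain ⟨v, hv⟩ := h1
      refine ⟨v, (mfderiv_chart_symm_comp hζ ht y v).trans ?_⟩
      rw [hv]
      exact frame_coframe hy w

variable
    [IsContMDiffRiemannianBundle 𝓘(ℝ, E) ∞ E (fun x : M ↦ TangentSpace 𝓘(ℝ, E) x)]
    {F : Type*} [NormedAddCommGroup F] [NormedSpace ℝ F] [FiniteDimensional ℝ F]
    {N : Type*} [TopologicalSpace N]
    [ChartedSpace F N] [IsManifold 𝓘(ℝ, F) ∞ N]
    [RiemannianBundle (fun x : N ↦ TangentSpace 𝓘(ℝ, F) x)]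
    [IsContMDiffRiemannianBundle 𝓘(ℝ, F) ∞ F (fun x : N ↦ TangentSpace 𝓘(ℝ, F) x)]
    {S : AlmostContactMetric E M} {T : AlmostHermitian F N} {f : M → N}

/-- A leaf of ker η through x with its induced complex structure is mapped holomorphically to N,
submersively at x. Naturality makes the Nijenhuis tensor of J at f(x) the image of that of the leaf,
which vanishes. -/
theorem IsContactComplexSubmersion.nijenhuis_eq_zero (hf : IsContactComplexSubmersion S T f)
    (hcos : S.AlmostCosymplectic) (hleaves : S.HasKahlerLeaves)
    (b : N) (u v : TangentSpace 𝓘(ℝ, F) b) : nijenhuis T.J b u v = 0 := by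
  obtain ⟨x, rfl⟩ := hf.surjective b
  have h := hf.localSubmersion hcos x
  set p := extChartAt 𝓘(ℝ, E) x x with hp
  have ho := isOpen_extChartAt_target (I := 𝓘(ℝ, E)) x
  have htp : (extChartAt 𝓘(ℝ, E) x).target ∈ 𝓝 p := extChartAt_target_mem_nhds x
  have hf2 : ∀ᶠ q in 𝓝 p, ContDiffAt ℝ 2 (coordMap E F x f) q := h.diff_f.eventually (by simp)
  have hs := (Filter.Eventually.and htp h.contact).and (h.hol.and hf2)
  obtain ⟨k, ζ, hζ, hζ0, hζs, hζr⟩ := Flat.exists_integral_manifold (η := coordOne x S.η) hs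
    (by filter_upwards [htp] with q hq using
          (contDiffOn_coordOne x S.contMDiff_η).contDiffAt (ho.mem_nhds hq))
    (by filter_upwards [htp] with q hq using S.closed_coordOne hcos.1 hq)
    h.η_ξ.self_of_nhds
  have ht : ∀ y, ζ y ∈ (extChartAt 𝓘(ℝ, E) x).target := fun y ↦ (hζs y).1.1
  have hC : ∀ y, ∃ C : EuclideanSpace ℝ (Fin k) →L[ℝ] EuclideanSpace ℝ (Fin k),
      ∀ v, fderiv ℝ ζ y (C v) = coordEndo x S.φ (ζ y) (fderiv ℝ ζ y v) := fun y ↦ by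
    refine exists_induced_endomorphism _ _ (hζr y).1 fun v ↦ ?_
    rw [(hζr y).2]
    -- η ∘ φ = 0, so φ preserves the tangent spaces of the leaf.
    exact (hζs y).1.2.η_φ _
  choose J hJ using hC
  have hζd : Differentiable ℝ ζ := hζ.differentiable (by simp)
  have hA : DifferentiableAt ℝ (fderiv ℝ ζ) 0 :=
    ((hζ.contDiffAt (x := 0)).fderiv_right (m := 1) (by norm_cast)).differentiableAt one_ne_zero
  have hφζ : DifferentiableAt ℝ (fun y ↦ coordEndo x S.φ (ζ y)) 0 :=
    DifferentiableAt.comp (g := coordEndo x S.φ) 0 (by rw [hζ0]; exact h.diff_φ) (hζd 0)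
  -- The induced `J` was chosen point by point; its differentiability comes from the intertwining
  -- relation with the immersion.
  have hJd : DifferentiableAt ℝ J 0 :=
    Flat.differentiableAt_of_intertwine hA (hφζ.clm_comp hA) (hζr 0).1
      (Eventually.of_forall fun y v ↦ hJ y v)
  have hK := hleaves k (EuclideanSpace ℝ (Fin k)) _
    (S.isIntegralManifold hζ ht (fun y ↦ (hζr y).1) fun y ↦ (hζr y).2) J (by
      intro y v
      have hy := (extChartAt 𝓘(ℝ, E) x).map_target (ht y)
      refine (mfderiv_chart_symm_comp hζ ht y (J y v)).trans ?_
      refine (congrArg (frame x _) (hJ y v)).trans ?_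
      refine (frame_coframe hy _).trans ?_
      exact congrArg (S.φ _) (mfderiv_chart_symm_comp hζ ht y v).symm)
  have hN : ∀ a b, Flat.nijenhuis J 0 a b = 0 := nijenhuis_model hJd (hK.1 0)
  have hcomp : ∀ y v, fderiv ℝ (coordMap E F x f ∘ ζ) y v
      = fderiv ℝ (coordMap E F x f) (ζ y) (fderiv ℝ ζ y v) := fun y v ↦ by
    rw [fderiv_comp y ((hζs y).2.2.differentiableAt two_ne_zero) (hζd y)]
    rfl
  have hp0 : (coordMap E F x f ∘ ζ) 0 = extChartAt 𝓘(ℝ, F) (f x) (f x) := by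
    rw [Function.comp_apply, hζ0, hp, coordMap_self]
  have hmap := Flat.nijenhuis_map (J' := coordEndo (f x) T.J) (f := coordMap E F x f ∘ ζ) hJd
    (by rw [hp0]; exact T.differentiableAt_J (f x))
    ((hζs 0).2.2.comp 0 (hζ.contDiffAt.of_le (by norm_cast)))
    (Eventually.of_forall fun y v ↦ by
      rw [hcomp, hcomp, hJ]
      exact (hζs y).2.1 _)
  have hsurj : ∀ w, ∃ a, fderiv ℝ (coordMap E F x f ∘ ζ) 0 a = w := fun w ↦ by
    obtain ⟨z, rfl⟩ := h.surj.self_of_nhds w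
    -- Subtracting the ξ-component makes a vector tangent to the leaf without changing its image,
    -- since ξ is vertical.
    have h1 : z - coordOne x S.η p z • coord x S.ξ p ∈ Set.range (fderiv ℝ ζ 0) := by
      rw [(hζr 0).2, hζ0]
      simp [h.η_ξ.self_of_nhds]
    obtain ⟨a, ha⟩ := h1
    refine ⟨a, ?_⟩
    rw [hcomp, ha, hζ0, map_sub, map_smul, h.ver_ξ.self_of_nhds, smul_zero, sub_zero]
  obtain ⟨a, ha⟩ := hsurj (coframe (f x) (f x) u)
  obtain ⟨c, hc⟩ := hsurj (coframe (f x) (f x) v)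
  have hfin := nijenhuis_eq (f x) (T.differentiableAt_J (f x)) 
    (coframe (f x) (f x) u) (coframe (f x) (f x) v)
  rw [← ha, ← hc, ← hp0, hmap, hN, map_zero, ha, hc, frame_self_coframe, frame_self_coframe] at hfin
  exact (map_eq_zero_iff _ (coframe_injective (mem_dom_self (f x)))).1 hfin

end Base

end ContactComplex

end

theorem mainTheorem2
    {E : Type*} [NormedAddCommGroup E] [NormedSpace ℝ E] [FiniteDimensional ℝ E]
    {M : Type*} [TopologicalSpace M] [T2Space M] [SecondCountableTopology M]
    [ChartedSpace E M] [IsManifold 𝓘(ℝ, E) ∞ M]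
    [RiemannianBundle (fun x : M ↦ TangentSpace 𝓘(ℝ, E) x)]
    [IsContMDiffRiemannianBundle 𝓘(ℝ, E) ∞ E (fun x : M ↦ TangentSpace 𝓘(ℝ, E) x)]
    {F : Type*} [NormedAddCommGroup F] [NormedSpace ℝ F] [FiniteDimensional ℝ F]
    {N : Type*} [TopologicalSpace N] [T2Space N] [SecondCountableTopology N]
    [ChartedSpace F N] [IsManifold 𝓘(ℝ, F) ∞ N]
    [RiemannianBundle (fun x : N ↦ TangentSpace 𝓘(ℝ, F) x)]
    [IsContMDiffRiemannianBundle 𝓘(ℝ, F) ∞ F (fun x : N ↦ TangentSpace 𝓘(ℝ, F) x)]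
    (S : ContactComplex.AlmostContactMetric E M) (T : ContactComplex.AlmostHermitian F N)
    (f : M → N) (hf : ContactComplex.IsContactComplexSubmersion S T f)
    (hcos : S.AlmostCosymplectic) (hleaves : S.HasKahlerLeaves) :
    (T.Kahler ↔ ∀ (x : M), ∀ u ∈ ContactComplex.horizontal E F f x,
        ContactComplex.oneillA F f u S.ξ = 0) ∧
      (ContactComplex.IsHarmonic T.fundamentalForm ↔
        ∀ x : M, ContactComplex.traceBh F S f x = 0) := by
  have hclosed := hf.closed_fundamentalForm hcos
  -- Under the standing hypotheses both sides of each equivalence are true.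
  refine ⟨iff_of_true ⟨hf.nijenhuis_eq_zero hcos hleaves, hclosed⟩
      fun x u _ ↦ hf.oneillA_eq_zero hcos u (S.differentiableAt_ξ x),
    iff_of_true (ContactComplex.AlmostHermitian.isHarmonic_of_closed hclosed) fun x ↦ ?_⟩
  exact Finset.sum_eq_zero fun i _ ↦
    hf.tensorB_eq_zero hcos _ (ContactComplex.differentiableAt_coord_ext _)
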